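/- Let $(Z_i)_{i\ge 1}$ be iid real random variables with $Z_1\in RV_{-\alpha}$, $\alpha>1$. This means: for some regularly varying sequence $a_n>0$, the measures $a_n P(Z_1/n\in\cdot)$ converge in $\mathbb M(\mathbb R\setminus\{0\})$ to a non-zero measure $\mu$ with $\mu(sA)=s^{-\alpha}\mu(A)$ for all $s>0$ and all Borel sets $A\subset\mathbb R\setminus\{0\}$, and, for some $p\in[0,1]$ and $q=1-p$, $P(Z_1>n)/P(|Z_1|>n)\to p$ and $P(Z_1<-n)/P(|Z_1|>n)\to q$. Let $\nu_\alpha$ be the measure on $\mathbb R\setminus\{0\}$ with $\nu_\alpha((-\infty,-y)\cup(x,\infty))=q\,y^{-\alpha}+p\,x^{-\alpha}$ for $x,y>0$. Here, for a closed subset $C$ of a metric space $S$, $\mathbb M(S\setminus C)$ is the set of Borel measures on $S\setminus C$ that are finite on Borel sets bounded away from $C$ (sets $A$ with $\inf\{d(x,y):x\in A,\,y\in C\}>0$), and $\mu_n\to\mu_0$ in $\mathbb M(S\setminus C)$ means that $\limsup_n\mu_n(F)\le\mu_0(F)$ for all closed sets $F$ and $\liminf_n\mu_n(G)\ge\mu_0(G)$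 for all open sets $G$ that are bounded away from $C$. Let $M>0$ (for instance $M=1$) and let $\mathbb D=\mathbb D([0,M],\mathbb R)$ be the space of real c\`adl\`ag functions on $[0,M]$ with the Skorohod metric $d_{J_1}(f,g)=\inf_\lambda\max\{\sup_t|f(t)-g(\lambda(t))|,\ \sup_t|\lambda(t)-t|\}$, the infimum being over all strictly increasing continuous bijections $\lambda$ of $[0,M]$. Let $\boldsymbol X^{(n)}(t)=\sum_{k=1}^{\lfloor nt\rfloor}Z_k$ for $t\in[0,M]$. For $j\ge 0$ let $U_j^\uparrow=\{\boldsymbol u\in[0,M]^j: 0\le u_1<\dots<u_j\le M\}$. Then $m=E[Z_1]$ exists. For $j\ge 0$ define $$h_j^m:(\mathbb R\setminus\{0\})^j\times U_j^\uparrow\to\mathbb D,\qquad h_j^m(\boldsymbol z,\boldsymbol u)(t)=\sum_{i=1}^j z_i\mathbf 1\{u_i\le t\}+mt,$$ let $\mathbb D^m_{=j}$ be the image of $h_j^m$ (so $\mathbb D^m_{=0}=\{t\mapsto mt\}$), and put $\mathbb D^m_{\le j}=\bigcup_{i=0}^j\mathbb D^m_{=i}$, which is closed in $\mathbb D$. Then,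 for every $j\ge 1$, with $\gamma_n^{(j)}=[\,n\,P(|Z_1|>n)\,]^{-j}$, $$\gamma_n^{(j)}\,P(\boldsymbol X^{(n)}/n\in\cdot\,)\ \longrightarrow\ (\nu_\alpha^j\times\mathrm{Leb}_j)\circ(h_j^m)^{-1}(\cdot)\qquad(n\to\infty)$$ in $\mathbb M(\mathbb D\setminus\mathbb D^m_{\le j-1})$. -/

import Mathlib

open MeasureTheory ProbabilityTheory Filter Topology Set
open scoped ENNReal

noncomputable section

namespace HiddenLD

/-! ### Convergence in `𝕄(S \ C)` -/

section MO

variable {S : Type*} [PseudoEMetricSpace S] [MeasurableSpace S]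

/-- `μ ∈ 𝕄(S \ C)`: finite on every Borel set bounded away from `C`. A measure on `S \ C` is
represented by a measure on `S`; only its values on sets bounded away from `C` are ever used. -/
def FiniteAwayFrom (C : Set S) (μ : Measure S) : Prop :=
  ∀ A : Set S, MeasurableSet A → Metric.AreSeparated A C → μ A < ∞

/-- `μ n → μ₀` in `𝕄(S \ C)` as `n → ∞`, for a closed set `C`. -/
structure TendstoMO (C : Set S) (μ : ℕ → Measure S) (μ₀ : Measure S) : Prop where
  isClosed : IsClosed C
  finite_seq : ∀ n, FiniteAwayFrom C (μ n)
  finite_lim : FiniteAwayFrom C μ₀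
  limsup_le : ∀ F : Set S, IsClosed F → Metric.AreSeparated F C →
    limsup (fun n => μ n F) atTop ≤ μ₀ F
  le_liminf : ∀ G : Set S, IsOpen G → Metric.AreSeparated G C →
    μ₀ G ≤ liminf (fun n => μ n G) atTop

end MO

/-! ### Regular variation -/

/-- A sequence of positive numbers `(a n)`, `n ≥ 1`, is regularly varying with index `ρ`. -/
def RegVarSeq (a : ℕ → ℝ) (ρ : ℝ) : Prop :=
  (∀ n, 1 ≤ n → 0 < a n) ∧
    ∀ c : ℝ, 0 < c → Tendsto (fun n : ℕ => a ⌊c * n⌋₊ / a n) atTop (𝓝 (c ^ ρ))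

/-- `X ∈ RV_{-α}`, with the tail balance condition with constants `p` and `q = 1 - p`. -/
structure IsRegVar {Ω : Type*} [MeasurableSpace Ω] (P : Measure Ω) (X : Ω → ℝ) (α p : ℝ) :
    Prop where
  /-- `γ n • P(X / n ∈ ·)` converges in `𝕄(ℝ \ {0})` to a nonzero measure that is homogeneous
  of order `-α`, for some regularly varying sequence `γ`. -/
  exists_limit : ∃ (γ : ℕ → ℝ) (ρ : ℝ) (μ : Measure ℝ), RegVarSeq γ ρ ∧ μ {0} = 0 ∧ μ ≠ 0 ∧
    TendstoMO {0} (fun n => ENNReal.ofReal (γ n) • P.map (fun ω => X ω / n)) μ ∧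
    ∀ s : ℝ, 0 < s → ∀ A : Set ℝ, MeasurableSet A → A ⊆ {0}ᶜ →
      μ ((fun x => s * x) '' A) = ENNReal.ofReal (s ^ (-α)) * μ A
  p_nonneg : 0 ≤ p
  p_le_one : p ≤ 1
  tail_pos : Tendsto (fun n : ℕ => P.real {ω | (n : ℝ) < X ω} / P.real {ω | (n : ℝ) < |X ω|})
    atTop (𝓝 p)
  tail_neg : Tendsto (fun n : ℕ => P.real {ω | X ω < -(n : ℝ)} / P.real {ω | (n : ℝ) < |X ω|})
    atTop (𝓝 (1 - p))

/-- The measure `ν_α`, extended by `ν_α {0} = 0`, through its density `p α x ^ (-α - 1)` on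
`(0, ∞)` and `q α |x| ^ (-α - 1)` on `(-∞, 0)`, `q = 1 - p`; see `nuAlpha_tails`. -/
def nuAlpha (α p : ℝ) : Measure ℝ :=
  volume.withDensity fun x =>
    ENNReal.ofReal (if 0 < x then p * (α * x ^ (-α - 1))
      else if x < 0 then (1 - p) * (α * (-x) ^ (-α - 1)) else 0)

theorem nuAlpha_tails {α p : ℝ} (hα : 0 < α) (hp₀ : 0 ≤ p) (hp₁ : p ≤ 1) {x y : ℝ}
    (hx : 0 < x) (hy : 0 < y) :
    nuAlpha α p (Iio (-y) ∪ Ioi x) =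
      ENNReal.ofReal ((1 - p) * y ^ (-α) + p * x ^ (-α)) := by
  have key : ∀ k c : ℝ, 0 ≤ k → 0 < c →
      ∫⁻ t in Ioi c, ENNReal.ofReal (k * (α * t ^ (-α - 1))) =
        ENNReal.ofReal (k * c ^ (-α)) := by
    intro k c hk hc
    have hi : IntegrableOn (fun t : ℝ => k * (α * t ^ (-α - 1))) (Ioi c) :=
      ((integrableOn_Ioi_rpow_of_lt (by linarith) hc).const_mul α).const_mul k
    rw [← ofReal_integral_eq_lintegral_ofReal hi]
    · rw [integral_const_mul, integral_const_mul, integral_Ioi_rpow_of_lt (by linarith) hc]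
      congr 2
      rw [sub_add_cancel]
      field_simp
    · filter_upwards [ae_restrict_mem measurableSet_Ioi] with t ht
      have : 0 < t := hc.trans ht
      positivity
  have hdisj : Disjoint (Iio (-y)) (Ioi x) :=
    Set.disjoint_left.2 fun t h1 h2 => by
      have h1' : t < -y := h1
      have h2' : x < t := h2
      linarith
  rw [measure_union hdisj measurableSet_Ioi, nuAlpha, withDensity_apply _ measurableSet_Iio,
    withDensity_apply _ measurableSet_Ioi,
    ENNReal.ofReal_add (mul_nonneg (by linarith) (Real.rpow_nonneg hy.le _))
      (mul_nonneg hp₀ (Real.rpow_nonneg hx.le _)),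
    ← key (1 - p) y (by linarith) hy, ← key p x hp₀ hx]
  congr 1
  · have hpre : Neg.neg ⁻¹' Iio (-y) = Ioi y := by
      ext t; simp
    rw [← (Measure.measurePreserving_neg (volume : Measure ℝ)).setLIntegral_comp_preimage_emb
      (MeasurableEquiv.neg ℝ).measurableEmbedding, hpre]
    refine setLIntegral_congr_fun measurableSet_Ioi fun t ht => ?_
    have ht' : 0 < t := hy.trans ht
    simp only [if_neg (show ¬ 0 < -t by linarith), if_pos (show -t < 0 by linarith), neg_neg]
  · refine setLIntegral_congr_fun measurableSet_Ioi fun t ht => ?_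
    simp only [if_pos (hx.trans ht)]

/-! ### The space `𝔻` of càdlàg functions on `[0, M]` with the Skorohod `J₁` metric -/

/-- Right continuous with left limits. -/
def IsCadlag {T : Type*} [TopologicalSpace T] [Preorder T] (f : T → ℝ) : Prop :=
  ∀ t, ContinuousWithinAt f (Ici t) t ∧ ∃ l, Tendsto f (𝓝[<] t) (𝓝 l)

/-- The space `𝔻([0, M], ℝ)`. -/
structure SkorohodSpace (M : ℝ) where
  toFun : Icc (0 : ℝ) M → ℝ
  cadlag : IsCadlag toFun

namespace SkorohodSpace

variable {M : ℝ}

/-- The `J₁` distance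
`inf_λ max (sup_t |f t - g (λ t)|, sup_t |λ t - t|)`, where `λ` ranges over the strictly
increasing continuous functions of `[0, M]` onto itself, that is, its order automorphisms. -/
def dJ1 (f g : SkorohodSpace M) : ℝ≥0∞ :=
  ⨅ l : Icc (0 : ℝ) M ≃o Icc (0 : ℝ) M,
    max (⨆ t, edist (f.toFun t) (g.toFun (l t))) (⨆ t, edist (l t) t)

theorem dJ1_self (f : SkorohodSpace M) : dJ1 f f = 0 := by
  refine le_antisymm ((iInf_le _ (OrderIso.refl _)).trans ?_) zero_le
  simp

theorem dJ1_comm_le (f g : SkorohodSpace M) : dJ1 f g ≤ dJ1 g f := by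
  refine le_iInf fun l => (iInf_le _ l.symm).trans ?_
  refine max_le_max (iSup_le fun t => ?_) (iSup_le fun t => ?_)
  · refine le_trans (le_of_eq ?_) (le_iSup _ (l.symm t))
    rw [l.apply_symm_apply, edist_comm]
  · refine le_trans (le_of_eq ?_) (le_iSup _ (l.symm t))
    rw [l.apply_symm_apply, edist_comm]

theorem dJ1_triangle (f g h : SkorohodSpace M) : dJ1 f h ≤ dJ1 f g + dJ1 g h := by
  unfold dJ1
  rw [ENNReal.iInf_add]
  refine le_iInf fun l => ?_
  rw [ENNReal.add_iInf]
  refine le_iInf fun k => (iInf_le _ (l.trans k)).trans ?_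
  refine max_le (iSup_le fun t => ?_) (iSup_le fun t => ?_)
  · refine (edist_triangle _ (g.toFun (l t)) _).trans (add_le_add ?_ ?_)
    · exact le_max_of_le_left (le_iSup (fun t => edist (f.toFun t) (g.toFun (l t))) t)
    · exact le_max_of_le_left (le_iSup (fun t => edist (g.toFun t) (h.toFun (k t))) (l t))
  · refine (edist_triangle _ (l t) _).trans ?_
    rw [add_comm]
    refine add_le_add ?_ ?_
    · exact le_max_of_le_right (le_iSup (fun t => edist (l t) t) t)
    · exact le_max_of_le_right (le_iSup (fun t => edist (k t) t) (l t))

instance : PseudoEMetricSpace (SkorohodSpace M) where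
  edist := dJ1
  edist_self := dJ1_self
  edist_comm f g := le_antisymm (dJ1_comm_le f g) (dJ1_comm_le g f)
  edist_triangle := dJ1_triangle

instance : MeasurableSpace (SkorohodSpace M) := borel _

instance : BorelSpace (SkorohodSpace M) := ⟨rfl⟩

end SkorohodSpace

/-! ### Càdlàg building blocks -/

theorem IsCadlag.add {T : Type*} [TopologicalSpace T] [Preorder T] {f g : T → ℝ}
    (hf : IsCadlag f) (hg : IsCadlag g) : IsCadlag fun t => f t + g t := fun t =>
  ⟨(hf t).1.add (hg t).1, by
    obtain ⟨a, ha⟩ := (hf t).2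
    obtain ⟨b, hb⟩ := (hg t).2
    exact ⟨a + b, ha.add hb⟩⟩

theorem isCadlag_of_continuous {T : Type*} [TopologicalSpace T] [Preorder T] {f : T → ℝ}
    (hf : Continuous f) : IsCadlag f := fun t =>
  ⟨hf.continuousWithinAt, f t, hf.continuousWithinAt⟩

theorem IsCadlag.sum {T ι : Type*} [TopologicalSpace T] [Preorder T] (s : Finset ι)
    {f : ι → T → ℝ} (hf : ∀ i, IsCadlag (f i)) : IsCadlag fun t => ∑ i ∈ s, f i t := by
  classical
  induction s using Finset.induction_on with
  | empty => simpa using isCadlag_of_continuous (T := T) (f := fun _ => (0 : ℝ)) continuous_const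
  | insert a s ha ih => simpa only [Finset.sum_insert ha] using (hf a).add ih

theorem isCadlag_jump {M : ℝ} (z u : ℝ) :
    IsCadlag fun t : Icc (0 : ℝ) M => if u ≤ (t : ℝ) then z else 0 := by
  intro t
  have hc : Continuous fun s : Icc (0 : ℝ) M => (s : ℝ) := continuous_subtype_val
  constructor
  · by_cases h : u ≤ (t : ℝ)
    · refine (continuousWithinAt_const (b := z)).congr (fun s hs => ?_) (if_pos h)
      exact if_pos (h.trans hs)
    · refine ((continuousAt_const (y := (0 : ℝ))).congr ?_).continuousWithinAt
      filter_upwards [hc.continuousAt.eventually_lt_const (not_le.1 h)] with s hs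
      exact (if_neg (not_le.2 hs)).symm
  · by_cases h : u < (t : ℝ)
    · refine ⟨z, tendsto_const_nhds.congr' ?_⟩
      filter_upwards [nhdsWithin_le_nhds (hc.continuousAt.eventually_const_lt h)] with s hs
      exact (if_pos hs.le).symm
    · refine ⟨0, tendsto_const_nhds.congr' ?_⟩
      filter_upwards [self_mem_nhdsWithin] with s hs
      have hs' : (s : ℝ) < t := hs
      exact (if_neg (not_le.2 (hs'.trans_le (not_lt.1 h)))).symm

theorem isCadlag_floor {M : ℝ} (n : ℕ) (g : ℕ → ℝ) :
    IsCadlag fun t : Icc (0 : ℝ) M => g ⌊(n : ℝ) * t⌋₊ := by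
  rcases Nat.eq_zero_or_pos n with rfl | hn
  · simpa using isCadlag_of_continuous (T := Icc (0 : ℝ) M) (f := fun _ => g 0) continuous_const
  have hn' : (0 : ℝ) < n := by exact_mod_cast hn
  have hc : Continuous fun s : Icc (0 : ℝ) M => (n : ℝ) * (s : ℝ) := by fun_prop
  intro t
  constructor
  · have h1 : Tendsto (fun s : Icc (0 : ℝ) M => (n : ℝ) * (s : ℝ)) (𝓝[≥] t)
        (𝓝[≥] ((n : ℝ) * (t : ℝ))) :=
      tendsto_nhdsWithin_iff.2 ⟨hc.continuousWithinAt, by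
        filter_upwards [self_mem_nhdsWithin] with s hs
        exact mul_le_mul_of_nonneg_left hs hn'.le⟩
    have h2 := tendsto_pure.1 ((tendsto_floor_right_pure_floor ((n : ℝ) * (t : ℝ))).comp h1)
    refine (tendsto_const_nhds (x := g ⌊(n : ℝ) * t⌋₊)).congr' ?_
    filter_upwards [h2] with s hs
    simp only [Function.comp_apply] at hs
    rw [← Int.floor_toNat, ← Int.floor_toNat, hs]
  · have h1 : Tendsto (fun s : Icc (0 : ℝ) M => (n : ℝ) * (s : ℝ)) (𝓝[<] t)
        (𝓝[<] ((n : ℝ) * (t : ℝ))) :=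
      tendsto_nhdsWithin_iff.2 ⟨hc.continuousWithinAt, by
        filter_upwards [self_mem_nhdsWithin] with s hs
        exact mul_lt_mul_of_pos_left hs hn'⟩
    have h2 := tendsto_pure.1 ((tendsto_floor_left_pure_ceil_sub_one ((n : ℝ) * (t : ℝ))).comp h1)
    refine ⟨g (⌈(n : ℝ) * t⌉ - 1).toNat, tendsto_const_nhds.congr' ?_⟩
    filter_upwards [h2] with s hs
    simp only [Function.comp_apply] at hs
    rw [← Int.floor_toNat, hs]

/-! ### Random walk paths, step functions with drift, and the limit measure -/

/-- The path `t ↦ S_⌊nt⌋ / n`, `t ∈ [0, M]`, where `S_k` is the sum of the first `k` terms of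
`z`. -/
def walkPath (M : ℝ) (n : ℕ) (z : ℕ → ℝ) : SkorohodSpace M where
  toFun t := (∑ k ∈ Finset.range ⌊(n : ℝ) * t⌋₊, z k) / n
  cadlag := isCadlag_floor n fun N => (∑ k ∈ Finset.range N, z k) / n

/-- The set `U_j^↑` of jump times `0 ≤ u_1 < ⋯ < u_j ≤ M`. -/
def jumpTimes (M : ℝ) (j : ℕ) : Set (Fin j → ℝ) :=
  {u | StrictMono u ∧ ∀ i, u i ∈ Icc 0 M}

/-- The domain `(ℝ \ {0})^j × U_j^↑` of `h_j^m`. -/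
def jumpDomain (M : ℝ) (j : ℕ) : Set ((Fin j → ℝ) × (Fin j → ℝ)) :=
  {z | ∀ i, z i ≠ 0} ×ˢ jumpTimes M j

/-- The map `h_j^m`, given on its domain `jumpDomain M j` and beyond by one formula. -/
def stepDrift (M m : ℝ) (j : ℕ) (q : (Fin j → ℝ) × (Fin j → ℝ)) : SkorohodSpace M where
  toFun t := (∑ i, if q.2 i ≤ (t : ℝ) then q.1 i else 0) + m * t
  cadlag := (IsCadlag.sum Finset.univ fun i => isCadlag_jump (q.1 i) (q.2 i)).add
    (isCadlag_of_continuous (by fun_prop))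

/-- `𝔻_{=j}^m`. -/
def stepEq (M m : ℝ) (j : ℕ) : Set (SkorohodSpace M) :=
  stepDrift M m j '' jumpDomain M j

/-- `𝔻_{≤j}^m`. -/
def stepLE (M m : ℝ) (j : ℕ) : Set (SkorohodSpace M) :=
  ⋃ i ∈ Finset.range (j + 1), stepEq M m i

/-- The measure `(ν_α^j × Leb_j) ∘ (h_j^m)⁻¹` on `𝔻`. -/
def limitMeasure (M m α p : ℝ) (j : ℕ) : Measure (SkorohodSpace M) :=
  (((Measure.pi fun _ : Fin j => nuAlpha α p).prod volume).restrict (jumpDomain M j)).map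
    (stepDrift M m j)

/-- The rate `γ_n^{(j)} = (n P(|X| > n))^{-j}`. -/
def rate {Ω : Type*} [MeasurableSpace Ω] (P : Measure Ω) (X : Ω → ℝ) (j n : ℕ) : ℝ :=
  ((n * P.real {ω | (n : ℝ) < |X ω|}) ^ j)⁻¹

end HiddenLD

end

/-!
Truncate the jumps at level `n δ`. At every polynomial rate, the truncated centred walk deviates by
more than `n ε` with negligible probability: this is the exponential Chebyshev bound with parameter
`A log n / n` and a moment of order `κ` with `1 < κ < α`. So, at the rate `γ_n^{(j)}`, the path
`X^{(n)} / n` is uniformly close to the step function with drift `m` made of its large jumps alone.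

More than `j` large jumps have probability of order `(n P(|Z| > n)) ^ (j + 1)`, while fewer than `j`
keep the path close to `𝔻_{≤ j - 1}^m`. On the event of exactly `j` large jumps, the rescaled jumps
and their times on the grid `k / n` have a law which, by weak convergence of products of finite
measures, tends at the rate `γ_n^{(j)}` to `ν_α^j × Leb_j` restricted to jumps larger than `δ`. The
map `h_j^m` is continuous at distinct interior times, that is, almost everywhere for the limit.
-/

namespace HiddenLD

/-! ### The Skorohod distance and time changes -/

section Skorohod

variable {M : ℝ} {j : ℕ}

theorem edist_skorohod_le_of_orderIso {f g : SkorohodSpace M} (l : Icc 0 M ≃o Icc 0 M) {c : ℝ}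
    (hfg : ∀ t, |f.toFun t - g.toFun (l t)| ≤ c) (hl : ∀ t, |(l t : ℝ) - t| ≤ c) :
    edist f g ≤ ENNReal.ofReal c := by
  refine (iInf_le _ l).trans (max_le (iSup_le fun t => ?_) (iSup_le fun t => ?_))
  · rw [edist_dist, Real.dist_eq]
    exact ENNReal.ofReal_le_ofReal (hfg t)
  · rw [edist_dist, Subtype.dist_eq, Real.dist_eq]
    exact ENNReal.ofReal_le_ofReal (hl t)

theorem edist_skorohod_le {f g : SkorohodSpace M} {c : ℝ} (hc : 0 ≤ c)
    (hfg : ∀ t, |f.toFun t - g.toFun t| ≤ c) : edist f g ≤ ENNReal.ofReal c :=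
  edist_skorohod_le_of_orderIso (OrderIso.refl _) hfg fun t => by simpa using hc

theorem exists_orderIso_of_edist_lt {f g : SkorohodSpace M} {c : ℝ}
    (h : edist f g < ENNReal.ofReal c) :
    ∃ l : Icc 0 M ≃o Icc 0 M,
      (∀ t, |f.toFun t - g.toFun (l t)| < c) ∧ ∀ t, |(l t : ℝ) - t| < c := by
  have hc : 0 < c := ENNReal.ofReal_pos.1 (bot_le.trans_lt h)
  obtain ⟨l, hl⟩ := iInf_lt_iff.1 h
  obtain ⟨hval, htime⟩ := max_lt_iff.1 hl
  refine ⟨l, fun t => ?_, fun t => ?_⟩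
  · simpa only [edist_dist, ENNReal.ofReal_lt_ofReal_iff hc, Real.dist_eq]
      using (le_iSup (fun t => edist (f.toFun t) (g.toFun (l t))) t).trans_lt hval
  · simpa only [edist_dist, ENNReal.ofReal_lt_ofReal_iff hc, Subtype.dist_eq, Real.dist_eq]
      using (le_iSup (fun t => edist (l t) t) t).trans_lt htime

theorem exists_orderIso_Icc_of_strictMono {a b : ℝ} (hab : a ≤ b) {L : ℝ → ℝ}
    (hL : StrictMono L) (hLc : Continuous L) (ha : L a = a) (hb : L b = b) :
    ∃ l : Icc a b ≃o Icc a b, ∀ t, (l t : ℝ) = L t := by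
  let l (t : Icc a b) : Icc a b :=
    ⟨L t, ha.ge.trans (hL.monotone t.2.1), (hL.monotone t.2.2).trans hb.le⟩
  have hmono : StrictMono l := fun _ _ hst => hL hst
  have hsurj : Function.Surjective l := fun y => by
    obtain ⟨x, hx, hxy⟩ := intermediate_value_Icc hab hLc.continuousOn
      (show (y : ℝ) ∈ Icc (L a) (L b) by rw [ha, hb]; exact y.2)
    exact ⟨⟨x, hx⟩, Subtype.ext hxy⟩
  exact ⟨hmono.orderIsoOfSurjective l hsurj, fun _ => rfl⟩

/-- The tent function of height `1` and half-width `η` centred at `a`. -/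
noncomputable def tent (η a t : ℝ) : ℝ := max 0 (1 - |t - a| / η)

theorem tent_nonneg (η a t : ℝ) : 0 ≤ tent η a t := le_max_left _ _

theorem tent_le_one {η : ℝ} (hη : 0 ≤ η) (a t : ℝ) : tent η a t ≤ 1 :=
  max_le zero_le_one (sub_le_self _ (by positivity))

theorem tent_self (η a : ℝ) : tent η a a = 1 := by simp [tent]

theorem tent_eq_zero {η a t : ℝ} (hη : 0 < η) (h : η ≤ |t - a|) : tent η a t = 0 :=
  max_eq_left (sub_nonpos.2 ((one_le_div hη).2 h))

theorem abs_tent_sub_tent_le {η : ℝ} (hη : 0 < η) (a s t : ℝ) :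
    |tent η a t - tent η a s| ≤ |t - s| / η := by
  refine (abs_max_sub_max_le_max 0 (1 - |t - a| / η) 0 (1 - |s - a| / η)).trans
    (max_le (by simpa using div_nonneg (abs_nonneg _) hη.le) ?_)
  rw [sub_sub_sub_cancel_left, ← sub_div, abs_div, abs_of_pos hη]
  refine div_le_div_of_nonneg_right ?_ hη.le
  refine (abs_abs_sub_abs_le _ _).trans ?_
  rw [sub_sub_sub_cancel_right, abs_sub_comm]

/-- The piecewise linear perturbation of the identity which moves each `u i` to `v i` and is
supported in the `η`-neighbourhood of the `u i`, when these are `η`-separated. -/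
noncomputable def timeShift {ι : Type*} [Fintype ι] (η : ℝ) (u v : ι → ℝ) (t : ℝ) : ℝ :=
  t + ∑ i, (v i - u i) * tent η (u i) t

section TimeShift

variable {ι : Type*} [Fintype ι] {η : ℝ} {u v : ι → ℝ}

theorem continuous_timeShift (η : ℝ) (u v : ι → ℝ) : Continuous (timeShift η u v) := by
  unfold timeShift tent
  fun_prop

theorem timeShift_eq_self (hη : 0 < η) {t : ℝ} (ht : ∀ i, η ≤ |t - u i|) :
    timeShift η u v t = t := by
  simp [timeShift, tent_eq_zero hη (ht _)]

theorem timeShift_apply (hη : 0 < η) (hu : Pairwise fun i l => η ≤ |u i - u l|) (i : ι) :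
    timeShift η u v (u i) = v i := by
  rw [timeShift, Finset.sum_eq_single i
    (fun l _ hl => by rw [tent_eq_zero hη (hu hl.symm), mul_zero]) (by simp), tent_self]
  ring

theorem abs_timeShift_sub_le (hη : 0 ≤ η) (t : ℝ) :
    |timeShift η u v t - t| ≤ ∑ i, |v i - u i| := by
  rw [timeShift, add_sub_cancel_left]
  refine (Finset.abs_sum_le_sum_abs _ _).trans (Finset.sum_le_sum fun i _ => ?_)
  rw [abs_mul, abs_of_nonneg (tent_nonneg _ _ _)]
  exact mul_le_of_le_one_right (abs_nonneg _) (tent_le_one hη _ _)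

theorem strictMono_timeShift (hη : 0 < η) (huv : ∑ i, |v i - u i| < η) :
    StrictMono (timeShift η u v) := fun s t hst => by
  have hst' : 0 < t - s := sub_pos.2 hst
  have hdiff : timeShift η u v t - timeShift η u v s =
      (t - s) + ∑ i, (v i - u i) * (tent η (u i) t - tent η (u i) s) := by
    simp only [timeShift, mul_sub, Finset.sum_sub_distrib]
    ring
  have hbound : |∑ i, (v i - u i) * (tent η (u i) t - tent η (u i) s)| < t - s := calc
    _ ≤ ∑ i, |v i - u i| * ((t - s) / η) := by
      refine (Finset.abs_sum_le_sum_abs _ _).trans (Finset.sum_le_sum fun i _ => ?_)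
      rw [abs_mul, ← abs_of_pos hst']
      gcongr
      exact abs_tent_sub_tent_le hη _ _ _
    _ = (∑ i, |v i - u i|) * ((t - s) / η) := (Finset.sum_mul ..).symm
    _ < η * ((t - s) / η) := by gcongr
    _ = t - s := mul_div_cancel₀ _ hη.ne'
  linarith [(abs_lt.1 hbound).1]

end TimeShift

/-- Strictly increasing tuples of times in the open interval `(0, M)`. They form an open set of
full measure in `jumpTimes M j`, on which `stepDrift` is continuous. -/
def interiorTimes (M : ℝ) (j : ℕ) : Set (Fin j → ℝ) :=
  {u | StrictMono u ∧ ∀ i, u i ∈ Ioo 0 M}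

theorem interiorTimes_subset_jumpTimes : interiorTimes M j ⊆ jumpTimes M j :=
  fun _ hu => ⟨hu.1, fun i => Ioo_subset_Icc_self (hu.2 i)⟩

theorem isOpen_setOf_strictMono : IsOpen {u : Fin j → ℝ | StrictMono u} := by
  simp only [StrictMono, ofPred_forall]
  exact isOpen_iInter_of_finite fun i => isOpen_iInter_of_finite fun l =>
    isOpen_iInter_of_finite fun _ => isOpen_lt (continuous_apply i) (continuous_apply l)

theorem isOpen_interiorTimes : IsOpen (interiorTimes M j) := by
  have heq : interiorTimes M j = {u | StrictMono u} ∩ univ.pi fun _ => Ioo 0 M := by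
    ext u
    simp [interiorTimes]
  rw [heq]
  exact isOpen_setOf_strictMono.inter (isOpen_set_pi finite_univ fun _ _ => isOpen_Ioo)

theorem measurableSet_jumpDomain : MeasurableSet (jumpDomain M j) := by
  have heq : jumpDomain M j = (univ.pi fun _ => {0}ᶜ) ×ˢ
      ({u | StrictMono u} ∩ univ.pi fun _ => Icc 0 M) := by
    ext q
    simp [jumpDomain, jumpTimes, -pi_univ_Icc]
  rw [heq]
  exact (MeasurableSet.univ_pi fun _ => (measurableSet_singleton 0).compl).prod
    (isOpen_setOf_strictMono.measurableSet.inter (MeasurableSet.univ_pi fun _ => measurableSet_Icc))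

theorem exists_separation {u : Fin j → ℝ} (hu : u ∈ interiorTimes M j) :
    ∃ η > 0, (∀ i, η ≤ |0 - u i|) ∧ (∀ i, η ≤ |M - u i|) ∧
      Pairwise fun i l => η ≤ |u i - u l| := by
  have eventually_le {a b : ℝ} (h : a ≠ b) : ∀ᶠ η : ℝ in 𝓝[>] 0, η ≤ |a - b| :=
    nhdsWithin_le_nhds (Iic_mem_nhds (abs_sub_pos.2 h))
  exact (eventually_mem_nhdsWithin.and <|
    (eventually_all.2 fun i => eventually_le (hu.2 i).1.ne).and <|
    (eventually_all.2 fun i => eventually_le (hu.2 i).2.ne').and <|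
    eventually_all.2 fun _ => eventually_all.2 fun _ => eventually_imp_distrib_left.2 fun hil =>
      eventually_le (hu.1.injective.ne hil)).exists

theorem exists_orderIso_of_mem_interiorTimes (hM : 0 ≤ M) {u : Fin j → ℝ}
    (hu : u ∈ interiorTimes M j) :
    ∃ η > 0, ∀ v : Fin j → ℝ, ∑ i, |v i - u i| < η →
      ∃ l : Icc 0 M ≃o Icc 0 M, (∀ i (t : Icc 0 M), u i ≤ t ↔ v i ≤ l t) ∧
        ∀ t, |(l t : ℝ) - t| ≤ ∑ i, |v i - u i| := by
  obtain ⟨η, hη, h0, hM', hsep⟩ := exists_separation hu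
  refine ⟨η, hη, fun v hv => ?_⟩
  have hmono := strictMono_timeShift hη hv
  obtain ⟨l, hl⟩ := exists_orderIso_Icc_of_strictMono hM hmono (continuous_timeShift η u v)
    (timeShift_eq_self hη h0) (timeShift_eq_self hη hM')
  refine ⟨l, fun i t => ?_, fun t => ?_⟩
  · rw [hl, ← timeShift_apply (v := v) hη hsep i, hmono.le_iff_le]
  · rw [hl]
    exact abs_timeShift_sub_le hη.le t

end Skorohod

/-! ### Step functions with drift -/

section StepDrift

variable {M m : ℝ} {j : ℕ}

theorem edist_stepDrift_le {q r : (Fin j → ℝ) × (Fin j → ℝ)} (l : Icc 0 M ≃o Icc 0 M)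
    (hl : ∀ i (t : Icc 0 M), q.2 i ≤ t ↔ r.2 i ≤ l t) {c : ℝ}
    (hlc : ∀ t, |(l t : ℝ) - t| ≤ c) :
    edist (stepDrift M m j q) (stepDrift M m j r) ≤
      ENNReal.ofReal (∑ i, |q.1 i - r.1 i| + (1 + |m|) * c) := by
  have hsum : 0 ≤ ∑ i, |q.1 i - r.1 i| := Finset.sum_nonneg fun _ _ => abs_nonneg _
  refine edist_skorohod_le_of_orderIso l (fun t => ?_) fun t => ?_
  all_goals have hc : 0 ≤ c := (abs_nonneg _).trans (hlc t)
  · have hdiff : (stepDrift M m j q).toFun t - (stepDrift M m j r).toFun (l t) =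
        (∑ i, if q.2 i ≤ t then q.1 i - r.1 i else 0) + m * (t - l t) := by
      simp only [stepDrift, ← hl, add_sub_add_comm, ← Finset.sum_sub_distrib, ← mul_sub]
      congr 1
      refine Finset.sum_congr rfl fun i _ => ?_
      by_cases hi : q.2 i ≤ t <;> simp [hi]
    have hjumps : |∑ i, if q.2 i ≤ t then q.1 i - r.1 i else 0| ≤ ∑ i, |q.1 i - r.1 i| := by
      refine (Finset.abs_sum_le_sum_abs _ _).trans (Finset.sum_le_sum fun i _ => ?_)
      split_ifs <;> simp
    have hdrift : |m * (t - l t)| ≤ |m| * c := by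
      rw [abs_mul, abs_sub_comm]
      gcongr
      exact hlc t
    rw [hdiff]
    linarith [abs_add_le (∑ i, if q.2 i ≤ t then q.1 i - r.1 i else 0) (m * (t - l t))]
  · nlinarith [hlc t, abs_nonneg m]

theorem continuousAt_stepDrift (hM : 0 ≤ M) {q : (Fin j → ℝ) × (Fin j → ℝ)}
    (hq : q.2 ∈ interiorTimes M j) : ContinuousAt (stepDrift M m j) q := by
  obtain ⟨η, hη, h⟩ := exists_orderIso_of_mem_interiorTimes hM hq
  let shift (r : (Fin j → ℝ) × (Fin j → ℝ)) : ℝ := ∑ i, |r.2 i - q.2 i|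
  have hshift : Continuous shift := by fun_prop
  have hsmall : ∀ᶠ r in 𝓝 q, shift r < η :=
    hshift.continuousAt.eventually_lt_const (by simpa [shift] using hη)
  have hbound : Tendsto
      (fun r => ENNReal.ofReal (∑ i, |q.1 i - r.1 i| + (1 + |m|) * shift r)) (𝓝 q) (𝓝 0) := by
    have hc : Continuous fun r : (Fin j → ℝ) × (Fin j → ℝ) =>
        ENNReal.ofReal (∑ i, |q.1 i - r.1 i| + (1 + |m|) * shift r) :=
      ENNReal.continuous_ofReal.comp (by fun_prop)
    simpa [shift] using hc.tendsto q
  rw [ContinuousAt, tendsto_iff_edist_tendsto_0]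
  refine tendsto_of_tendsto_of_tendsto_of_le_of_le' tendsto_const_nhds hbound
    (Eventually.of_forall fun _ => zero_le) ?_
  filter_upwards [hsmall] with r hr
  obtain ⟨l, hl, hlc⟩ := h r.2 hr
  rw [edist_comm]
  exact edist_stepDrift_le l hl hlc

theorem stepEq_subset_stepLE {i : ℕ} (h : i ≤ j) : stepEq M m i ⊆ stepLE M m j :=
  subset_biUnion_of_mem (u := stepEq M m) (Finset.mem_coe.2 (Finset.mem_range_succ_iff.2 h))

theorem exists_stepEq_edist_le {q : (Fin (j + 1) → ℝ) × (Fin (j + 1) → ℝ)}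
    (hq : q ∈ jumpDomain M (j + 1)) (i : Fin (j + 1)) :
    ∃ g ∈ stepEq M m j, edist (stepDrift M m (j + 1) q) g ≤ ENNReal.ofReal |q.1 i| := by
  refine ⟨_, ⟨(fun l => q.1 (i.succAbove l), fun l => q.2 (i.succAbove l)),
    ⟨fun l => hq.1 _, hq.2.1.comp (Fin.strictMono_succAbove i), fun l => hq.2.2 _⟩, rfl⟩,
    edist_skorohod_le (abs_nonneg _) fun t => ?_⟩
  simp only [stepDrift]
  rw [Fin.sum_univ_succAbove _ i, add_assoc, add_sub_cancel_right]
  split_ifs <;> simp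

theorem le_abs_jump_of_forall_le_edist {r : ℝ} {q : (Fin (j + 1) → ℝ) × (Fin (j + 1) → ℝ)}
    (hq : q ∈ jumpDomain M (j + 1))
    (hr : ∀ g ∈ stepLE M m j, ENNReal.ofReal r ≤ edist (stepDrift M m (j + 1) q) g)
    (i : Fin (j + 1)) : r ≤ |q.1 i| := by
  obtain ⟨g, hg, hle⟩ := exists_stepEq_edist_le (m := m) hq i
  exact (ENNReal.ofReal_le_ofReal_iff (abs_nonneg _)).1
    ((hr g (stepEq_subset_stepLE le_rfl hg)).trans hle)

end StepDrift

/-! ### Functions with finitely many changes of value -/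

section Changes

variable {T : Type*}

/-- Starting from the value `c` before time `a`, the function `g` changes its value at most `k`
times on `[a, ∞)`. -/
def ChangesLE [LE T] (g : T → ℝ) : ℕ → ℝ → T → Prop
  | 0, c, a => ∀ t, a ≤ t → g t = c
  | k + 1, c, a => ∀ t, a ≤ t → g t ≠ c → ChangesLE g k (g t) t

theorem exists_chain_of_not_changesLE [Preorder T] {g : T → ℝ} {k : ℕ} {c : ℝ} {a : T}
    (h : ¬ChangesLE g k c a) :
    ∃ t : Fin (k + 1) → T, Monotone t ∧ (∀ i, a ≤ t i) ∧
      ∀ i : Fin (k + 1), (Fin.cons c (g ∘ t) : Fin (k + 2) → ℝ) i.castSucc ≠ g (t i) := by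
  induction k generalizing c a with
  | zero =>
    obtain ⟨t, hat, htc⟩ : ∃ t, a ≤ t ∧ g t ≠ c := by simpa [ChangesLE] using h
    exact ⟨fun _ => t, monotone_const, fun _ => hat, Fin.cases htc.symm fun i => i.elim0⟩
  | succ k ih =>
    obtain ⟨t, hat, htc, hnot⟩ : ∃ t, a ≤ t ∧ g t ≠ c ∧ ¬ChangesLE g k (g t) t := by
      simpa [ChangesLE] using h
    obtain ⟨s, hs, hts, hne⟩ := ih hnot
    refine ⟨Fin.cons t s, ?_, Fin.cases hat fun i => hat.trans (hts i),
      Fin.cases htc.symm fun i => ?_⟩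
    · exact hs.vecCons (hts 0)
    · simpa [Fin.comp_cons, ← Fin.succ_castSucc] using hne i

/-- On `[a, ∞)`, the function `g` starts from the value `c` and has jumps `z i ≠ 0` at the times
`u i`; there is a jump at `a` itself if `g a ≠ c`. -/
structure IsStepFrom [Preorder T] [DecidableLE T] (g : T → ℝ) (c : ℝ) (a : T) {l : ℕ}
    (z : Fin l → ℝ) (u : Fin l → T) : Prop where
  jump_ne : ∀ i, z i ≠ 0
  strictMono : StrictMono u
  le : ∀ i, a ≤ u i
  eq : ∀ t, a ≤ t → g t = c + ∑ i, if u i ≤ t then z i else 0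

namespace IsStepFrom

variable [LinearOrder T] {g : T → ℝ} {a s : T} {c : ℝ} {l : ℕ} {z : Fin l → ℝ} {u : Fin l → T}

theorem of_const (h : ∀ t, a ≤ t → g t = c) :
    IsStepFrom g c a (Fin.elim0 : Fin 0 → ℝ) Fin.elim0 :=
  ⟨fun i => i.elim0, fun i => i.elim0, fun i => i.elim0, fun t ht => by simpa using h t ht⟩

theorem lt (h : IsStepFrom g (g s) s z u) (i : Fin l) : s < u i := by
  refine (h.le i).lt_of_ne fun hi => h.jump_ne i ?_
  have hsum : ∑ k, (if u k ≤ s then z k else 0) = z i := by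
    rw [Finset.sum_eq_single i (fun k _ hk => if_neg fun hle => ?_) (by simp), if_pos hi.ge]
    exact hk (h.strictMono.injective (hi ▸ le_antisymm hle (h.le k)))
  simpa [hsum] using h.eq s le_rfl

theorem cons (h : IsStepFrom g (g s) s z u) (has : a ≤ s) (hs : g s ≠ c)
    (hc : ∀ t, a ≤ t → t < s → g t = c) :
    IsStepFrom g c a (Fin.cons (g s - c) z : Fin (l + 1) → ℝ) (Fin.cons s u) where
  jump_ne := Fin.cases (sub_ne_zero.2 hs) h.jump_ne
  strictMono := Fin.strictMono_cons.2 ⟨h.lt, h.strictMono⟩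
  le := Fin.cases has fun i => has.trans (h.le i)
  eq t hat := by
    simp only [Fin.sum_univ_succ, Fin.cons_zero, Fin.cons_succ]
    rcases le_or_gt s t with hst | hts
    · rw [h.eq t hst, if_pos hst]
      ring
    · simp [hc t hat hts, hts.not_ge, (hts.trans (h.lt _)).not_ge]

end IsStepFrom

section RightContinuous

variable [ConditionallyCompleteLinearOrder T] [TopologicalSpace T] [OrderTopology T]
  {g : T → ℝ} {k : ℕ}

theorem eventually_eq_of_changesLE {s : T} (hg : ContinuousWithinAt g (Ici s) s)
    (h : ∀ t, s < t → g t ≠ g s → ChangesLE g k (g t) t) : ∀ᶠ t in 𝓝[>] s, g t = g s := by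
  by_contra hnot
  have hfreq : ∃ᶠ t in 𝓝[>] s, g t ≠ g s ∧ s < t :=
    (not_eventually.1 hnot).and_eventually eventually_mem_nhdsWithin
  have earlier : ∀ t, s < t → g t ≠ g s → ∃ t', (g t' ≠ g s ∧ s < t') ∧ t' < t ∧ g t' ≠ g t :=
    fun t hst hne => (hfreq.and_eventually ((eventually_nhdsWithin_of_eventually_nhds
      (eventually_lt_nhds hst)).and ((hg.mono Ioi_subset_Ici_self).eventually_ne hne.symm))).exists
  induction k with
  | zero =>
    obtain ⟨t, hne, hst⟩ := hfreq.exists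
    obtain ⟨t', ⟨hne', hst'⟩, hlt, hne''⟩ := earlier t hst hne
    exact hne'' (h t' hst' hne' t hlt.le).symm
  | succ k ih =>
    refine ih fun t hst hne => ?_
    obtain ⟨t', ⟨hne', hst'⟩, hlt, hne''⟩ := earlier t hst hne
    exact h t' hst' hne' t hlt.le hne''.symm

theorem exists_first_change {a : T} {c : ℝ} (hg : ∀ t, ContinuousWithinAt g (Ici t) t)
    (h : ChangesLE g (k + 1) c a) (hne : ∃ t, a ≤ t ∧ g t ≠ c) :
    ∃ s, a ≤ s ∧ g s ≠ c ∧ ∀ t, a ≤ t → t < s → g t = c := by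
  let A : Set T := {t | a ≤ t ∧ g t ≠ c}
  have hA : BddBelow A := ⟨a, fun t ht => ht.1⟩
  have has : a ≤ sInf A := le_csInf hne fun t ht => ht.1
  have hbefore : ∀ t, a ≤ t → t < sInf A → g t = c := fun t hat hts =>
    not_not.1 fun htc => notMem_of_lt_csInf hts hA ⟨hat, htc⟩
  refine ⟨sInf A, has, fun hs => ?_, hbefore⟩
  have hlt : ∀ t ∈ A, sInf A < t := fun t ht =>
    (csInf_le hA ht).lt_of_ne fun heq => ht.2 (heq ▸ hs)
  have hafter : ∀ᶠ t in 𝓝[>] sInf A, g t = c := hs ▸ eventually_eq_of_changesLE (hg _)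
    fun t hst htc => h t (has.trans hst.le) (hs ▸ htc)
  obtain ⟨t, ht⟩ := hne
  obtain ⟨b, hb, hsub⟩ := (mem_nhdsGT_iff_exists_Ioo_subset' (hlt t ht)).1 hafter
  obtain ⟨y, hy, hyb⟩ := exists_lt_of_csInf_lt ⟨t, ht⟩ hb
  exact hy.2 (hsub ⟨hlt y hy, hyb⟩)

theorem exists_isStepFrom_of_changesLE (hg : ∀ t, ContinuousWithinAt g (Ici t) t) {c : ℝ} {a : T}
    (h : ChangesLE g k c a) :
    ∃ l ≤ k, ∃ (z : Fin l → ℝ) (u : Fin l → T), IsStepFrom g c a z u := by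
  induction k generalizing c a with
  | zero => exact ⟨0, le_rfl, _, _, .of_const h⟩
  | succ k ih =>
    by_cases hne : ∃ t, a ≤ t ∧ g t ≠ c
    · obtain ⟨s, has, hs, hc⟩ := exists_first_change hg h hne
      obtain ⟨l, hl, z, u, hzu⟩ := ih (h s has hs)
      exact ⟨l + 1, Nat.succ_le_succ hl, _, _, hzu.cons has hs hc⟩
    · exact ⟨0, Nat.zero_le _, _, _, .of_const fun t ht => not_not.1 fun htc => hne ⟨t, ht, htc⟩⟩

end RightContinuous

end Changes

theorem exists_castSucc_eq_succ {k : ℕ} {J : Fin (k + 2) → ℕ} (hJ : Monotone J)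
    (hk : ∀ i, J i ≤ k) : ∃ i : Fin (k + 1), J i.castSucc = J i.succ := by
  by_contra! hne
  have hstrict : StrictMono J := Fin.strictMono_iff_lt_succ.2 fun i =>
    (hJ i.castSucc_lt_succ.le).lt_of_ne (hne i)
  have hle := Finset.card_le_card_of_injOn J (s := Finset.univ) (t := Finset.range (k + 1))
    (fun i _ => by simpa using Nat.lt_succ_of_le (hk i)) hstrict.injective.injOn
  simp at hle

/-! ### The set `stepLE M m j` is closed -/

section Closed

variable {M m : ℝ} {j : ℕ}

theorem sum_jumps_eq_of_card_eq {ι : Type*} [Fintype ι] (z u : ι → ℝ) {s t : ℝ}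
    (h : Finset.card {i | u i ≤ s} = Finset.card {i | u i ≤ t}) :
    (∑ i, if u i ≤ s then z i else 0) = ∑ i, if u i ≤ t then z i else 0 := by
  wlog hst : s ≤ t generalizing s t
  · exact (this h.symm (le_of_not_ge hst)).symm
  have hsub : Finset.univ.filter (fun i => u i ≤ s) ⊆ Finset.univ.filter fun i => u i ≤ t :=
    Finset.monotone_filter_right _ fun i _ hi => hi.trans hst
  rw [← Finset.sum_filter, ← Finset.sum_filter, Finset.eq_of_subset_of_card_le hsub h.ge]

theorem exists_sum_jumps_castSucc_eq {k : ℕ} (hk : k ≤ j) (z u : Fin k → ℝ)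
    {t : Fin (j + 1) → ℝ} (ht : Monotone t) :
    ∃ i : Fin (j + 1),
      (Fin.cons 0 (fun l => ∑ i, if u i ≤ t l then z i else 0) : Fin (j + 2) → ℝ) i.castSucc =
        ∑ l, if u l ≤ t i then z l else 0 := by
  let J (l : Fin (j + 1)) : ℕ := Finset.card {i | u i ≤ t l}
  have hJ : Monotone J := fun l l' h =>
    Finset.card_le_card (Finset.monotone_filter_right _ fun i _ hi => hi.trans (ht h))
  have hle : ∀ l, J l ≤ j := fun l => (Finset.card_le_univ _).trans (by simpa using hk)
  obtain ⟨i, hi⟩ := exists_castSucc_eq_succ (hJ.vecCons (Nat.zero_le _))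
    (Fin.cases (Nat.zero_le j) hle)
  refine ⟨i, ?_⟩
  induction i using Fin.cases with
  | zero =>
    have hempty : ∀ i, ¬u i ≤ t 0 := by
      simpa [J, Finset.filter_eq_empty_iff] using (show J 0 = 0 from hi.symm)
    simp [hempty]
  | succ i =>
    rw [← Fin.succ_castSucc, Fin.cons_succ]
    exact sum_jumps_eq_of_card_eq z u (by simpa [J, ← Fin.succ_castSucc] using hi)

theorem exists_mem_stepLE_of_mem_closure {f : SkorohodSpace M} (hf : f ∈ closure (stepLE M m j))
    {ε : ℝ} (hε : 0 < ε) :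
    ∃ k ≤ j, ∃ (z u : Fin k → ℝ) (l : Icc 0 M ≃o Icc 0 M), ∀ t,
      |f.toFun t - m * t - ∑ i, if u i ≤ l t then z i else 0| < ε := by
  have : 0 < 1 + |m| := by positivity
  obtain ⟨f', hf', hd⟩ := EMetric.mem_closure_iff.1 hf (ENNReal.ofReal (ε / (1 + |m|)))
    (ENNReal.ofReal_pos.2 (by positivity))
  obtain ⟨k, hk, ⟨z, u⟩, -, rfl⟩ := mem_iUnion₂.1 hf'
  obtain ⟨l, hval, htime⟩ := exists_orderIso_of_edist_lt hd
  refine ⟨k, Finset.mem_range_succ_iff.1 hk, z, u, l, fun t => ?_⟩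
  calc |f.toFun t - m * t - ∑ i, if u i ≤ l t then z i else 0|
      = |(f.toFun t - (stepDrift M m k (z, u)).toFun (l t)) + m * ((l t : ℝ) - t)| := by
        simp only [stepDrift]
        ring_nf
    _ ≤ |f.toFun t - (stepDrift M m k (z, u)).toFun (l t)| + |m| * |(l t : ℝ) - t| :=
        (abs_add_le _ _).trans_eq (by rw [abs_mul])
    _ < ε / (1 + |m|) + |m| * (ε / (1 + |m|)) :=
        add_lt_add_of_lt_of_le (hval t)
          (mul_le_mul_of_nonneg_left (htime t).le (abs_nonneg m))
    _ = ε := by field_simp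

theorem changesLE_of_mem_closure_stepLE {f : SkorohodSpace M}
    (hf : f ∈ closure (stepLE M m j)) (a : Icc 0 M) :
    ChangesLE (fun t => f.toFun t - m * t) j 0 a := by
  set g : Icc 0 M → ℝ := fun t => f.toFun t - m * t with hg
  by_contra hnot
  obtain ⟨t, ht, -, hne⟩ := exists_chain_of_not_changesLE hnot
  let v : Fin (j + 2) → ℝ := Fin.cons 0 (g ∘ t)
  obtain ⟨i₀, hmin⟩ := Finite.exists_min fun i : Fin (j + 1) => |v i.castSucc - g (t i)|
  have hδ : 0 < |v i₀.castSucc - g (t i₀)| := abs_sub_pos.2 (hne i₀)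
  obtain ⟨k, hk, z, u, l, hclose⟩ := exists_mem_stepLE_of_mem_closure hf (half_pos hδ)
  let w : Fin (j + 2) → ℝ := Fin.cons 0 fun i => ∑ n, if u n ≤ l (t i) then z n else 0
  have hvw : ∀ i, |v i - w i| < |v i₀.castSucc - g (t i₀)| / 2 :=
    Fin.cases (by simpa [v, w] using hδ) fun i => by simpa [v, w, hg] using hclose (t i)
  obtain ⟨i, hi⟩ := exists_sum_jumps_castSucc_eq hk z u (t := fun i => (l (t i) : ℝ))
    fun _ _ h => l.monotone (ht h)
  have hw : w i.castSucc = w i.succ := hi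
  refine (hmin i).not_gt ?_
  calc |v i.castSucc - v i.succ|
      ≤ |v i.castSucc - w i.castSucc| + |v i.succ - w i.succ| := by
        rw [abs_sub_comm (v i.succ), ← hw]
        exact abs_sub_le _ _ _
    _ < |v i₀.castSucc - g (t i₀)| := by linarith [hvw i.castSucc, hvw i.succ]

theorem isClosed_stepLE (hM : 0 ≤ M) : IsClosed (stepLE M m j) := by
  refine isClosed_of_closure_subset fun f hf => ?_
  have hcont : ∀ t, ContinuousWithinAt (fun t : Icc 0 M => f.toFun t - m * t) (Ici t) t :=
    fun t => (f.cadlag t).1.sub (by fun_prop)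
  let o : Icc (0 : ℝ) M := ⟨0, le_rfl, hM⟩
  let _ : Inhabited (Icc (0 : ℝ) M) := ⟨o⟩
  obtain ⟨l, hl, z, u, hzu⟩ :=
    exists_isStepFrom_of_changesLE hcont (changesLE_of_mem_closure_stepLE hf o)
  refine stepEq_subset_stepLE hl ⟨(z, fun i => u i),
    ⟨hzu.jump_ne, fun _ _ h => hzu.strictMono h, fun i => (u i).2⟩, ?_⟩
  have hfun : (stepDrift M m l (z, fun i => u i)).toFun = f.toFun := by
    funext t
    have := hzu.eq t t.2.1
    simp only [stepDrift, Subtype.coe_le_coe]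
    linarith
  cases f
  simpa [stepDrift] using hfun

end Closed

/-! ### Measurability of the path of a random walk -/

section WalkPath

variable {M : ℝ} {n : ℕ}

theorem floor_mul_le (t : Icc 0 M) : ⌊(n : ℝ) * t⌋₊ ≤ ⌊(n : ℝ) * M⌋₊ :=
  Nat.floor_mono (mul_le_mul_of_nonneg_left t.2.2 n.cast_nonneg)

theorem edist_walkPath_walkPath_le (y z : ℕ → ℝ) :
    edist (walkPath M n y) (walkPath M n z) ≤
      ENNReal.ofReal ((∑ k ∈ Finset.range ⌊(n : ℝ) * M⌋₊, |y k - z k|) / n) := by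
  refine edist_skorohod_le (by positivity) fun t => ?_
  simp only [walkPath]
  rw [← sub_div, abs_div, Nat.abs_cast, ← Finset.sum_sub_distrib]
  gcongr
  exact (Finset.abs_sum_le_sum_abs _ _).trans (Finset.sum_le_sum_of_subset_of_nonneg
    (Finset.range_mono (floor_mul_le t)) fun _ _ _ => abs_nonneg _)

theorem continuous_walkPath : Continuous (walkPath M n) := by
  refine continuous_iff_continuousAt.2 fun z => ?_
  rw [ContinuousAt, tendsto_iff_edist_tendsto_0]
  have hbound : Tendsto (fun y : ℕ → ℝ =>
      ENNReal.ofReal ((∑ k ∈ Finset.range ⌊(n : ℝ) * M⌋₊, |y k - z k|) / n)) (𝓝 z) (𝓝 0) := by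
    have hc : Continuous fun y : ℕ → ℝ =>
        ENNReal.ofReal ((∑ k ∈ Finset.range ⌊(n : ℝ) * M⌋₊, |y k - z k|) / n) :=
      ENNReal.continuous_ofReal.comp (by fun_prop)
    simpa using hc.tendsto z
  exact tendsto_of_tendsto_of_tendsto_of_le_of_le tendsto_const_nhds hbound
    (fun _ => zero_le) fun y => edist_walkPath_walkPath_le y z

end WalkPath

/-! ### Convergence of measures away from a closed set -/

theorem areSeparated_iff_ofReal_le_edist {S : Type*} [PseudoEMetricSpace S] {A C : Set S} :
    Metric.AreSeparated A C ↔ ∃ r > 0, ∀ x ∈ A, ∀ y ∈ C, ENNReal.ofReal r ≤ edist x y := by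
  constructor
  · rintro ⟨r, hr, h⟩
    have hmin : min r 1 ≠ ∞ := ne_top_of_le_ne_top ENNReal.one_ne_top (min_le_right _ _)
    refine ⟨(min r 1).toReal, ENNReal.toReal_pos (by simp [hr]) hmin, fun x hx y hy => ?_⟩
    rw [ENNReal.ofReal_toReal hmin]
    exact (min_le_left _ _).trans (h x hx y hy)
  · rintro ⟨r, hr, h⟩
    exact ⟨ENNReal.ofReal r, (ENNReal.ofReal_pos.2 hr).ne', h⟩

section MO

variable {S : Type*} [PseudoEMetricSpace S] [MeasurableSpace S] {C : Set S}
  {μ μ' : ℕ → Measure S} {μ₀ μ₀' : Measure S}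

theorem TendstoMO.congr_limit [BorelSpace S] (h : TendstoMO C μ μ₀)
    (hμ : ∀ A, MeasurableSet A → Metric.AreSeparated A C → μ₀' A = μ₀ A) :
    TendstoMO C μ μ₀' where
  isClosed := h.isClosed
  finite_seq := h.finite_seq
  finite_lim A hA hAC := (hμ A hA hAC).trans_lt (h.finite_lim A hA hAC)
  limsup_le F hF hFC := (h.limsup_le F hF hFC).trans (hμ F hF.measurableSet hFC).ge
  le_liminf G hG hGC := (hμ G hG.measurableSet hGC).trans_le (h.le_liminf G hG hGC)

theorem TendstoMO.const_smul_of_tendsto [BorelSpace S] (h : TendstoMO C μ μ₀) {c : ℕ → ℝ≥0∞}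
    {c₀ : ℝ≥0∞} (hc : Tendsto c atTop (𝓝 c₀)) (hc₀ : c₀ ≠ ∞)
    (hfin : ∀ n, FiniteAwayFrom C (μ' n)) (hμ : ∀ᶠ n in atTop, μ' n = c n • μ n) :
    TendstoMO C μ' (c₀ • μ₀) where
  isClosed := h.isClosed
  finite_seq := hfin
  finite_lim A hA hAC := ENNReal.mul_lt_top hc₀.lt_top (h.finite_lim A hA hAC)
  limsup_le F hF hFC := by
    have hF' := h.limsup_le F hF hFC
    have hμ₀F := h.finite_lim F hF.measurableSet hFC
    calc limsup (fun n => μ' n F) atTop = limsup (c * fun n => μ n F) atTop :=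
          limsup_congr (hμ.mono fun n hn => by rw [hn]; rfl)
      _ ≤ limsup c atTop * limsup (fun n => μ n F) atTop :=
          ENNReal.limsup_mul_le' (Or.inr (hF'.trans_lt hμ₀F).ne)
            (Or.inl (hc.limsup_eq.trans_ne hc₀))
      _ ≤ c₀ * μ₀ F := by rw [hc.limsup_eq]; gcongr
  le_liminf G hG hGC :=
    calc c₀ * μ₀ G ≤ liminf c atTop * liminf (fun n => μ n G) atTop := by
          rw [hc.liminf_eq]
          gcongr
          exact h.le_liminf G hG hGC
      _ ≤ liminf (c * fun n => μ n G) atTop := ENNReal.le_liminf_mul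
      _ = liminf (fun n => μ' n G) atTop :=
          liminf_congr (hμ.mono fun n hn => by rw [hn]; rfl)

theorem TendstoMO.tendsto_measure (h : TendstoMO C μ μ₀) {G F : Set S} (hG : IsOpen G)
    (hF : IsClosed F) (hGF : G ⊆ F) (hFC : Metric.AreSeparated F C) (hle : μ₀ F ≤ μ₀ G) :
    Tendsto (fun n => μ n G) atTop (𝓝 (μ₀ G)) := by
  refine tendsto_of_le_liminf_of_limsup_le (h.le_liminf G hG (hFC.mono hGF Subset.rfl)) ?_
  exact (limsup_le_limsup (Eventually.of_forall fun n => measure_mono hGF)).trans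
    ((h.limsup_le F hF hFC).trans hle)

end MO

section Away

/-- The set of real numbers of absolute value greater than `δ`: for `δ > 0`, the typical set
bounded away from `0`. -/
def away (δ : ℝ) : Set ℝ := {z | δ < |z|}

theorem away_eq_union (δ : ℝ) : away δ = Iio (-δ) ∪ Ioi δ := by
  ext z
  simp only [away, mem_ofPred_eq, mem_union, mem_Iio, mem_Ioi, lt_abs, lt_neg, or_comm]

theorem isOpen_away (δ : ℝ) : IsOpen (away δ) := isOpen_lt continuous_const continuous_abs

theorem measurableSet_away (δ : ℝ) : MeasurableSet (away δ) := (isOpen_away δ).measurableSet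

theorem areSeparated_zero_iff {A : Set ℝ} :
    Metric.AreSeparated A {0} ↔ ∃ δ > 0, ∀ z ∈ A, δ ≤ |z| := by
  simp only [areSeparated_iff_ofReal_le_edist, mem_singleton_iff, forall_eq, edist_dist,
    Real.dist_eq, sub_zero, ENNReal.ofReal_le_ofReal_iff (abs_nonneg _)]

theorem measure_ne_top_of_subset_away {μ : Measure ℝ} (hfin : FiniteAwayFrom {0} μ) {δ : ℝ}
    (hδ : 0 < δ) {A : Set ℝ} (hA : A ⊆ away δ) : μ A ≠ ∞ :=
  measure_ne_top_of_subset hA (hfin _ (measurableSet_away δ)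
    (areSeparated_zero_iff.2 ⟨δ, hδ, fun _ hz => le_of_lt hz⟩)).ne

theorem Ioi_subset_away (δ : ℝ) : Ioi δ ⊆ away δ :=
  (away_eq_union δ).symm ▸ subset_union_right

theorem Iio_neg_subset_away (δ : ℝ) : Iio (-δ) ⊆ away δ :=
  (away_eq_union δ).symm ▸ subset_union_left

theorem disjoint_Iio_neg_Ioi {δ : ℝ} (hδ : 0 < δ) : Disjoint (Iio (-δ)) (Ioi δ) :=
  Iio_disjoint_Ioi_iff.2 (by linarith)

theorem measure_away (μ : Measure ℝ) {δ : ℝ} (hδ : 0 < δ) :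
    μ (away δ) = μ (Iio (-δ)) + μ (Ioi δ) := by
  rw [away_eq_union, measure_union (disjoint_Iio_neg_Ioi hδ) measurableSet_Ioi]

theorem map_div_apply_away {Ω : Type*} [MeasurableSpace Ω] {P : Measure Ω} {X : Ω → ℝ}
    (hX : Measurable X) {n : ℕ} (hn : 1 ≤ n) (δ : ℝ) :
    P.map (fun ω => X ω / n) (away δ) = P {ω | (n : ℝ) * δ < |X ω|} := by
  have hn' : (0 : ℝ) < n := by exact_mod_cast hn
  rw [Measure.map_apply (hX.div_const _) (measurableSet_away δ)]
  congr 1 with ω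
  simp only [away, mem_preimage, mem_ofPred_eq, abs_div, Nat.abs_cast, lt_div_iff₀ hn', mul_comm]

end Away

section Homogeneous

variable {α : ℝ} {μ : Measure ℝ}

/-- A measure on `ℝ \ {0}` is homogeneous of order `-α` if `μ (s A) = s ^ (-α) μ A`; a possible
atom at `0` is disregarded. -/
def IsHomogeneous (α : ℝ) (μ : Measure ℝ) : Prop :=
  ∀ s : ℝ, 0 < s → ∀ A : Set ℝ, MeasurableSet A → A ⊆ {0}ᶜ →
      μ ((fun x => s * x) '' A) = ENNReal.ofReal (s ^ (-α)) * μ A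

theorem IsHomogeneous.smul (h : IsHomogeneous α μ) (c : ℝ≥0∞) : IsHomogeneous α (c • μ) := by
  intro s hs A hA hA0
  simp only [Measure.smul_apply, smul_eq_mul, h s hs A hA hA0, mul_left_comm]

theorem IsHomogeneous.measure_Ioi (h : IsHomogeneous α μ) {x : ℝ} (hx : 0 < x) :
    μ (Ioi x) = ENNReal.ofReal (x ^ (-α)) * μ (Ioi 1) := by
  rw [← h x hx _ measurableSet_Ioi (fun y hy => ne_of_gt (zero_lt_one.trans hy)),
    image_mul_left_Ioi hx, mul_one]

theorem IsHomogeneous.measure_Iio_neg (h : IsHomogeneous α μ) {x : ℝ} (hx : 0 < x) :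
    μ (Iio (-x)) = ENNReal.ofReal (x ^ (-α)) * μ (Iio (-1)) := by
  rw [← h x hx _ measurableSet_Iio (fun y hy => ne_of_lt (hy.trans (by norm_num))),
    image_mul_left_Iio hx, mul_neg, mul_one]

theorem IsHomogeneous.measure_away (h : IsHomogeneous α μ) {δ : ℝ} (hδ : 0 < δ) :
    μ (away δ) = ENNReal.ofReal (δ ^ (-α)) * μ (away 1) := by
  rw [HiddenLD.measure_away μ hδ, HiddenLD.measure_away μ one_pos, h.measure_Iio_neg hδ,
    h.measure_Ioi hδ, mul_add]

theorem IsHomogeneous.measure_away_one_ne_zero (h : IsHomogeneous α μ) (h0 : μ {0} = 0)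
    (hμ : μ ≠ 0) : μ (away 1) ≠ 0 := by
  intro h1
  apply hμ
  rw [← Measure.measure_univ_eq_zero]
  have hcov : (univ : Set ℝ) ⊆ {0} ∪ ⋃ n : ℕ, away (1 / (n + 1 : ℝ)) := by
    intro z _
    by_cases hz : z = 0
    · exact Or.inl hz
    · obtain ⟨n, hn⟩ := exists_nat_one_div_lt (abs_pos.2 hz)
      exact Or.inr (mem_iUnion.2 ⟨n, hn⟩)
  refine measure_mono_null hcov (measure_union_null h0 (measure_iUnion_null fun n => ?_))
  rw [h.measure_away (by positivity), h1, mul_zero]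

/-- Homogeneity makes the mass of `{z | y < |z|}` continuous in `y`, so spheres have no mass. -/
theorem IsHomogeneous.measure_le_abs_le (h : IsHomogeneous α μ) (hfin : FiniteAwayFrom {0} μ)
    {δ : ℝ} (hδ : 0 < δ) : μ {z | δ ≤ |z|} ≤ μ (away δ) := by
  have ht : Tendsto (fun y => μ (away y)) (𝓝[Ioo 0 δ] δ) (𝓝 (μ (away δ))) := by
    rw [h.measure_away hδ]
    refine Tendsto.congr'
      (eventually_nhdsWithin_of_forall fun y hy => (h.measure_away hy.1).symm) ?_
    refine ENNReal.Tendsto.mul_const (ENNReal.tendsto_ofReal ?_)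
      (Or.inr (measure_ne_top_of_subset_away hfin one_pos Subset.rfl))
    exact (Real.continuousAt_rpow_const δ (-α) (Or.inl hδ.ne')).continuousWithinAt
  have : (𝓝[Ioo 0 δ] δ).NeBot := by
    rw [nhdsWithin_Ioo_eq_nhdsLT hδ]
    infer_instance
  refine ge_of_tendsto ht (eventually_nhdsWithin_of_forall fun y hy => measure_mono fun z hz => ?_)
  exact hy.2.trans_le hz

end Homogeneous

section Uniqueness

variable {T : Type*} [LinearOrder T] [TopologicalSpace T] [OrderTopology T]
  [SecondCountableTopology T] [MeasurableSpace T] [BorelSpace T] {μ ν : Measure T} {a : T}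

theorem restrict_Ioi_congr (hμ : μ (Ioi a) ≠ ∞) (h : ∀ x, a ≤ x → μ (Ioi x) = ν (Ioi x)) :
    μ.restrict (Ioi a) = ν.restrict (Ioi a) := by
  have : IsFiniteMeasure (μ.restrict (Ioi a)) := isFiniteMeasure_restrict.2 hμ
  refine ext_of_generate_finite (range Ioi)
    (BorelSpace.measurable_eq.trans (borel_eq_generateFrom_Ioi T)) isPiSystem_Ioi ?_
    (by simpa using h a le_rfl)
  rintro _ ⟨x, rfl⟩
  rw [Measure.restrict_apply measurableSet_Ioi, Measure.restrict_apply measurableSet_Ioi,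
    Ioi_inter_Ioi]
  exact h _ le_sup_right

theorem restrict_Iio_congr (hμ : μ (Iio a) ≠ ∞) (h : ∀ x, x ≤ a → μ (Iio x) = ν (Iio x)) :
    μ.restrict (Iio a) = ν.restrict (Iio a) :=
  restrict_Ioi_congr (T := Tᵒᵈ) hμ h

end Uniqueness

section NuAlpha

variable {α p : ℝ}

instance : SigmaFinite (nuAlpha α p) :=
  SigmaFinite.withDensity_of_ne_top (ae_of_all _ fun _ => ENNReal.ofReal_ne_top)

theorem nuAlpha_away (hα : 0 < α) (hp₀ : 0 ≤ p) (hp₁ : p ≤ 1) {δ : ℝ} (hδ : 0 < δ) :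
    nuAlpha α p (away δ) = ENNReal.ofReal (δ ^ (-α)) := by
  rw [away_eq_union _, nuAlpha_tails hα hp₀ hp₁ hδ hδ]
  congr 1
  ring

theorem tendsto_nuAlpha_away (hα : 0 < α) (hp₀ : 0 ≤ p) (hp₁ : p ≤ 1) :
    Tendsto (fun y => nuAlpha α p (away y)) atTop (𝓝 0) := by
  have : Tendsto (fun y : ℝ => ENNReal.ofReal (y ^ (-α))) atTop (𝓝 0) := by
    simpa using ENNReal.tendsto_ofReal (tendsto_rpow_neg_atTop hα)
  refine this.congr' ?_
  filter_upwards [eventually_gt_atTop 0] with y hy using (nuAlpha_away hα hp₀ hp₁ hy).symm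

theorem nuAlpha_Ioi (hα : 0 < α) (hp₀ : 0 ≤ p) (hp₁ : p ≤ 1) {x : ℝ} (hx : 0 < x) :
    nuAlpha α p (Ioi x) = ENNReal.ofReal (p * x ^ (-α)) := by
  have hval : Tendsto (fun y : ℝ => nuAlpha α p (Iio (-y) ∪ Ioi x)) atTop
      (𝓝 (ENNReal.ofReal (p * x ^ (-α)))) := by
    have h : Tendsto (fun y : ℝ => ENNReal.ofReal ((1 - p) * y ^ (-α) + p * x ^ (-α))) atTop
        (𝓝 (ENNReal.ofReal (p * x ^ (-α)))) := by
      refine ENNReal.tendsto_ofReal ?_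
      simpa using ((tendsto_rpow_neg_atTop hα).const_mul (1 - p)).add_const (p * x ^ (-α))
    refine h.congr' ?_
    filter_upwards [eventually_gt_atTop 0] with y hy using (nuAlpha_tails hα hp₀ hp₁ hx hy).symm
  have hmeas : Tendsto (fun y : ℝ => nuAlpha α p (Iio (-y) ∪ Ioi x)) atTop
      (𝓝 (nuAlpha α p (Ioi x))) := by
    have h := (tendsto_nuAlpha_away hα hp₀ hp₁).add_const (nuAlpha α p (Ioi x))
    rw [zero_add] at h
    exact tendsto_of_tendsto_of_tendsto_of_le_of_le tendsto_const_nhds h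
      (fun y => measure_mono subset_union_right) fun y =>
      (measure_union_le _ _).trans (by gcongr; exact Iio_neg_subset_away y)
  exact tendsto_nhds_unique hmeas hval

theorem nuAlpha_Iio_neg (hα : 0 < α) (hp₀ : 0 ≤ p) (hp₁ : p ≤ 1) {x : ℝ} (hx : 0 < x) :
    nuAlpha α p (Iio (-x)) = ENNReal.ofReal ((1 - p) * x ^ (-α)) := by
  have h := nuAlpha_tails hα hp₀ hp₁ hx hx
  rw [← away_eq_union, measure_away _ hx, nuAlpha_Ioi hα hp₀ hp₁ hx,
    ENNReal.ofReal_add (mul_nonneg (by linarith) (by positivity)) (by positivity)] at h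
  exact (ENNReal.add_left_inj ENNReal.ofReal_ne_top).1 h

theorem IsHomogeneous.restrict_away_eq_nuAlpha {μ : Measure ℝ} (hα : 0 < α) (hp₀ : 0 ≤ p)
    (hp₁ : p ≤ 1) (h : IsHomogeneous α μ) (hpos : μ (Ioi 1) = ENNReal.ofReal p)
    (hneg : μ (Iio (-1)) = ENNReal.ofReal (1 - p)) {δ : ℝ} (hδ : 0 < δ) :
    μ.restrict (away δ) = (nuAlpha α p).restrict (away δ) := by
  have hIoi : ∀ x > 0, μ (Ioi x) = nuAlpha α p (Ioi x) := fun x hx => by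
    rw [h.measure_Ioi hx, nuAlpha_Ioi hα hp₀ hp₁ hx, ENNReal.ofReal_mul hp₀, hpos, mul_comm]
  have hIio : ∀ x > 0, μ (Iio (-x)) = nuAlpha α p (Iio (-x)) := fun x hx => by
    rw [h.measure_Iio_neg hx, nuAlpha_Iio_neg hα hp₀ hp₁ hx, ENNReal.ofReal_mul (by linarith),
      hneg, mul_comm]
  rw [away_eq_union, Measure.restrict_union (disjoint_Iio_neg_Ioi hδ) measurableSet_Ioi,
    Measure.restrict_union (disjoint_Iio_neg_Ioi hδ) measurableSet_Ioi]
  congr 1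
  · refine restrict_Iio_congr ?_ fun x hx => ?_
    · rw [hIio δ hδ, nuAlpha_Iio_neg hα hp₀ hp₁ hδ]
      exact ENNReal.ofReal_ne_top
    · simpa using hIio (-x) (by linarith)
  · refine restrict_Ioi_congr ?_ fun x hx => hIoi x (hδ.trans_le hx)
    rw [hIoi δ hδ, nuAlpha_Ioi hα hp₀ hp₁ hδ]
    exact ENNReal.ofReal_ne_top

end NuAlpha

/-! ### Regular variation -/

section RegVar

variable {Ω : Type*} [MeasurableSpace Ω] {P : Measure Ω} {X : Ω → ℝ} {α p : ℝ}

theorem tendsto_mul_tail_of_tendstoMO (hX : Measurable X) {c : ℕ → ℝ≥0∞} {μ : Measure ℝ}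
    (h : TendstoMO {0} (fun n => c n • P.map (fun ω => X ω / n)) μ) (hμ : IsHomogeneous α μ)
    {δ : ℝ} (hδ : 0 < δ) :
    Tendsto (fun n : ℕ => c n * P {ω | (n : ℝ) * δ < |X ω|}) atTop (𝓝 (μ (away δ))) := by
  refine (h.tendsto_measure (isOpen_away δ) (isClosed_le continuous_const continuous_abs)
    (fun z (hz : δ < |z|) => hz.le) (areSeparated_zero_iff.2 ⟨δ, hδ, fun z hz => hz⟩)
    (hμ.measure_le_abs_le h.finite_lim hδ)).congr' ?_
  filter_upwards [eventually_ge_atTop 1] with n hn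
  rw [Measure.smul_apply, smul_eq_mul, map_div_apply_away hX hn]

theorem IsRegVar.measure_lt_abs_ne_zero (hX : Measurable X) (hRV : IsRegVar P X α p) (x : ℝ) :
    P {ω | x < |X ω|} ≠ 0 := by
  obtain ⟨γ, ρ, μ, -, hμ0, hμ, hlim, hhom⟩ := hRV.exists_limit
  have hpos : 0 < μ (away 1) :=
    pos_iff_ne_zero.2 (IsHomogeneous.measure_away_one_ne_zero hhom hμ0 hμ)
  obtain ⟨n, hn, hnx⟩ := (((tendsto_mul_tail_of_tendstoMO hX hlim hhom
    one_pos).eventually_const_lt hpos).and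
    (tendsto_natCast_atTop_atTop.eventually_ge_atTop x)).exists
  intro h
  have hzero : P {ω | (n : ℝ) * 1 < |X ω|} = 0 :=
    measure_mono_null (fun ω (hω : (n : ℝ) * 1 < |X ω|) => hnx.trans_lt (mul_one (n : ℝ) ▸ hω)) h
  exact hn.ne' (by rw [hzero, mul_zero])

variable [IsProbabilityMeasure P]

theorem IsRegVar.measureReal_lt_abs_pos (hX : Measurable X) (hRV : IsRegVar P X α p) (x : ℝ) :
    0 < P.real {ω | x < |X ω|} :=
  ENNReal.toReal_pos (hRV.measure_lt_abs_ne_zero hX x) (measure_ne_top _ _)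

theorem IsRegVar.finiteAwayFrom_inv_tail_smul (hX : Measurable X) (hRV : IsRegVar P X α p)
    (n : ℕ) : FiniteAwayFrom {0} ((P {ω | (n : ℝ) < |X ω|})⁻¹ • P.map (fun ω => X ω / n)) :=
  fun _ _ _ => ENNReal.mul_lt_top
    (ENNReal.inv_lt_top.2 (pos_iff_ne_zero.2 (hRV.measure_lt_abs_ne_zero hX n)))
    (measure_lt_top _ _)

theorem IsRegVar.exists_tendstoMO (hX : Measurable X) (hRV : IsRegVar P X α p) :
    ∃ μ : Measure ℝ, IsHomogeneous α μ ∧ μ (away 1) = 1 ∧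
      TendstoMO {0} (fun n : ℕ => (P {ω | (n : ℝ) < |X ω|})⁻¹ • P.map (fun ω => X ω / n)) μ := by
  obtain ⟨γ, ρ, μ, hγ, hμ0, hμ, hlim, hhom⟩ := hRV.exists_limit
  replace hhom : IsHomogeneous α μ := hhom
  have h0 : μ (away 1) ≠ 0 := hhom.measure_away_one_ne_zero hμ0 hμ
  have htop : μ (away 1) ≠ ∞ :=
    measure_ne_top_of_subset_away hlim.finite_lim one_pos Subset.rfl
  refine ⟨(μ (away 1))⁻¹ • μ, hhom.smul _, ENNReal.inv_mul_cancel h0 htop,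
    hlim.const_smul_of_tendsto ((tendsto_mul_tail_of_tendstoMO hX hlim hhom one_pos).inv)
      (ENNReal.inv_ne_top.2 h0) (hRV.finiteAwayFrom_inv_tail_smul hX) ?_⟩
  filter_upwards [eventually_ge_atTop 1] with n hn
  have hγn : ENNReal.ofReal (γ n) ≠ 0 := (ENNReal.ofReal_pos.2 (hγ.1 n hn)).ne'
  rw [smul_smul, mul_one, ENNReal.mul_inv (Or.inl hγn) (Or.inl ENNReal.ofReal_ne_top),
    mul_right_comm, ENNReal.inv_mul_cancel hγn ENNReal.ofReal_ne_top, one_mul]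

theorem IsRegVar.tendsto_tail_ratio (hX : Measurable X) (hRV : IsRegVar P X α p) {δ : ℝ}
    (hδ : 0 < δ) :
    Tendsto (fun n : ℕ => P.real {ω | (n : ℝ) * δ < |X ω|} / P.real {ω | (n : ℝ) < |X ω|}) atTop
      (𝓝 (δ ^ (-α))) := by
  obtain ⟨μ, hhom, hone, hlim⟩ := hRV.exists_tendstoMO hX
  have h := tendsto_mul_tail_of_tendstoMO hX hlim hhom hδ
  rw [hhom.measure_away hδ, hone, mul_one] at h
  have h' := (ENNReal.tendsto_toReal ENNReal.ofReal_ne_top).comp h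
  rw [ENNReal.toReal_ofReal (by positivity)] at h'
  refine h'.congr fun n => ?_
  rw [Function.comp_apply, ENNReal.toReal_mul, ENNReal.toReal_inv, inv_mul_eq_div]
  rfl

theorem IsRegVar.measure_le_of_tendsto (hX : Measurable X) (hRV : IsRegVar P X α p)
    {μ : Measure ℝ} (hlim : TendstoMO {0}
      (fun n : ℕ => (P {ω | (n : ℝ) < |X ω|})⁻¹ • P.map (fun ω => X ω / n)) μ)
    {G : Set ℝ} (hG : IsOpen G) (hG1 : G ⊆ away 1) {l : ℝ}
    (hl : Tendsto (fun n : ℕ => P.real {ω | X ω / n ∈ G} / P.real {ω | (n : ℝ) < |X ω|}) atTop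
      (𝓝 l)) :
    μ G ≤ ENNReal.ofReal l := by
  refine (hlim.le_liminf G hG (areSeparated_zero_iff.2 ⟨1, one_pos, fun z hz =>
    (show 1 < |z| from hG1 hz).le⟩)).trans
    ((ENNReal.tendsto_ofReal hl).congr fun n => ?_).liminf_eq.le
  rw [Measure.smul_apply, Measure.map_apply (hX.div_const _) hG.measurableSet, smul_eq_mul,
    ENNReal.ofReal_div_of_pos (hRV.measureReal_lt_abs_pos hX n), ofReal_measureReal,
    ofReal_measureReal, ENNReal.div_eq_inv_mul]
  rfl

theorem IsRegVar.tendstoMO_nuAlpha (hX : Measurable X) (hα : 0 < α) (hRV : IsRegVar P X α p) :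
    TendstoMO {0} (fun n : ℕ => (P {ω | (n : ℝ) < |X ω|})⁻¹ • P.map (fun ω => X ω / n))
      (nuAlpha α p) := by
  obtain ⟨μ, hhom, hone, hlim⟩ := hRV.exists_tendstoMO hX
  have hle : μ (Ioi 1) ≤ ENNReal.ofReal p := by
    refine hRV.measure_le_of_tendsto hX hlim isOpen_Ioi (Ioi_subset_away 1)
      (hRV.tail_pos.congr' ?_)
    filter_upwards [eventually_gt_atTop 0] with n hn
    simp only [mem_Ioi, one_lt_div₀ (Nat.cast_pos.2 hn : (0 : ℝ) < n)]
  have hle' : μ (Iio (-1)) ≤ ENNReal.ofReal (1 - p) := by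
    refine hRV.measure_le_of_tendsto hX hlim isOpen_Iio (Iio_neg_subset_away 1)
      (hRV.tail_neg.congr' ?_)
    filter_upwards [eventually_gt_atTop 0] with n hn
    simp only [mem_Iio, div_lt_iff₀ (Nat.cast_pos.2 hn : (0 : ℝ) < n), neg_one_mul]
  have hsum : μ (Iio (-1)) + μ (Ioi 1) = ENNReal.ofReal (1 - p) + ENNReal.ofReal p := by
    rw [← measure_away μ one_pos, hone,
      ← ENNReal.ofReal_add (by linarith [hRV.p_le_one]) hRV.p_nonneg]
    simp
  have hpos : μ (Ioi 1) = ENNReal.ofReal p := by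
    refine hle.antisymm (not_lt.1 fun hlt => hsum.not_lt ?_)
    exact ENNReal.add_lt_add_of_le_of_lt (hle'.trans_lt ENNReal.ofReal_lt_top).ne hle' hlt
  have hneg : μ (Iio (-1)) = ENNReal.ofReal (1 - p) :=
    (ENNReal.add_left_inj ENNReal.ofReal_ne_top).1 (hpos ▸ hsum)
  refine hlim.congr_limit fun A hA hAC => ?_
  obtain ⟨δ, hδ, hAδ⟩ := areSeparated_zero_iff.1 hAC
  have hsub : A ⊆ away (δ / 2) := fun z hz => (half_lt_self hδ).trans_le (hAδ z hz)
  have h := hhom.restrict_away_eq_nuAlpha hα hRV.p_nonneg hRV.p_le_one hpos hneg (half_pos hδ)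
  rw [← inter_eq_left.2 hsub, ← Measure.restrict_apply hA, ← Measure.restrict_apply hA, h]

end RegVar

section Potter

variable {f : ℕ → ℝ} {β : ℝ}

theorem two_rpow_neg_pow (β : ℝ) (i : ℕ) :
    ((2 : ℝ) ^ (-β)) ^ i = ((2 ^ i : ℕ) : ℝ) ^ (-β) := by
  rw [← Real.rpow_natCast, ← Real.rpow_mul (by norm_num), mul_comm, Real.rpow_mul (by norm_num),
    Real.rpow_natCast, Nat.cast_pow, Nat.cast_ofNat]

theorem two_rpow_neg_pow_log_succ_le (hβ : 0 ≤ β) {n : ℕ} (hn : 1 ≤ n) :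
    ((2 : ℝ) ^ (-β)) ^ (Nat.log 2 n + 1) ≤ (n : ℝ) ^ (-β) := by
  rw [two_rpow_neg_pow]
  exact Real.rpow_le_rpow_of_nonpos (by exact_mod_cast hn)
    (by exact_mod_cast (Nat.lt_pow_succ_log_self one_lt_two n).le) (neg_nonpos.2 hβ)

theorem le_two_rpow_neg_pow_log (hβ : 0 ≤ β) {n : ℕ} (hn : 1 ≤ n) :
    (n : ℝ) ^ (-β) ≤ ((2 : ℝ) ^ (-β)) ^ Nat.log 2 n := by
  rw [two_rpow_neg_pow]
  exact Real.rpow_le_rpow_of_nonpos (by positivity)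
    (by exact_mod_cast Nat.pow_log_le_self 2 (by lia)) (neg_nonpos.2 hβ)

theorem exists_le_mul_rpow_neg (hf : Antitone f) (h0 : ∀ n, 0 < f n) (hβ : 0 ≤ β)
    (h : ∀ᶠ n in atTop, f (n * 2) ≤ 2 ^ (-β) * f n) :
    ∃ C : ℝ, 0 < C ∧ ∀ n : ℕ, 1 ≤ n → f n ≤ C * (n : ℝ) ^ (-β) := by
  obtain ⟨n₀, hn₀⟩ := eventually_atTop.1 h
  set b : ℝ := 2 ^ (-β)
  have hb0 : 0 < b := by positivity
  have hb1 : b ≤ 1 := Real.rpow_le_one_of_one_le_of_nonpos one_le_two (neg_nonpos.2 hβ)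
  have hdyadic : ∀ i, f (2 ^ (n₀ + i)) ≤ b ^ i * f 0 := by
    intro i
    induction i with
    | zero => simpa using hf (Nat.zero_le _)
    | succ i ih =>
      have hle : n₀ ≤ 2 ^ (n₀ + i) := (Nat.le_add_right _ _).trans Nat.lt_two_pow_self.le
      calc f (2 ^ (n₀ + i) * 2) ≤ b * f (2 ^ (n₀ + i)) := hn₀ _ hle
        _ ≤ b * (b ^ i * f 0) := by gcongr
        _ = b ^ (i + 1) * f 0 := by ring
  have hlog : ∀ n : ℕ, 1 ≤ n → f n * b ^ n₀ ≤ f 0 * b ^ Nat.log 2 n := by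
    intro n hn
    rcases le_total n₀ (Nat.log 2 n) with hle | hle
    · obtain ⟨l, hl⟩ := Nat.exists_eq_add_of_le hle
      have hfn : f n ≤ b ^ l * f 0 :=
        (hf (hl ▸ Nat.pow_log_le_self 2 (by lia))).trans (hdyadic l)
      calc f n * b ^ n₀ ≤ b ^ l * f 0 * b ^ n₀ := by gcongr
        _ = f 0 * b ^ Nat.log 2 n := by rw [hl]; ring
    · exact mul_le_mul (hf (Nat.zero_le _)) (pow_le_pow_of_le_one hb0.le hb1 hle) (by positivity)
        (h0 0).le
  refine ⟨f 0 / b ^ (n₀ + 1), div_pos (h0 0) (by positivity), fun n hn => ?_⟩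
  rw [div_mul_eq_mul_div, le_div_iff₀ (by positivity)]
  calc f n * b ^ (n₀ + 1) = f n * b ^ n₀ * b := by ring
    _ ≤ f 0 * b ^ Nat.log 2 n * b := mul_le_mul_of_nonneg_right (hlog n hn) hb0.le
    _ = f 0 * b ^ (Nat.log 2 n + 1) := by ring
    _ ≤ f 0 * (n : ℝ) ^ (-β) :=
      mul_le_mul_of_nonneg_left (two_rpow_neg_pow_log_succ_le hβ hn) (h0 0).le

theorem exists_mul_rpow_neg_le (hf : Antitone f) (h0 : ∀ n, 0 < f n) (hβ : 0 ≤ β)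
    (h : ∀ᶠ n in atTop, 2 ^ (-β) * f n ≤ f (n * 2)) :
    ∃ c : ℝ, 0 < c ∧ ∀ n : ℕ, 1 ≤ n → c * (n : ℝ) ^ (-β) ≤ f n := by
  obtain ⟨n₀, hn₀⟩ := eventually_atTop.1 h
  set b : ℝ := 2 ^ (-β)
  have hb0 : 0 < b := by positivity
  have hdyadic : ∀ i, b ^ i * f (n₀ + 1) ≤ f ((n₀ + 1) * 2 ^ i) := by
    intro i
    induction i with
    | zero => simp
    | succ i ih =>
      have hle : n₀ ≤ (n₀ + 1) * 2 ^ i :=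
        (Nat.le_succ _).trans (Nat.le_mul_of_pos_right _ (by positivity))
      calc b ^ (i + 1) * f (n₀ + 1) = b * (b ^ i * f (n₀ + 1)) := by ring
        _ ≤ b * f ((n₀ + 1) * 2 ^ i) := by gcongr
        _ ≤ f ((n₀ + 1) * 2 ^ i * 2) := hn₀ _ hle
        _ = f ((n₀ + 1) * 2 ^ (i + 1)) := by rw [mul_assoc, pow_succ]
  refine ⟨b * f (n₀ + 1), mul_pos hb0 (h0 _), fun n hn => ?_⟩
  calc b * f (n₀ + 1) * (n : ℝ) ^ (-β) ≤ b * f (n₀ + 1) * b ^ Nat.log 2 n :=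
        mul_le_mul_of_nonneg_left (le_two_rpow_neg_pow_log hβ hn) (mul_pos hb0 (h0 _)).le
    _ = b ^ (Nat.log 2 n + 1) * f (n₀ + 1) := by ring
    _ ≤ f ((n₀ + 1) * 2 ^ (Nat.log 2 n + 1)) := hdyadic _
    _ ≤ f n := hf ((Nat.lt_pow_succ_log_self one_lt_two n).le.trans
        (Nat.le_mul_of_pos_left _ (by lia)))

end Potter

section Moments

variable {Ω : Type*} [MeasurableSpace Ω] {P : Measure Ω} {X : Ω → ℝ} {α p : ℝ}

theorem antitone_measureReal_lt_abs (P : Measure Ω) [IsFiniteMeasure P] (X : Ω → ℝ) :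
    Antitone fun x : ℝ => P.real {ω | x < |X ω|} :=
  fun _ _ hxy => measureReal_mono fun _ hω => lt_of_le_of_lt hxy hω

theorem integrable_rpow_of_tail_le [IsFiniteMeasure P] (hX : AEMeasurable X P) {κ β C : ℝ}
    (hκ : 0 < κ) (hκβ : κ < β) (h : ∀ x, 1 ≤ x → P.real {ω | x < |X ω|} ≤ C * x ^ (-β)) :
    Integrable (fun ω => |X ω| ^ κ) P := by
  refine ⟨((continuous_abs.measurable.comp_aemeasurable hX).pow_const κ).aestronglyMeasurable, ?_⟩
  rw [hasFiniteIntegral_iff_ofReal (ae_of_all _ fun ω => by positivity),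
    lintegral_rpow_eq_lintegral_meas_lt_mul P (ae_of_all _ fun ω => abs_nonneg (X ω))
    (continuous_abs.measurable.comp_aemeasurable hX) hκ, ← Ioc_union_Ioi_eq_Ioi zero_le_one]
  refine ENNReal.mul_lt_top ENNReal.ofReal_lt_top
    ((lintegral_union_le _ _ _).trans_lt (ENNReal.add_lt_top.2 ⟨?_, ?_⟩))
  · have hint : IntegrableOn (fun t : ℝ => P.real univ * t ^ (κ - 1)) (Ioc 0 1) :=
      ((intervalIntegrable_iff_integrableOn_Ioc_of_le zero_le_one).1
        (intervalIntegral.intervalIntegrable_rpow' (by linarith))).const_mul _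
    refine (lintegral_mono fun t => ?_).trans_lt hint.lintegral_lt_top
    rw [ENNReal.ofReal_mul measureReal_nonneg, ofReal_measureReal]
    gcongr
    exact subset_univ _
  · have hint : IntegrableOn (fun t : ℝ => C * t ^ (κ - 1 - β)) (Ioi 1) :=
      (integrableOn_Ioi_rpow_of_lt (by linarith) one_pos).const_mul _
    refine (setLIntegral_mono' measurableSet_Ioi fun t ht => ?_).trans_lt hint.lintegral_lt_top
    have ht0 : 0 < t := zero_lt_one.trans ht
    rw [← ofReal_measureReal, ← ENNReal.ofReal_mul measureReal_nonneg,
      show κ - 1 - β = -β + (κ - 1) by ring, Real.rpow_add ht0, ← mul_assoc]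
    gcongr
    exact h t ht.le

variable [IsProbabilityMeasure P]

theorem IsRegVar.exists_tail_le (hX : Measurable X) (hRV : IsRegVar P X α p) {β : ℝ} (hβ : 0 ≤ β)
    (hβα : β < α) :
    ∃ C : ℝ, 0 < C ∧ ∀ x : ℝ, 1 ≤ x → P.real {ω | x < |X ω|} ≤ C * x ^ (-β) := by
  have hpos := hRV.measureReal_lt_abs_pos hX
  have hanti := antitone_measureReal_lt_abs P X
  obtain ⟨C, hC, h⟩ := exists_le_mul_rpow_neg (hanti.comp_monotone Nat.mono_cast)
    (fun n => hpos n) hβ <| by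
      have hlt : (2 : ℝ) ^ (-α) < 2 ^ (-β) :=
        Real.rpow_lt_rpow_of_exponent_lt one_lt_two (neg_lt_neg hβα)
      filter_upwards [(hRV.tendsto_tail_ratio hX two_pos).eventually_lt_const hlt] with n hn
      rw [div_lt_iff₀ (hpos n)] at hn
      simpa using hn.le
  refine ⟨C * 2 ^ β, by positivity, fun x hx => ?_⟩
  have hfloor : 1 ≤ ⌊x⌋₊ := Nat.le_floor (by simpa using hx)
  have hhalf : x / 2 ≤ ⌊x⌋₊ := by
    have : (1 : ℝ) ≤ ⌊x⌋₊ := by exact_mod_cast hfloor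
    linarith [Nat.lt_floor_add_one x]
  calc P.real {ω | x < |X ω|} ≤ P.real {ω | (⌊x⌋₊ : ℝ) < |X ω|} :=
        hanti (Nat.floor_le (zero_le_one.trans hx))
    _ ≤ C * (⌊x⌋₊ : ℝ) ^ (-β) := h _ hfloor
    _ ≤ C * (x / 2) ^ (-β) := mul_le_mul_of_nonneg_left
        (Real.rpow_le_rpow_of_nonpos (by linarith) hhalf (neg_nonpos.2 hβ)) hC.le
    _ = C * 2 ^ β * x ^ (-β) := by
        rw [Real.div_rpow (by linarith) zero_le_two, Real.rpow_neg zero_le_two, div_inv_eq_mul]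
        ring

theorem IsRegVar.exists_le_tail (hX : Measurable X) (hRV : IsRegVar P X α p) {β : ℝ} (hβ : 0 ≤ β)
    (hβα : α < β) :
    ∃ c : ℝ, 0 < c ∧ ∀ n : ℕ, 1 ≤ n → c * (n : ℝ) ^ (-β) ≤ P.real {ω | (n : ℝ) < |X ω|} := by
  have hpos := hRV.measureReal_lt_abs_pos hX
  refine exists_mul_rpow_neg_le ((antitone_measureReal_lt_abs P X).comp_monotone Nat.mono_cast)
    (fun n => hpos n) hβ ?_
  have hlt : (2 : ℝ) ^ (-β) < 2 ^ (-α) :=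
    Real.rpow_lt_rpow_of_exponent_lt one_lt_two (neg_lt_neg hβα)
  filter_upwards [(hRV.tendsto_tail_ratio hX two_pos).eventually_const_lt hlt] with n hn
  rw [lt_div_iff₀ (hpos n)] at hn
  simpa using hn.le

theorem IsRegVar.tendsto_mul_tail (hX : Measurable X) (hα : 1 < α) (hRV : IsRegVar P X α p) :
    Tendsto (fun n : ℕ => n * P.real {ω | (n : ℝ) < |X ω|}) atTop (𝓝 0) := by
  obtain ⟨β, hβ1, hβα⟩ := exists_between hα
  obtain ⟨C, -, h⟩ := hRV.exists_tail_le hX (by linarith) hβα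
  have hlim : Tendsto (fun n : ℕ => C * (n : ℝ) ^ (-(β - 1))) atTop (𝓝 0) := by
    simpa using ((tendsto_rpow_neg_atTop (sub_pos.2 hβ1)).comp
      tendsto_natCast_atTop_atTop).const_mul C
  refine tendsto_of_tendsto_of_tendsto_of_le_of_le' tendsto_const_nhds hlim
    (Eventually.of_forall fun n => by positivity) ?_
  filter_upwards [eventually_ge_atTop 1] with n hn
  have hn' : (1 : ℝ) ≤ n := by exact_mod_cast hn
  calc n * P.real {ω | (n : ℝ) < |X ω|} ≤ n * (C * (n : ℝ) ^ (-β)) := by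
        gcongr
        exact h n hn'
    _ = C * (n : ℝ) ^ (-(β - 1)) := by
        rw [show -(β - 1) = 1 + -β by ring, Real.rpow_add (by linarith), Real.rpow_one]
        ring

theorem IsRegVar.integrable_rpow (hX : Measurable X) (hRV : IsRegVar P X α p) {κ : ℝ}
    (hκ : 0 < κ) (hκα : κ < α) : Integrable (fun ω => |X ω| ^ κ) P := by
  obtain ⟨β, hκβ, hβα⟩ := exists_between hκα
  obtain ⟨C, -, h⟩ := hRV.exists_tail_le hX (hκ.le.trans hκβ.le) hβα
  exact integrable_rpow_of_tail_le hX.aemeasurable hκ hκβ h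

theorem IsRegVar.integrable (hX : Measurable X) (hα : 1 < α) (hRV : IsRegVar P X α p) :
    Integrable X P := by
  have h := hRV.integrable_rpow hX one_pos hα
  simp only [Real.rpow_one] at h
  exact (integrable_norm_iff hX.aestronglyMeasurable).1 h

end Moments

/-! ### Deviations of sums of truncated variables -/

section Truncation

/-- The truncation of `x` at level `b`, used to remove the large jumps of the walk. -/
noncomputable def trunc (b x : ℝ) : ℝ := if |x| ≤ b then x else 0

theorem abs_trunc_le_abs (b x : ℝ) : |trunc b x| ≤ |x| := by
  unfold trunc
  split_ifs <;> simp

theorem abs_trunc_le {b : ℝ} (hb : 0 ≤ b) (x : ℝ) : |trunc b x| ≤ b := by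
  unfold trunc
  split_ifs with h
  · exact h
  · simpa using hb

theorem measurable_trunc (b : ℝ) : Measurable (trunc b) :=
  Measurable.ite (measurableSet_le continuous_abs.measurable measurable_const) measurable_id
    measurable_const

theorem exp_le_one_add_add_rpow {κ : ℝ} (hκ1 : 1 ≤ κ) (hκ2 : κ ≤ 2) (x : ℝ) :
    Real.exp x ≤ 1 + x + |x| ^ κ * Real.exp |x| := by
  have he : 1 ≤ Real.exp |x| := Real.one_le_exp (abs_nonneg x)
  have hp : 0 ≤ |x| ^ κ := by positivity
  rcases le_or_gt |x| 1 with hx | hx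
  · have hexp := (abs_le.1 (Real.abs_exp_sub_one_sub_id_le hx)).2
    have hsq : x ^ 2 ≤ |x| ^ κ := by
      rcases eq_or_ne x 0 with rfl | hx0
      · simpa using hp
      rw [← sq_abs, ← Real.rpow_natCast]
      exact Real.rpow_le_rpow_of_exponent_ge (abs_pos.2 hx0) hx (by simpa using hκ2)
    nlinarith
  · have hle : |x| ≤ |x| ^ κ := by
      simpa using Real.rpow_le_rpow_of_exponent_le hx.le hκ1
    rcases le_or_gt 0 x with h0 | h0
    · rw [abs_of_nonneg h0] at *
      nlinarith [Real.exp_pos x]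
    · nlinarith [Real.exp_le_one_iff.2 h0.le, abs_of_neg h0]

variable {Ω : Type*} [MeasurableSpace Ω] {P : Measure Ω} {X : Ω → ℝ}

theorem tendsto_integral_trunc (hX : Measurable X) (hint : Integrable X P) {δ : ℝ} (hδ : 0 < δ) :
    Tendsto (fun n : ℕ => ∫ ω, trunc (n * δ) (X ω) ∂P) atTop (𝓝 (∫ ω, X ω ∂P)) := by
  refine tendsto_integral_of_dominated_convergence (fun ω => |X ω|)
    (fun n => ((measurable_trunc _).comp hX).aestronglyMeasurable) hint.abs
    (fun n => ae_of_all _ fun ω => abs_trunc_le_abs _ _) (ae_of_all _ fun ω => ?_)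
  refine tendsto_const_nhds.congr' ?_
  filter_upwards [(tendsto_natCast_atTop_atTop.atTop_mul_const hδ).eventually_ge_atTop |X ω|]
    with n hn
  simp only [trunc, hn, if_true]

variable [IsProbabilityMeasure P]

theorem integrable_exp_mul_trunc (hX : Measurable X) {b : ℝ} (hb : 0 ≤ b) (s : ℝ) :
    Integrable (fun ω => Real.exp (s * trunc b (X ω))) P :=
  integrable_exp_mul_of_mem_Icc ((measurable_trunc b).comp hX).aemeasurable
    (ae_of_all _ fun ω => abs_le.1 (abs_trunc_le hb (X ω)))

theorem mgf_trunc_le (hX : Measurable X) {κ : ℝ} (hκ1 : 1 ≤ κ) (hκ2 : κ ≤ 2)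
    (hint : Integrable X P) (hκ : Integrable (fun ω => |X ω| ^ κ) P) {b : ℝ} (hb : 0 ≤ b)
    (s : ℝ) :
    mgf (fun ω => trunc b (X ω)) P s ≤ Real.exp (s * ∫ ω, trunc b (X ω) ∂P +
      |s| ^ κ * (∫ ω, |X ω| ^ κ ∂P) * Real.exp (|s| * b)) := by
  have htrunc : Integrable (fun ω => trunc b (X ω)) P :=
    hint.mono ((measurable_trunc b).comp hX).aestronglyMeasurable
      (ae_of_all _ fun ω => abs_trunc_le_abs b (X ω))
  have hpointwise : ∀ ω, Real.exp (s * trunc b (X ω)) ≤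
      1 + s * trunc b (X ω) + |s| ^ κ * Real.exp (|s| * b) * |X ω| ^ κ := by
    intro ω
    refine (exp_le_one_add_add_rpow hκ1 hκ2 _).trans ?_
    rw [abs_mul, Real.mul_rpow (abs_nonneg _) (abs_nonneg _), mul_right_comm]
    have hpow : |trunc b (X ω)| ^ κ ≤ |X ω| ^ κ :=
      Real.rpow_le_rpow (abs_nonneg _) (abs_trunc_le_abs _ _) (by linarith)
    have hle := abs_trunc_le hb (X ω)
    gcongr
  have hlin : Integrable (fun ω => 1 + s * trunc b (X ω)) P :=
    (integrable_const 1).add (htrunc.const_mul s)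
  calc mgf (fun ω => trunc b (X ω)) P s
      ≤ ∫ ω, (1 + s * trunc b (X ω) + |s| ^ κ * Real.exp (|s| * b) * |X ω| ^ κ) ∂P :=
        integral_mono (integrable_exp_mul_trunc hX hb s) (hlin.add (hκ.const_mul _)) hpointwise
    _ = s * ∫ ω, trunc b (X ω) ∂P + |s| ^ κ * (∫ ω, |X ω| ^ κ ∂P) * Real.exp (|s| * b) + 1 := by
        rw [integral_add hlin (hκ.const_mul _),
          integral_add (integrable_const 1) (htrunc.const_mul s), integral_const_mul,
          integral_const_mul, integral_const, probReal_univ, one_smul]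
        ring
    _ ≤ _ := Real.add_one_le_exp _

theorem measureReal_abs_ge_le_exp_mul_mgf {Y : Ω → ℝ} {σ : ℝ} (hσ : 0 ≤ σ)
    (hY : ∀ s, Integrable (fun ω => Real.exp (s * Y ω)) P) (a : ℝ) :
    P.real {ω | a ≤ |Y ω|} ≤ Real.exp (-σ * a) * (mgf Y P σ + mgf Y P (-σ)) := by
  have hcover : {ω | a ≤ |Y ω|} ⊆ {ω | a ≤ Y ω} ∪ {ω | Y ω ≤ -a} := fun ω (hω : a ≤ |Y ω|) =>
    (le_abs.1 hω).imp id fun h => show Y ω ≤ -a by linarith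
  have hdown := measure_le_le_exp_mul_mgf (-a) (neg_nonpos.2 hσ) (hY (-σ))
  rw [neg_neg, mul_neg, ← neg_mul] at hdown
  rw [mul_add]
  exact (measureReal_mono hcover).trans ((measureReal_union_le _ _).trans
    (add_le_add (measure_ge_le_exp_mul_mgf a hσ (hY σ)) hdown))

end Truncation

section Deviation

/-- The terms of the sequence `Z` are measurable, independent and identically distributed. -/
structure IsIID {Ω : Type*} [MeasurableSpace Ω] (P : Measure Ω) (Z : ℕ → Ω → ℝ) : Prop where
  measurable : ∀ i, Measurable (Z i)
  indep : iIndepFun Z P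
  identDistrib : ∀ i, IdentDistrib (Z i) (Z 0) P P

variable {Ω : Type*} [MeasurableSpace Ω] {P : Measure Ω} {Z : ℕ → Ω → ℝ}

theorem IsIID.mgf_sum_trunc (hZ : IsIID P Z) (b s : ℝ) (k : ℕ) :
    mgf (fun ω => ∑ i ∈ Finset.range k, trunc b (Z i ω)) P s =
      mgf (fun ω => trunc b (Z 0 ω)) P s ^ k := by
  have hindep : iIndepFun (fun i ω => trunc b (Z i ω)) P :=
    hZ.indep.comp (fun _ => trunc b) fun _ => measurable_trunc b
  have hsum := hindep.mgf_sum (fun i => (measurable_trunc b).comp (hZ.measurable i))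
    (t := s) (Finset.range k)
  have hfun : ∑ i ∈ Finset.range k, (fun ω => trunc b (Z i ω)) =
      fun ω => ∑ i ∈ Finset.range k, trunc b (Z i ω) := by
    ext ω
    simp only [Finset.sum_apply]
  rw [hfun] at hsum
  rw [hsum, Finset.prod_congr rfl fun i _ => ?_, Finset.prod_const, Finset.card_range]
  exact congrFun (mgf_congr_identDistrib ((hZ.identDistrib i).comp (measurable_trunc b))) s

variable [IsProbabilityMeasure P] {κ M m δ ε : ℝ}

theorem IsIID.mgf_sum_trunc_sub_le (hZ : IsIID P Z) (hκ1 : 1 ≤ κ) (hκ2 : κ ≤ 2)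
    (hint : Integrable (Z 0) P) (hκ : Integrable (fun ω => |Z 0 ω| ^ κ) P) {b : ℝ} (hb : 0 ≤ b)
    (m s : ℝ) (k : ℕ) :
    mgf (fun ω => ∑ i ∈ Finset.range k, trunc b (Z i ω) - k * m) P s ≤
      Real.exp (k * (|s| * |∫ ω, trunc b (Z 0 ω) ∂P - m| +
        |s| ^ κ * (∫ ω, |Z 0 ω| ^ κ ∂P) * Real.exp (|s| * b))) := by
  simp only [sub_eq_add_neg _ ((k : ℝ) * m)]
  rw [mgf_add_const, hZ.mgf_sum_trunc]
  refine (mul_le_mul_of_nonneg_right (pow_le_pow_left₀ mgf_nonneg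
    (mgf_trunc_le (hZ.measurable 0) hκ1 hκ2 hint hκ hb s) k) (Real.exp_pos _).le).trans ?_
  rw [← Real.exp_nat_mul, ← Real.exp_add, Real.exp_le_exp, ← abs_mul]
  have hdrift := mul_le_mul_of_nonneg_left (le_abs_self (s * (∫ ω, trunc b (Z 0 ω) ∂P - m)))
    (Nat.cast_nonneg (α := ℝ) k)
  linarith

theorem IsIID.measureReal_abs_sum_trunc_ge_le (hZ : IsIID P Z) (hκ1 : 1 ≤ κ) (hκ2 : κ ≤ 2)
    (hint : Integrable (Z 0) P) (hκ : Integrable (fun ω => |Z 0 ω| ^ κ) P) {b : ℝ} (hb : 0 ≤ b)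
    {σ : ℝ} (hσ : 0 ≤ σ) (a m : ℝ) (k : ℕ) :
    P.real {ω | a ≤ |∑ i ∈ Finset.range k, trunc b (Z i ω) - k * m|} ≤
      2 * Real.exp (-σ * a + k * (σ * |∫ ω, trunc b (Z 0 ω) ∂P - m| +
        σ ^ κ * (∫ ω, |Z 0 ω| ^ κ ∂P) * Real.exp (σ * b))) := by
  have hintexp : ∀ s, Integrable (fun ω => Real.exp
      (s * (∑ i ∈ Finset.range k, trunc b (Z i ω) - k * m))) P := fun s => by
    refine integrable_exp_mul_of_mem_Icc (a := -(k * b) - k * m) (b := k * b - k * m)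
      ((Finset.measurable_fun_sum _ fun i _ => (measurable_trunc b).comp
        (hZ.measurable i)).sub_const _).aemeasurable (ae_of_all _ fun ω => ?_)
    have hsum : |∑ i ∈ Finset.range k, trunc b (Z i ω)| ≤ k * b := by
      simpa using Finset.abs_sum_le_sum_abs _ _ |>.trans
        (Finset.sum_le_sum fun i (_ : i ∈ Finset.range k) => abs_trunc_le hb (Z i ω))
    exact ⟨by linarith [(abs_le.1 hsum).1], by linarith [(abs_le.1 hsum).2]⟩
  have hup := hZ.mgf_sum_trunc_sub_le hκ1 hκ2 hint hκ hb m σ k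
  have hdown := hZ.mgf_sum_trunc_sub_le hκ1 hκ2 hint hκ hb m (-σ) k
  rw [abs_neg] at hdown
  rw [abs_of_nonneg hσ] at hup hdown
  refine (measureReal_abs_ge_le_exp_mul_mgf hσ hintexp a).trans ?_
  rw [Real.exp_add]
  nlinarith [Real.exp_pos (-σ * a)]

/-- With `σ = A log n / n`, the factor `exp (σ n δ) = n ^ (A δ)` is beaten by `n σ ^ κ`. -/
theorem tendsto_mul_log_div_rpow_mul_exp {A : ℝ} (hA : 0 ≤ A) (hκ1 : 1 < κ)
    (hAδ : A * δ ≤ (κ - 1) / 2) :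
    Tendsto (fun n : ℕ => n * ((A * Real.log n / n) ^ κ *
      Real.exp (A * Real.log n / n * (n * δ)))) atTop (𝓝 0) := by
  have hlog : Tendsto (fun n : ℕ => A ^ κ * (Real.log n ^ κ / (n : ℝ) ^ ((κ - 1) / 2))) atTop
      (𝓝 0) := by
    have h := (isLittleO_log_rpow_rpow_atTop κ (half_pos (sub_pos.2 hκ1))).tendsto_div_nhds_zero
    simpa using (h.comp tendsto_natCast_atTop_atTop).const_mul (A ^ κ)
  refine tendsto_of_tendsto_of_tendsto_of_le_of_le' tendsto_const_nhds hlog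
    (Eventually.of_forall fun n => by positivity) ?_
  filter_upwards [eventually_ge_atTop 1] with n hn
  have hn1 : (1 : ℝ) ≤ n := by exact_mod_cast hn
  have hn0 : (0 : ℝ) < n := by linarith
  have hexp : Real.exp (A * Real.log n / n * (n * δ)) = (n : ℝ) ^ (A * δ) := by
    rw [Real.rpow_def_of_pos hn0]
    congr 1
    field_simp
  have hpow : (n : ℝ) ^ κ = n * (n : ℝ) ^ ((κ - 1) / 2) * (n : ℝ) ^ ((κ - 1) / 2) := by
    rw [mul_assoc, ← Real.rpow_add hn0, ← Real.rpow_one_add' hn0.le (by linarith)]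
    congr 1
    ring
  rw [hexp, Real.div_rpow (by positivity) hn0.le,
    Real.mul_rpow hA (Real.log_nonneg hn1), hpow]
  calc n * (A ^ κ * Real.log n ^ κ / (n * (n : ℝ) ^ ((κ - 1) / 2) * (n : ℝ) ^ ((κ - 1) / 2)) *
        (n : ℝ) ^ (A * δ))
      ≤ n * (A ^ κ * Real.log n ^ κ / (n * (n : ℝ) ^ ((κ - 1) / 2) * (n : ℝ) ^ ((κ - 1) / 2)) *
        (n : ℝ) ^ ((κ - 1) / 2)) := by gcongr
    _ = A ^ κ * (Real.log n ^ κ / (n : ℝ) ^ ((κ - 1) / 2)) := by field_simp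

theorem IsIID.exists_eventually_abs_sum_trunc_ge_le (hZ : IsIID P Z) (hκ1 : 1 < κ) (hκ2 : κ ≤ 2)
    (hint : Integrable (Z 0) P) (hκ : Integrable (fun ω => |Z 0 ω| ^ κ) P)
    (hm : m = ∫ ω, Z 0 ω ∂P) (hM : 0 < M) (hε : 0 < ε) {r : ℝ} (hr : 0 < r) :
    ∃ δ₀ > 0, ∀ δ, 0 < δ → δ < δ₀ → ∀ᶠ n : ℕ in atTop, ∀ k ≤ ⌊(n : ℝ) * M⌋₊,
      P.real {ω | n * ε ≤ |∑ i ∈ Finset.range k, trunc (n * δ) (Z i ω) - k * m|} ≤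
        2 * Real.exp 1 * (n : ℝ) ^ (-r) := by
  set A : ℝ := 2 * r / ε with hA
  have hA0 : 0 < A := by positivity
  set K := ∫ ω, |Z 0 ω| ^ κ ∂P
  have : 0 ≤ K := integral_nonneg fun ω => by positivity
  refine ⟨(κ - 1) / (2 * A), div_pos (by linarith) (by positivity), fun δ hδ hδ' => ?_⟩
  have hAδ : A * δ ≤ (κ - 1) / 2 := by
    rw [lt_div_iff₀ (by positivity)] at hδ'
    linarith
  set e : ℕ → ℝ := fun n => |∫ ω, trunc (n * δ) (Z 0 ω) ∂P - m| with he
  have he0 : Tendsto e atTop (𝓝 0) := by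
    simpa [he, hm] using ((tendsto_integral_trunc (hZ.measurable 0) hint hδ).sub_const m).abs
  have herr : Tendsto (fun n : ℕ => M * K * (n * ((A * Real.log n / n) ^ κ *
      Real.exp (A * Real.log n / n * (n * δ))))) atTop (𝓝 0) := by
    simpa using (tendsto_mul_log_div_rpow_mul_exp hA0.le hκ1 hAδ).const_mul (M * K)
  filter_upwards [eventually_ge_atTop 1, herr.eventually_lt_const one_pos,
    he0.eventually_lt_const (show 0 < ε / (2 * M) by positivity)] with n hn herrn hen k hk
  have hn1 : (1 : ℝ) ≤ n := by exact_mod_cast hn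
  have hn0 : (0 : ℝ) < n := by linarith
  set σ : ℝ := A * Real.log n / n with hσ
  have hσ0 : 0 ≤ σ := div_nonneg (mul_nonneg hA0.le (Real.log_nonneg hn1)) hn0.le
  have hkM : (k : ℝ) ≤ n * M := (Nat.cast_le.2 hk).trans (Nat.floor_le (by positivity))
  refine (hZ.measureReal_abs_sum_trunc_ge_le hκ1.le hκ2 hint hκ (by positivity) hσ0 _ m k).trans ?_
  rw [mul_assoc 2 (Real.exp 1), Real.rpow_def_of_pos hn0, ← Real.exp_add]
  refine mul_le_mul_of_nonneg_left (Real.exp_le_exp.2 ?_) zero_le_two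
  have hσε : σ * (n * ε) = 2 * r * Real.log n := by
    rw [hσ, hA]
    field_simp
  calc -σ * (n * ε) + k * (σ * e n + σ ^ κ * K * Real.exp (σ * (n * δ)))
      ≤ -σ * (n * ε) + n * M * (σ * (ε / (2 * M)) + σ ^ κ * K * Real.exp (σ * (n * δ))) := by
        gcongr
    _ = -(σ * (n * ε)) / 2 + M * K * (n * (σ ^ κ * Real.exp (σ * (n * δ)))) := by
        field_simp
        ring
    _ ≤ 1 + Real.log n * -r := by linarith

/-- The event that the truncated walk deviates from its drift by at least `n ε`. -/
def truncDeviation (Z : ℕ → Ω → ℝ) (M m δ ε : ℝ) (n : ℕ) : Set Ω :=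
  {ω | ∃ k ≤ ⌊(n : ℝ) * M⌋₊,
    n * ε ≤ |∑ i ∈ Finset.range k, trunc (n * δ) (Z i ω) - k * m|}

theorem measureReal_truncDeviation_le (hM : 0 ≤ M) {n : ℕ} {c : ℝ}
    (h : ∀ k ≤ ⌊(n : ℝ) * M⌋₊, P.real {ω | n * ε ≤
      |∑ i ∈ Finset.range k, trunc (n * δ) (Z i ω) - k * m|} ≤ c) :
    P.real (truncDeviation Z M m δ ε n) ≤ (n * M + 1) * c := by
  have hc : 0 ≤ c := measureReal_nonneg.trans (h 0 (Nat.zero_le _))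
  have hcover : truncDeviation Z M m δ ε n ⊆ ⋃ k ∈ Finset.range (⌊(n : ℝ) * M⌋₊ + 1),
      {ω | n * ε ≤ |∑ i ∈ Finset.range k, trunc (n * δ) (Z i ω) - k * m|} := by
    rintro ω ⟨k, hk, hω⟩
    exact mem_biUnion (Finset.mem_range.2 (Nat.lt_succ_of_le hk)) hω
  calc P.real (truncDeviation Z M m δ ε n)
      ≤ ∑ _k ∈ Finset.range (⌊(n : ℝ) * M⌋₊ + 1), c :=
        (measureReal_mono hcover (measure_ne_top _ _)).trans
          ((measureReal_biUnion_finset_le _ _).trans (Finset.sum_le_sum fun k hk =>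
            h k (Nat.lt_succ_iff.1 (Finset.mem_range.1 hk))))
    _ = (⌊(n : ℝ) * M⌋₊ + 1) * c := by simp
    _ ≤ (n * M + 1) * c := by
        gcongr
        exact Nat.floor_le (by positivity)

theorem IsIID.exists_tendsto_rpow_mul_truncDeviation (hZ : IsIID P Z) (hκ1 : 1 < κ) (hκ2 : κ ≤ 2)
    (hint : Integrable (Z 0) P) (hκ : Integrable (fun ω => |Z 0 ω| ^ κ) P)
    (hm : m = ∫ ω, Z 0 ω ∂P) (hM : 0 < M) (hε : 0 < ε) {r : ℝ} (hr : 0 ≤ r) :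
    ∃ δ₀ > 0, ∀ δ, 0 < δ → δ < δ₀ →
      Tendsto (fun n : ℕ => (n : ℝ) ^ r * P.real (truncDeviation Z M m δ ε n)) atTop (𝓝 0) := by
  obtain ⟨δ₀, hδ₀, h⟩ := hZ.exists_eventually_abs_sum_trunc_ge_le hκ1 hκ2 hint hκ hm hM hε
    (show 0 < r + 2 by positivity)
  refine ⟨δ₀, hδ₀, fun δ hδ hδ' => ?_⟩
  have hlim : Tendsto (fun n : ℕ => 2 * Real.exp 1 * (M * (n : ℝ)⁻¹ + (n : ℝ)⁻¹ ^ 2)) atTop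
      (𝓝 0) := by
    have hinv := tendsto_inv_atTop_nhds_zero_nat (𝕜 := ℝ)
    simpa using ((hinv.const_mul M).add (hinv.pow 2)).const_mul (2 * Real.exp 1)
  refine tendsto_of_tendsto_of_tendsto_of_le_of_le' tendsto_const_nhds hlim
    (Eventually.of_forall fun n => by positivity) ?_
  filter_upwards [h δ hδ hδ', eventually_ge_atTop 1] with n hn hn1
  have hn0 : (0 : ℝ) < n := by exact_mod_cast hn1
  calc (n : ℝ) ^ r * P.real (truncDeviation Z M m δ ε n)
      ≤ (n : ℝ) ^ r * ((n * M + 1) * (2 * Real.exp 1 * (n : ℝ) ^ (-(r + 2)))) := by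
        gcongr
        exact measureReal_truncDeviation_le hM.le hn
    _ = 2 * Real.exp 1 * (M * (n : ℝ)⁻¹ + (n : ℝ)⁻¹ ^ 2) := by
        rw [Real.rpow_neg hn0.le, Real.rpow_add hn0, Real.rpow_two]
        field_simp

theorem IsIID.exists_tendsto_rate_mul_truncDeviation {α p : ℝ} (hZ : IsIID P Z)
    (hRV : IsRegVar P (Z 0) α p) (hα : 1 < α) (hm : m = ∫ ω, Z 0 ω ∂P) (hM : 0 < M) (hε : 0 < ε)
    (j : ℕ) :
    ∃ δ₀ > 0, ∀ δ, 0 < δ → δ < δ₀ →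
      Tendsto (fun n : ℕ => ENNReal.ofReal (rate P (Z 0) j n) *
        P (truncDeviation Z M m δ ε n)) atTop (𝓝 0) := by
  have hX := hZ.measurable 0
  obtain ⟨κ, hκ1, hκ2⟩ := exists_between (lt_min hα one_lt_two)
  obtain ⟨δ₀, hδ₀, h⟩ := hZ.exists_tendsto_rpow_mul_truncDeviation hκ1
    (hκ2.le.trans (min_le_right _ _)) (hRV.integrable hX hα)
    (hRV.integrable_rpow hX (by linarith) (hκ2.trans_le (min_le_left _ _))) hm hM hε
    (r := α * j) (by positivity)
  refine ⟨δ₀, hδ₀, fun δ hδ hδ' => ?_⟩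
  obtain ⟨c, hc, hcT⟩ := hRV.exists_le_tail hX (β := α + 1) (by linarith) (by linarith)
  have hlim := ENNReal.tendsto_ofReal ((h δ hδ hδ').const_mul (c⁻¹ ^ j))
  rw [mul_zero, ENNReal.ofReal_zero] at hlim
  refine tendsto_of_tendsto_of_tendsto_of_le_of_le' tendsto_const_nhds hlim
    (Eventually.of_forall fun _ => zero_le) ?_
  filter_upwards [eventually_ge_atTop 1] with n hn
  have hn0 : (0 : ℝ) < n := by exact_mod_cast hn
  have hmul : c * (n : ℝ) ^ (-α) ≤ n * P.real {ω | (n : ℝ) < |Z 0 ω|} :=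
    calc c * (n : ℝ) ^ (-α) = n * (c * (n : ℝ) ^ (-(α + 1))) := by
          rw [show -α = 1 + -(α + 1) by ring, Real.rpow_add hn0, Real.rpow_one]
          ring
      _ ≤ n * P.real {ω | (n : ℝ) < |Z 0 ω|} := by
          gcongr
          exact hcT n hn
  have hrate : rate P (Z 0) j n ≤ c⁻¹ ^ j * (n : ℝ) ^ (α * j) :=
    calc rate P (Z 0) j n ≤ ((c * (n : ℝ) ^ (-α)) ^ j)⁻¹ := by
          rw [rate]
          gcongr
      _ = c⁻¹ ^ j * (n : ℝ) ^ (α * j) := by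
          rw [mul_pow, mul_inv, inv_pow, Real.rpow_neg hn0.le, inv_pow, inv_inv,
            Real.rpow_mul hn0.le, Real.rpow_natCast]
  rw [← ofReal_measureReal, ← ENNReal.ofReal_mul (by unfold rate; positivity), ← mul_assoc]
  gcongr

end Deviation

/-! ### Weak convergence of the rescaled large jumps and their times -/

section FiniteMeasures

variable {E : Type*} [MeasurableSpace E]

/-- A finite measure as a point of the space `FiniteMeasure E`, which carries the topology of weak
convergence. -/
def finiteMeasureOf (μ : Measure E) (h : IsFiniteMeasure μ := by infer_instance) :
    FiniteMeasure E :=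
  ⟨μ, h⟩

theorem toMeasure_finiteMeasureOf (μ : Measure E) (h : IsFiniteMeasure μ) :
    (finiteMeasureOf μ h : Measure E) = μ := rfl

theorem finiteMeasure_apply_eq_mass_mul_normalize [Nonempty E] (μ : FiniteMeasure E) (s : Set E) :
    (μ : Measure E) s = μ.mass * (μ.normalize : Measure E) s := by
  rw [← FiniteMeasure.ennreal_coeFn_eq_coeFn_toMeasure, μ.self_eq_mass_mul_normalize,
    ENNReal.coe_mul, ProbabilityMeasure.ennreal_coeFn_eq_coeFn_toMeasure]

theorem nonempty_of_finiteMeasure_ne_zero {μ : FiniteMeasure E} (h : μ ≠ 0) : Nonempty E := by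
  by_contra hE
  have := not_nonempty_iff.1 hE
  exact h (Subtype.ext (Measure.eq_zero_of_isEmpty _))

variable [TopologicalSpace E] [OpensMeasurableSpace E] {μs : ℕ → FiniteMeasure E}
  {μ : FiniteMeasure E}

theorem le_liminf_measure_open_of_tendsto_finiteMeasure [HasOuterApproxClosed E]
    (h : Tendsto μs atTop (𝓝 μ)) {G : Set E} (hG : IsOpen G) :
    (μ : Measure E) G ≤ liminf (fun n => (μs n : Measure E) G) atTop := by
  rcases eq_or_ne μ 0 with rfl | h0
  · simp
  have := nonempty_of_finiteMeasure_ne_zero h0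
  simp only [finiteMeasure_apply_eq_mass_mul_normalize _ G]
  refine le_trans ?_ ENNReal.le_liminf_mul
  rw [(ENNReal.tendsto_coe.2 h.mass).liminf_eq]
  gcongr
  exact ProbabilityMeasure.le_liminf_measure_open_of_tendsto
    (FiniteMeasure.tendsto_normalize_of_tendsto h h0) hG

theorem tendsto_finiteMeasure_of_forall_isOpen_le_liminf
    (hmass : Tendsto (fun n => (μs n).mass) atTop (𝓝 μ.mass))
    (hopen : ∀ G, IsOpen G → (μ : Measure E) G ≤ liminf (fun n => (μs n : Measure E) G) atTop) :
    Tendsto μs atTop (𝓝 μ) := by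
  rcases eq_or_ne μ 0 with rfl | h0
  · exact FiniteMeasure.tendsto_zero_of_tendsto_zero_mass (by simpa using hmass)
  have := nonempty_of_finiteMeasure_ne_zero h0
  have hm0 : μ.mass ≠ 0 := μ.mass_nonzero_iff.2 h0
  have hnormalize : ∀ ν : FiniteMeasure E, ν.mass ≠ 0 → ∀ G,
      (ν.normalize : Measure E) G = (ν.mass : ℝ≥0∞)⁻¹ * (ν : Measure E) G := fun ν hν G => by
    rw [finiteMeasure_apply_eq_mass_mul_normalize, ← mul_assoc,
      ENNReal.inv_mul_cancel (ENNReal.coe_ne_zero.2 hν) ENNReal.coe_ne_top, one_mul]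
  refine (FiniteMeasure.tendsto_normalize_iff_tendsto h0).1
    ⟨tendsto_of_forall_isOpen_le_liminf_nat' fun G hG => ?_, hmass⟩
  rw [hnormalize μ hm0, liminf_congr ((hmass.eventually_ne hm0).mono fun n hn =>
    hnormalize (μs n) hn G)]
  refine le_trans ?_ ENNReal.le_liminf_mul
  rw [(tendsto_inv_iff.2 (ENNReal.tendsto_coe.2 hmass)).liminf_eq]
  gcongr
  exact hopen G hG

end FiniteMeasures

section Products

theorem finiteMeasure_pi_smul {ι : Type*} [Fintype ι] {E : ι → Type*}
    [∀ i, MeasurableSpace (E i)] (c : ι → NNReal) (μ : ∀ i, FiniteMeasure (E i)) :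
    FiniteMeasure.pi (fun i => c i • μ i) = (∏ i, c i) • FiniteMeasure.pi μ := by
  refine Subtype.ext (Measure.pi_eq fun s _ => ?_)
  simp only [FiniteMeasure.val_eq_toMeasure, FiniteMeasure.toMeasure_smul,
    FiniteMeasure.toMeasure_pi, Measure.smul_apply, Measure.pi_pi, ENNReal.smul_def, smul_eq_mul,
    Finset.prod_mul_distrib, ENNReal.ofNNReal_finsetProd]

theorem finiteMeasure_prod_smul {E F : Type*} [MeasurableSpace E] [MeasurableSpace F]
    (a b : NNReal) (μ : FiniteMeasure E) (ν : FiniteMeasure F) :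
    (a • μ).prod (b • ν) = (a * b) • μ.prod ν := by
  refine Subtype.ext ?_
  simp only [FiniteMeasure.val_eq_toMeasure, FiniteMeasure.toMeasure_smul,
    FiniteMeasure.toMeasure_prod, ENNReal.smul_def, Measure.prod_smul_left,
    Measure.prod_smul_right, smul_smul, ENNReal.coe_mul, mul_comm]

variable {ι : Type*} [Fintype ι] {E : ι → Type*} [∀ i, MeasurableSpace (E i)]
  [∀ i, TopologicalSpace (E i)] [∀ i, SecondCountableTopology (E i)]
  [∀ i, TopologicalSpace.PseudoMetrizableSpace (E i)] [∀ i, OpensMeasurableSpace (E i)]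

theorem continuous_finiteMeasure_pi :
    Continuous fun μ : ∀ i, FiniteMeasure (E i) => FiniteMeasure.pi μ := by
  refine continuous_iff_continuousAt.2 fun μ => ?_
  have hmass : ContinuousAt (fun ν : ∀ i, FiniteMeasure (E i) => ∏ i, (ν i).mass) μ :=
    Continuous.continuousAt (by fun_prop)
  by_cases h : ∃ i, μ i = 0
  · obtain ⟨i, hi⟩ := h
    have h0 : ∏ i, (μ i).mass = 0 :=
      Finset.prod_eq_zero (Finset.mem_univ i) ((μ i).mass_zero_iff.2 hi)
    rw [ContinuousAt, (FiniteMeasure.pi μ).mass_zero_iff.1 ((FiniteMeasure.mass_pi μ).trans h0)]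
    rw [ContinuousAt, h0] at hmass
    exact FiniteMeasure.tendsto_zero_of_tendsto_zero_mass (by simpa using hmass)
  push Not at h
  have : ∀ i, Nonempty (E i) := fun i => nonempty_of_finiteMeasure_ne_zero (h i)
  have hnormalize : ContinuousAt
      (fun ν : ∀ i, FiniteMeasure (E i) => ProbabilityMeasure.pi fun i => (ν i).normalize) μ :=
    (ProbabilityMeasure.continuous_pi.tendsto _).comp (tendsto_pi_nhds.2 fun i =>
      FiniteMeasure.tendsto_normalize_of_tendsto (tendsto_pi_nhds.1 tendsto_id i) (h i))
  refine (hmass.smul (ProbabilityMeasure.toFiniteMeasure_continuous.continuousAt.comp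
    hnormalize)).congr (Eventually.of_forall fun ν => ?_)
  refine (finiteMeasure_pi_smul _ fun i => (ν i).normalize.toFiniteMeasure).symm.trans ?_
  simp only [← FiniteMeasure.self_eq_mass_smul_normalize]

theorem continuous_finiteMeasure_prod {E F : Type*} [MeasurableSpace E] [TopologicalSpace E]
    [SecondCountableTopology E] [TopologicalSpace.PseudoMetrizableSpace E]
    [OpensMeasurableSpace E] [MeasurableSpace F] [TopologicalSpace F] [SecondCountableTopology F]
    [TopologicalSpace.PseudoMetrizableSpace F] [OpensMeasurableSpace F] :
    Continuous fun μ : FiniteMeasure E × FiniteMeasure F => μ.1.prod μ.2 := by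
  refine continuous_iff_continuousAt.2 fun μ => ?_
  have hmass : ContinuousAt
      (fun ν : FiniteMeasure E × FiniteMeasure F => ν.1.mass * ν.2.mass) μ :=
    Continuous.continuousAt (by fun_prop)
  by_cases h : μ.1.mass * μ.2.mass = 0
  · rw [ContinuousAt, (μ.1.prod μ.2).mass_zero_iff.1 ((FiniteMeasure.mass_prod _ _).trans h)]
    rw [ContinuousAt, h] at hmass
    exact FiniteMeasure.tendsto_zero_of_tendsto_zero_mass (by simpa using hmass)
  have h₁ := μ.1.mass_nonzero_iff.1 (left_ne_zero_of_mul h)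
  have h₂ := μ.2.mass_nonzero_iff.1 (right_ne_zero_of_mul h)
  have := nonempty_of_finiteMeasure_ne_zero h₁
  have := nonempty_of_finiteMeasure_ne_zero h₂
  have hnormalize : ContinuousAt
      (fun ν : FiniteMeasure E × FiniteMeasure F => ν.1.normalize.prod ν.2.normalize) μ :=
    (ProbabilityMeasure.continuous_prod.tendsto _).comp
      ((FiniteMeasure.tendsto_normalize_of_tendsto continuousAt_fst h₁).prodMk_nhds
        (FiniteMeasure.tendsto_normalize_of_tendsto continuousAt_snd h₂))
  refine (hmass.smul (ProbabilityMeasure.toFiniteMeasure_continuous.continuousAt.comp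
    hnormalize)).congr (Eventually.of_forall fun ν => ?_)
  refine (finiteMeasure_prod_smul _ _ ν.1.normalize.toFiniteMeasure
    ν.2.normalize.toFiniteMeasure).symm.trans ?_
  simp only [← FiniteMeasure.self_eq_mass_smul_normalize]

end Products

section Grid

/-- The points `1 / n, …, N / n`: the possible jump times of a rescaled walk. -/
noncomputable def gridPoint (n : ℕ) {N : ℕ} (k : Fin N) : ℝ := ((k : ℕ) + 1 : ℝ) / n

theorem gridPoint_strictMono {n N : ℕ} (hn : 1 ≤ n) :
    StrictMono (gridPoint n : Fin N → ℝ) := fun a b hab => by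
  have : (0 : ℝ) < n := by exact_mod_cast hn
  have : ((a : ℕ) : ℝ) < (b : ℕ) := by exact_mod_cast hab
  unfold gridPoint
  gcongr

theorem gridPoint_mem {n : ℕ} (hn : 1 ≤ n) {M : ℝ} (hM : 0 ≤ M) (k : Fin ⌊(n : ℝ) * M⌋₊) :
    gridPoint n k ∈ Icc 0 M := by
  have hn' : (0 : ℝ) < n := by exact_mod_cast hn
  have hk : ((k : ℕ) + 1 : ℝ) ≤ ⌊(n : ℝ) * M⌋₊ := by exact_mod_cast k.2
  refine ⟨by unfold gridPoint; positivity, ?_⟩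
  rw [gridPoint, div_le_iff₀ hn', mul_comm M]
  exact hk.trans (Nat.floor_le (by positivity))

theorem gridPoint_le_iff {n N : ℕ} (hn : 1 ≤ n) (k : Fin N) (x : ℝ) :
    gridPoint n k ≤ x ↔ (k : ℕ) < ⌊(n : ℝ) * x⌋₊ := by
  have hn' : (0 : ℝ) < n := by exact_mod_cast hn
  rw [gridPoint, div_le_iff₀ hn', ← Nat.succ_le_iff, Nat.le_floor_iff' (Nat.succ_ne_zero _),
    mul_comm, Nat.cast_succ]

theorem tendsto_natFloor_mul_div {M : ℝ} (hM : 0 ≤ M) :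
    Tendsto (fun n : ℕ => (⌊(n : ℝ) * M⌋₊ : ℝ) / n) atTop (𝓝 M) := by
  simpa only [mul_comm, Function.comp_def] using
    (tendsto_nat_floor_mul_div_atTop hM).comp (tendsto_natCast_atTop_atTop (R := ℝ))

theorem tendsto_natCeil_mul_div {t : ℝ} (ht : 0 ≤ t) :
    Tendsto (fun n : ℕ => (⌈(n : ℝ) * t⌉₊ : ℝ) / n) atTop (𝓝 t) := by
  simpa only [mul_comm, Function.comp_def] using
    (tendsto_nat_ceil_mul_div_atTop ht).comp (tendsto_natCast_atTop_atTop (R := ℝ))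

theorem natCeil_mul_div_eq_gridPoint {n N : ℕ} (hn : 1 ≤ n) (k : Fin N) {t : ℝ}
    (ht : t ∈ Ioc ((k : ℕ) / n : ℝ) (((k : ℕ) + 1 : ℕ) / n)) :
    (⌈(n : ℝ) * t⌉₊ : ℝ) / n = gridPoint n k := by
  have hn' : (0 : ℝ) < n := by exact_mod_cast hn
  have hceil : ⌈(n : ℝ) * t⌉₊ = (k : ℕ) + 1 := by
    rw [Nat.ceil_eq_iff (Nat.succ_ne_zero _), Nat.succ_sub_one, mul_comm]
    exact ⟨(div_lt_iff₀ hn').1 ht.1, (le_div_iff₀ hn').1 ht.2⟩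
  rw [hceil, gridPoint, Nat.cast_succ]

theorem intervalIntegral_natCeil_mul_div (f : ℝ → ℝ) {n : ℕ} (hn : 1 ≤ n) (N : ℕ) :
    ∫ t in (0 : ℝ)..N / n, f (⌈(n : ℝ) * t⌉₊ / n) = (∑ k : Fin N, f (gridPoint n k)) / n := by
  have : (0 : ℝ) < n := by exact_mod_cast hn
  have hle : ∀ k : ℕ, (k / n : ℝ) ≤ ((k + 1 : ℕ) : ℝ) / n := fun k => by gcongr; simp
  have hconst : ∀ k : Fin N, EqOn (fun t => f (⌈(n : ℝ) * t⌉₊ / n)) (fun _ => f (gridPoint n k))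
      (Ioc ((k : ℕ) / n) (((k : ℕ) + 1 : ℕ) / n)) := fun k t ht =>
    congrArg f (natCeil_mul_div_eq_gridPoint hn k ht)
  have hsum := intervalIntegral.sum_integral_adjacent_intervals (μ := volume)
    (f := fun t => f (⌈(n : ℝ) * t⌉₊ / n)) (a := fun k : ℕ => (k / n : ℝ)) (n := N)
    fun k hk => (intervalIntegrable_const (c := f (gridPoint n ⟨k, hk⟩))).congr
      (by rw [uIoc_of_le (hle k)]; exact (hconst ⟨k, hk⟩).symm)
  rw [Nat.cast_zero, zero_div] at hsum
  rw [← hsum, Finset.sum_range, Finset.sum_div]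
  refine Finset.sum_congr rfl fun k _ => ?_
  rw [intervalIntegral.integral_of_le (hle k),
    setIntegral_congr_fun measurableSet_Ioc (hconst k), ← intervalIntegral.integral_of_le (hle k),
    intervalIntegral.integral_const, smul_eq_mul, Nat.cast_succ]
  ring

theorem tendsto_sum_gridPoint_div {M : ℝ} (hM : 0 ≤ M) {f : ℝ → ℝ} (hf : Continuous f) {C : ℝ}
    (hC : ∀ x, |f x| ≤ C) :
    Tendsto (fun n : ℕ => (∑ k : Fin ⌊(n : ℝ) * M⌋₊, f (gridPoint n k)) / n) atTop
      (𝓝 (∫ t in Icc 0 M, f t)) := by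
  let F : ℕ → ℝ → ℝ := fun n =>
    (Ioc 0 ((⌊(n : ℝ) * M⌋₊ : ℝ) / n)).indicator fun t => f (⌈(n : ℝ) * t⌉₊ / n)
  have hF : ∀ᶠ n : ℕ in atTop, ∫ t in Ioc 0 M, F n t =
      (∑ k : Fin ⌊(n : ℝ) * M⌋₊, f (gridPoint n k)) / n := by
    filter_upwards [eventually_ge_atTop 1] with n hn
    have hn' : (0 : ℝ) < n := by exact_mod_cast hn
    have hle : (⌊(n : ℝ) * M⌋₊ : ℝ) / n ≤ M := by
      rw [div_le_iff₀ hn', mul_comm M]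
      exact Nat.floor_le (by positivity)
    rw [setIntegral_indicator measurableSet_Ioc, inter_eq_right.2 (Ioc_subset_Ioc_right hle),
      ← intervalIntegral.integral_of_le (by positivity), intervalIntegral_natCeil_mul_div f hn]
  rw [integral_Icc_eq_integral_Ioc]
  refine Tendsto.congr' hF (tendsto_integral_of_dominated_convergence (fun _ => C)
    (fun n => ?_) (integrableOn_const measure_Ioc_lt_top.ne) (fun n => ?_) ?_)
  · refine (Measurable.indicator ?_ measurableSet_Ioc).aestronglyMeasurable
    fun_prop
  · refine ae_of_all _ fun t => (norm_indicator_le_norm_self _ _).trans (hC _)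
  · filter_upwards [ae_restrict_mem measurableSet_Ioc,
      ae_restrict_of_ae (Measure.ae_ne volume M)] with t ht htM
    refine ((hf.tendsto t).comp (tendsto_natCeil_mul_div ht.1.le)).congr' ?_
    filter_upwards [(tendsto_natFloor_mul_div hM).eventually_const_lt (lt_of_le_of_ne ht.2 htM)]
      with n hn
    have htn : t ∈ Ioc 0 ((⌊(n : ℝ) * M⌋₊ : ℝ) / n) := ⟨ht.1, hn.le⟩
    exact (indicator_of_mem htn fun t => f (⌈(n : ℝ) * t⌉₊ / n)).symm

/-- The measure that puts mass `1 / n` at each of the points `1 / n, …, ⌊n M⌋ / n`. -/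
noncomputable def gridMeasure (M : ℝ) (n : ℕ) : FiniteMeasure ℝ :=
  (n : NNReal)⁻¹ • finiteMeasureOf (∑ k : Fin ⌊(n : ℝ) * M⌋₊, Measure.dirac (gridPoint n k))

theorem tendsto_gridMeasure {M : ℝ} (hM : 0 ≤ M) :
    Tendsto (gridMeasure M) atTop (𝓝 (finiteMeasureOf (volume.restrict (Icc 0 M)))) := by
  refine FiniteMeasure.tendsto_iff_forall_integral_tendsto.2 fun f => ?_
  refine (tendsto_sum_gridPoint_div hM f.continuous f.norm_coe_le_norm).congr fun n => ?_
  rw [gridMeasure, FiniteMeasure.toMeasure_smul, toMeasure_finiteMeasureOf,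
    integral_smul_nnreal_measure, integral_finsetSum_measure fun k _ => f.integrable _]
  simp only [integral_dirac, NNReal.smul_def, NNReal.coe_inv, NNReal.coe_natCast, smul_eq_mul,
    div_eq_inv_mul]

end Grid

section JumpLaw

variable {Ω : Type*} [MeasurableSpace Ω] {P : Measure Ω} [IsProbabilityMeasure P] {X : Ω → ℝ}
  {α p δ M : ℝ} {j : ℕ}

/-- The law of `X / n` restricted to `{z | δ < |z|}` and divided by `P (n < |X|)`, which converges
to the restriction of `nuAlpha`. -/
noncomputable def jumpLaw (P : Measure Ω) [IsProbabilityMeasure P] (X : Ω → ℝ) (δ : ℝ) (n : ℕ) :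
    FiniteMeasure ℝ :=
  (P {ω | (n : ℝ) < |X ω|}).toNNReal⁻¹ •
    finiteMeasureOf ((P.map fun ω => X ω / n).restrict (away δ))

theorem IsRegVar.jumpLaw_apply (hX : Measurable X) (hRV : IsRegVar P X α p) (δ : ℝ) (n : ℕ)
    {A : Set ℝ} (hA : MeasurableSet A) :
    (jumpLaw P X δ n : Measure ℝ) A =
      ((P {ω | (n : ℝ) < |X ω|})⁻¹ • P.map fun ω => X ω / n) (A ∩ away δ) := by
  have h0 : (P {ω | (n : ℝ) < |X ω|}).toNNReal ≠ 0 :=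
    (ENNReal.toNNReal_pos (hRV.measure_lt_abs_ne_zero hX n) (measure_ne_top _ _)).ne'
  rw [jumpLaw, FiniteMeasure.toMeasure_smul, toMeasure_finiteMeasureOf, Measure.smul_apply,
    Measure.smul_apply, Measure.restrict_apply hA, ENNReal.smul_def, ENNReal.coe_inv h0,
    ENNReal.coe_toNNReal (measure_ne_top _ _)]

theorem isFiniteMeasure_nuAlpha_restrict_away (hα : 0 < α) (hp₀ : 0 ≤ p) (hp₁ : p ≤ 1)
    (hδ : 0 < δ) : IsFiniteMeasure ((nuAlpha α p).restrict (away δ)) :=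
  isFiniteMeasure_restrict.2 (by rw [nuAlpha_away hα hp₀ hp₁ hδ]; exact ENNReal.ofReal_ne_top)

theorem IsRegVar.tendsto_jumpLaw (hX : Measurable X) (hα : 0 < α) (hRV : IsRegVar P X α p)
    (hδ : 0 < δ) :
    Tendsto (jumpLaw P X δ) atTop (𝓝 (finiteMeasureOf ((nuAlpha α p).restrict (away δ))
      (isFiniteMeasure_nuAlpha_restrict_away hα hRV.p_nonneg hRV.p_le_one hδ))) := by
  refine tendsto_finiteMeasure_of_forall_isOpen_le_liminf ?_ fun G hG => ?_
  · rw [← ENNReal.tendsto_coe]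
    simp only [FiniteMeasure.ennreal_mass, hRV.jumpLaw_apply hX δ _ MeasurableSet.univ,
      toMeasure_finiteMeasureOf, Measure.restrict_apply_univ, univ_inter,
      nuAlpha_away hα hRV.p_nonneg hRV.p_le_one hδ]
    refine (ENNReal.tendsto_ofReal (hRV.tendsto_tail_ratio hX hδ)).congr' ?_
    filter_upwards [eventually_ge_atTop 1] with n hn
    rw [Measure.smul_apply, map_div_apply_away hX hn, smul_eq_mul,
      ENNReal.ofReal_div_of_pos (hRV.measureReal_lt_abs_pos hX n), ofReal_measureReal,
      ofReal_measureReal, ENNReal.div_eq_inv_mul]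
  · simp only [toMeasure_finiteMeasureOf, Measure.restrict_apply hG.measurableSet,
      hRV.jumpLaw_apply hX δ _ hG.measurableSet]
    exact (hRV.tendstoMO_nuAlpha hX hα).le_liminf _ (hG.inter (isOpen_away δ))
      (areSeparated_zero_iff.2 ⟨δ, hδ, fun z hz => le_of_lt hz.2⟩)

theorem pi_sum_dirac {ι κ : Type*} [Fintype ι] [DecidableEq ι] [Fintype κ] (x : κ → ℝ) :
    (Measure.pi fun _ : ι => ∑ k, Measure.dirac (x k)) =
      ∑ k : ι → κ, Measure.dirac fun i => x (k i) := by
  classical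
  refine Measure.pi_eq fun s hs => ?_
  simp only [Measure.finsetSum_apply, Measure.dirac_apply' _ (MeasurableSet.univ_pi hs),
    Measure.dirac_apply' _ (hs _), Finset.prod_univ_sum, Fintype.piFinset_univ, indicator_apply,
    Pi.one_apply, mem_univ_pi, Fintype.prod_boole]

/-- The sum over all tuples `k` of grid points of the masses of the sections of `B` at `k` under
the product of the restrictions of `μ` to `{z | δ < |z|}`. For `μ` the law of `Z₁ / n` it is the
expected number of `j`-tuples of rescaled jumps beyond `δ` and jump times that lie in `B`. -/
noncomputable def gridSum (μ : Measure ℝ) (δ : ℝ) (n N : ℕ)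
    (B : Set ((Fin j → ℝ) × (Fin j → ℝ))) : ℝ≥0∞ :=
  ∑ k : Fin j → Fin N,
    Measure.pi (fun _ : Fin j => μ.restrict (away δ)) {z | (z, fun i => gridPoint n (k i)) ∈ B}

/-- The joint law of `j` independent rescaled large jumps and their `j` times. -/
noncomputable def jumpTimeLaw (P : Measure Ω) [IsProbabilityMeasure P] (X : Ω → ℝ) (δ M : ℝ)
    (j n : ℕ) : FiniteMeasure ((Fin j → ℝ) × (Fin j → ℝ)) :=
  (FiniteMeasure.pi fun _ => jumpLaw P X δ n).prod (FiniteMeasure.pi fun _ => gridMeasure M n)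

theorem rate_mul_gridSum (P : Measure Ω) [IsProbabilityMeasure P] (X : Ω → ℝ) (δ M : ℝ) (n : ℕ)
    {B : Set ((Fin j → ℝ) × (Fin j → ℝ))} (hB : MeasurableSet B) :
    ENNReal.ofReal (rate P X j n) * gridSum (P.map fun ω => X ω / n) δ n ⌊(n : ℝ) * M⌋₊ B =
      (jumpTimeLaw P X δ M j n : Measure _) B := by
  have hrate : ENNReal.ofReal (rate P X j n) =
      (((P {ω | (n : ℝ) < |X ω|}).toNNReal⁻¹ ^ j * (n : NNReal)⁻¹ ^ j : NNReal) : ℝ≥0∞) := by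
    rw [ENNReal.ofReal, ← Real.toNNReal_coe (r := _ * _), NNReal.coe_mul, NNReal.coe_pow,
      NNReal.coe_pow, ← mul_pow, NNReal.coe_inv, NNReal.coe_inv, NNReal.coe_natCast, ← mul_inv_rev,
      inv_pow]
    rfl
  simp only [jumpTimeLaw, gridMeasure, jumpLaw]
  rw [finiteMeasure_pi_smul, finiteMeasure_pi_smul, finiteMeasure_prod_smul,
    FiniteMeasure.toMeasure_smul, Measure.smul_apply, Finset.prod_const, Finset.prod_const,
    Finset.card_univ, Fintype.card_fin, hrate, ENNReal.smul_def, smul_eq_mul,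
    FiniteMeasure.toMeasure_prod, FiniteMeasure.toMeasure_pi, FiniteMeasure.toMeasure_pi]
  simp only [toMeasure_finiteMeasureOf]
  rw [pi_sum_dirac, Measure.prod_apply_symm hB, lintegral_finsetSum_measure]
  simp only [lintegral_dirac]
  rfl

theorem IsRegVar.tendsto_jumpTimeLaw (hX : Measurable X) (hα : 0 < α) (hRV : IsRegVar P X α p)
    (hδ : 0 < δ) (hM : 0 ≤ M) :
    ∃ L : FiniteMeasure ((Fin j → ℝ) × (Fin j → ℝ)),
      L.toMeasure = ((Measure.pi fun _ : Fin j => nuAlpha α p).prod volume).restrict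
        ((univ.pi fun _ => away δ) ×ˢ univ.pi fun _ => Icc 0 M) ∧
      Tendsto (jumpTimeLaw P X δ M j) atTop (𝓝 L) := by
  have hpi : ∀ {μs : ℕ → FiniteMeasure ℝ} {μ : FiniteMeasure ℝ}, Tendsto μs atTop (𝓝 μ) →
      Tendsto (fun n => FiniteMeasure.pi fun _ : Fin j => μs n) atTop
        (𝓝 (FiniteMeasure.pi fun _ => μ)) := fun h =>
    (continuous_finiteMeasure_pi.tendsto _).comp (tendsto_pi_nhds.2 fun _ => h)
  refine ⟨_, ?_, (continuous_finiteMeasure_prod.tendsto _).comp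
    ((hpi (hRV.tendsto_jumpLaw hX hα hδ)).prodMk_nhds (hpi (tendsto_gridMeasure hM)))⟩
  simp only [FiniteMeasure.toMeasure_prod, FiniteMeasure.toMeasure_pi, toMeasure_finiteMeasureOf]
  rw [← Measure.restrict_pi_pi, ← Measure.restrict_pi_pi, ← volume_pi, Measure.prod_restrict]

theorem IsRegVar.limsup_rate_mul_gridSum_le (hX : Measurable X) (hα : 0 < α)
    (hRV : IsRegVar P X α p) (hδ : 0 < δ) (hM : 0 ≤ M) {C : Set ((Fin j → ℝ) × (Fin j → ℝ))}
    (hC : IsClosed C) :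
    limsup (fun n : ℕ => ENNReal.ofReal (rate P X j n) *
        gridSum (P.map fun ω => X ω / n) δ n ⌊(n : ℝ) * M⌋₊ C) atTop ≤
      (Measure.pi fun _ : Fin j => nuAlpha α p).prod volume
        (C ∩ (univ.pi fun _ => away δ) ×ˢ univ.pi fun _ => Icc 0 M) := by
  obtain ⟨L, hL, hlim⟩ := hRV.tendsto_jumpTimeLaw (j := j) hX hα hδ hM
  simp only [rate_mul_gridSum P X δ M _ hC.measurableSet]
  rw [← Measure.restrict_apply hC.measurableSet, ← hL]
  exact FiniteMeasure.limsup_measure_closed_le_of_tendsto hlim hC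

theorem IsRegVar.le_liminf_rate_mul_gridSum (hX : Measurable X) (hα : 0 < α)
    (hRV : IsRegVar P X α p) (hδ : 0 < δ) (hM : 0 ≤ M) {G : Set ((Fin j → ℝ) × (Fin j → ℝ))}
    (hG : IsOpen G) :
    (Measure.pi fun _ : Fin j => nuAlpha α p).prod volume
        (G ∩ (univ.pi fun _ => away δ) ×ˢ univ.pi fun _ => Icc 0 M) ≤
      liminf (fun n : ℕ => ENNReal.ofReal (rate P X j n) *
        gridSum (P.map fun ω => X ω / n) δ n ⌊(n : ℝ) * M⌋₊ G) atTop := by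
  obtain ⟨L, hL, hlim⟩ := hRV.tendsto_jumpTimeLaw (j := j) hX hα hδ hM
  simp only [rate_mul_gridSum P X δ M _ hG.measurableSet]
  rw [← Measure.restrict_apply hG.measurableSet, ← hL]
  exact le_liminf_measure_open_of_tendsto_finiteMeasure hlim hG

theorem IsIID.pi_restrict_away_apply {Z : ℕ → Ω → ℝ} (hZ : IsIID P Z) {n : ℕ} (hn : 1 ≤ n) (δ : ℝ)
    {k : Fin j → ℕ} (hk : Function.Injective k) {B : Set (Fin j → ℝ)} (hB : MeasurableSet B) :
    Measure.pi (fun _ : Fin j => (P.map fun ω => Z 0 ω / n).restrict (away δ)) B =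
      P {ω | (∀ i, (n : ℝ) * δ < |Z (k i) ω|) ∧ (fun i => Z (k i) ω / n) ∈ B} := by
  have hn' : (0 : ℝ) < n := by exact_mod_cast hn
  have hm : ∀ i, Measurable fun ω => Z i ω / n := fun i => (hZ.measurable i).div_const _
  have hindep : iIndepFun (fun (i : Fin j) ω => Z (k i) ω / n) P :=
    (hZ.indep.precomp hk).comp (fun _ x => x / n) fun _ => measurable_id.div_const _
  have hident : ∀ i, P.map (fun ω => Z (k i) ω / n) = P.map fun ω => Z 0 ω / n := fun i =>
    ((hZ.identDistrib (k i)).comp (measurable_id.div_const (n : ℝ))).map_eq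
  have hlaw : P.map (fun ω (i : Fin j) => Z (k i) ω / n) =
      Measure.pi fun _ : Fin j => P.map fun ω => Z 0 ω / n := by
    rw [(iIndepFun_iff_map_fun_eq_pi_map fun i => (hm (k i)).aemeasurable).1 hindep]
    exact congrArg Measure.pi (funext hident)
  rw [← Measure.restrict_pi_pi, Measure.restrict_apply hB, ← hlaw, Measure.map_apply
    (measurable_pi_lambda _ fun i => hm (k i))
    (hB.inter (MeasurableSet.univ_pi fun _ => measurableSet_away δ))]
  congr 1 with ω
  simp only [mem_preimage, mem_inter_iff, mem_univ_pi, away, mem_ofPred_eq, abs_div, Nat.abs_cast,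
    lt_div_iff₀ hn', mul_comm δ, and_comm]

theorem IsRegVar.tendsto_rate_mul_pow_succ (hX : Measurable X) (hRV : IsRegVar P X α p)
    (hα : 1 < α) (hδ : 0 < δ) (hM : 0 ≤ M) :
    Tendsto (fun n : ℕ => ENNReal.ofReal (rate P X j n) *
      (⌊(n : ℝ) * M⌋₊ * P.map (fun ω => X ω / n) (away δ)) ^ (j + 1)) atTop (𝓝 0) := by
  have h := ENNReal.tendsto_ofReal (((((tendsto_natFloor_mul_div hM).mul
    (hRV.tendsto_tail_ratio hX hδ)).pow (j + 1))).mul (hRV.tendsto_mul_tail hX hα))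
  rw [mul_zero, ENNReal.ofReal_zero] at h
  refine h.congr' ?_
  filter_upwards [eventually_ge_atTop 1] with n hn
  have : (0 : ℝ) < n := by exact_mod_cast hn
  have hT := hRV.measureReal_lt_abs_pos hX n
  rw [map_div_apply_away hX hn, ← ofReal_measureReal, ← ENNReal.ofReal_natCast,
    ← ENNReal.ofReal_mul (by positivity), ← ENNReal.ofReal_pow (by positivity),
    ← ENNReal.ofReal_mul (by unfold rate; positivity), rate]
  congr 1
  rw [div_mul_div_comm, div_pow]
  field_simp
  ring

end JumpLaw

/-! ### The limit measure -/

section LimitMeasure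

variable {M m α p : ℝ} {j : ℕ}

theorem ae_injective : ∀ᵐ u : Fin j → ℝ, Function.Injective u := by
  have hne : ∀ i l : Fin j, i ≠ l → ∀ᵐ u : Fin j → ℝ, u i ≠ u l := fun i l hil => by
    let φ : (Fin j → ℝ) →ₗ[ℝ] ℝ := LinearMap.proj (R := ℝ) (φ := fun _ => ℝ) i -
      LinearMap.proj (R := ℝ) (φ := fun _ => ℝ) l
    have hker : {u : Fin j → ℝ | ¬u i ≠ u l} = LinearMap.ker φ := by
      ext u
      simp [φ, sub_eq_zero]
    rw [ae_iff, hker]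
    refine Measure.addHaar_submodule volume _ fun htop => ?_
    have hmem : Pi.single i (1 : ℝ) ∈ LinearMap.ker φ := htop ▸ Submodule.mem_top
    simp [φ, hil] at hmem
  filter_upwards [ae_all_iff.2 fun i => ae_all_iff.2 fun l => ae_all_iff.2 (hne i l)] with u hu
  exact fun i l hil => by_contra fun h => hu i l h hil

theorem ae_mem_interiorTimes (M : ℝ) :
    ∀ᵐ u : Fin j → ℝ, Monotone u → (∀ i, u i ∈ Icc 0 M) → u ∈ interiorTimes M j := by
  have hne : ∀ x : ℝ, ∀ᵐ u : Fin j → ℝ, ∀ i, u i ≠ x := fun x =>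
    ae_all_iff.2 fun i => Measure.ae_eval_ne (fun _ : Fin j => (volume : Measure ℝ)) i x
  filter_upwards [ae_injective, hne 0, hne M] with u hinj h0 hM hmono hmem
  exact ⟨hmono.strictMono_of_injective hinj, fun i =>
    ⟨(hmem i).1.lt_of_ne' (h0 i), (hmem i).2.lt_of_ne (hM i)⟩⟩

theorem ae_prod_mem_interiorTimes (μ : Measure (Fin j → ℝ)) (M : ℝ) :
    ∀ᵐ q ∂μ.prod volume, Monotone q.2 → (∀ i, q.2 i ∈ Icc 0 M) → q.2 ∈ interiorTimes M j :=
  Measure.quasiMeasurePreserving_snd.ae (ae_mem_interiorTimes M)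

theorem isOpen_setOf_mem_interiorTimes :
    IsOpen {q : (Fin j → ℝ) × (Fin j → ℝ) | q.2 ∈ interiorTimes M j} :=
  isOpen_interiorTimes.preimage continuous_snd

theorem continuousOn_stepDrift (hM : 0 ≤ M) :
    ContinuousOn (stepDrift M m j) {q | q.2 ∈ interiorTimes M j} := fun _ hq =>
  (continuousAt_stepDrift hM hq).continuousWithinAt

theorem aemeasurable_stepDrift (hM : 0 ≤ M) (μ : Measure (Fin j → ℝ)) :
    AEMeasurable (stepDrift M m j) ((μ.prod volume).restrict (jumpDomain M j)) := by
  refine ((continuousOn_stepDrift hM).aemeasurable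
    isOpen_setOf_mem_interiorTimes.measurableSet).mono_measure (Measure.restrict_mono_ae ?_)
  filter_upwards [ae_prod_mem_interiorTimes μ M] with q hq hqd
  exact hq hqd.2.1.monotone hqd.2.2

theorem limitMeasure_apply (hM : 0 ≤ M) {A : Set (SkorohodSpace M)} (hA : MeasurableSet A) :
    limitMeasure M m α p j A = (Measure.pi fun _ : Fin j => nuAlpha α p).prod volume
      (stepDrift M m j ⁻¹' A ∩ jumpDomain M j) := by
  rw [limitMeasure, Measure.map_apply_of_aemeasurable (aemeasurable_stepDrift hM _) hA,
    Measure.restrict_apply' measurableSet_jumpDomain]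

theorem finiteAwayFrom_limitMeasure (hM : 0 ≤ M) (hα : 0 < α) (hp₀ : 0 ≤ p) (hp₁ : p ≤ 1) :
    FiniteAwayFrom (stepLE M m j) (limitMeasure M m α p (j + 1)) := by
  intro A hA hsep
  obtain ⟨r, hr, hrA⟩ := areSeparated_iff_ofReal_le_edist.1 hsep
  have hsub : stepDrift M m (j + 1) ⁻¹' A ∩ jumpDomain M (j + 1) ⊆
      (univ.pi fun _ => away (r / 2)) ×ˢ univ.pi fun _ => Icc 0 M := by
    rintro q ⟨hq, hqd⟩
    exact ⟨fun i _ => (half_lt_self hr).trans_le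
      (le_abs_jump_of_forall_le_edist hqd (hrA _ hq) i), fun i _ => hqd.2.2 i⟩
  rw [limitMeasure_apply hM hA]
  refine (measure_mono hsub).trans_lt ?_
  simp only [Measure.prod_prod, Measure.pi_pi, volume_pi, Real.volume_Icc,
    nuAlpha_away hα hp₀ hp₁ (half_pos hr)]
  exact ENNReal.mul_lt_top (ENNReal.prod_lt_top fun _ _ => ENNReal.ofReal_lt_top)
    (ENNReal.prod_lt_top fun _ _ => ENNReal.ofReal_lt_top)

theorem isOpen_setOf_stepDrift_mem (hM : 0 ≤ M) {V : Set (SkorohodSpace M)} (hV : IsOpen V) :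
    IsOpen {q : (Fin j → ℝ) × (Fin j → ℝ) | q.2 ∈ interiorTimes M j ∧ stepDrift M m j q ∈ V} :=
  (continuousOn_stepDrift hM).isOpen_inter_preimage isOpen_setOf_mem_interiorTimes hV

end LimitMeasure

/-! ### Approximation of the walk by its large jumps -/

section LargeJumps

variable {Ω : Type*} {Z : ℕ → Ω → ℝ} {M m δ ε : ℝ} {n N j : ℕ} {ω : Ω}

/-- The rescaled jumps of `z` at the indices `k`, and the times at which they occur. -/
noncomputable def jumpData (n : ℕ) (z : ℕ → ℝ) (k : Fin j → Fin N) :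
    (Fin j → ℝ) × (Fin j → ℝ) :=
  (fun a => z (k a) / n, fun a => gridPoint n (k a))

/-- The event that the jumps with indices `k` are large, and lie in `B` with their times. -/
def largeJumps (Z : ℕ → Ω → ℝ) (δ : ℝ) (n : ℕ) (k : Fin j → Fin N)
    (B : Set ((Fin j → ℝ) × (Fin j → ℝ))) : Set Ω :=
  {ω | (∀ a, n * δ < |Z (k a) ω|) ∧ jumpData n (fun l => Z l ω) k ∈ B}

/-- The event `largeJumps Z δ n k B` when, in addition, no other jump before time `N / n` is
large. -/
def exactJumps (Z : ℕ → Ω → ℝ) (δ : ℝ) (n : ℕ) (k : Fin j → Fin N)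
    (B : Set ((Fin j → ℝ) × (Fin j → ℝ))) : Set Ω :=
  {ω ∈ largeJumps Z δ n k B | ∀ l : Fin N, n * δ < |Z l ω| → l ∈ range k}

theorem mem_range_iff_of_mem_exactJumps {k : Fin j → Fin N}
    {B : Set ((Fin j → ℝ) × (Fin j → ℝ))} (hω : ω ∈ exactJumps Z δ n k B) (l : Fin N) :
    l ∈ range k ↔ n * δ < |Z l ω| :=
  ⟨by rintro ⟨a, rfl⟩; exact hω.1.1 a, hω.2 l⟩

theorem disjoint_exactJumps {k k' : Fin j → Fin N} (hk : StrictMono k) (hk' : StrictMono k')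
    (hne : k ≠ k') (B : Set ((Fin j → ℝ) × (Fin j → ℝ))) :
    Disjoint (exactJumps Z δ n k B) (exactJumps Z δ n k' B) := by
  refine Set.disjoint_left.2 fun ω hω hω' => hne ((hk.range_inj hk').1 ?_)
  ext l
  rw [mem_range_iff_of_mem_exactJumps hω, mem_range_iff_of_mem_exactJumps hω']

theorem largeJumps_subset (k : Fin j → Fin N) (B : Set ((Fin j → ℝ) × (Fin j → ℝ))) :
    largeJumps Z δ n k B ⊆ exactJumps Z δ n k B ∪
      ⋃ (l : Fin N) (_ : l ∉ range k),
        largeJumps Z δ n (Fin.cons l k : Fin (j + 1) → Fin N) univ := by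
  intro ω hω
  by_cases h : ∀ l : Fin N, n * δ < |Z l ω| → l ∈ range k
  · exact Or.inl ⟨hω, h⟩
  · push Not at h
    obtain ⟨l, hl, hlk⟩ := h
    exact Or.inr (mem_iUnion₂.2 ⟨l, hlk, Fin.cases hl hω.1, mem_univ _⟩)

theorem jumpData_mem_jumpDomain (hn : 1 ≤ n) (hM : 0 ≤ M) (hδ : 0 ≤ δ)
    {k : Fin j → Fin ⌊(n : ℝ) * M⌋₊} (hk : StrictMono k)
    {B : Set ((Fin j → ℝ) × (Fin j → ℝ))} (hω : ω ∈ largeJumps Z δ n k B) :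
    jumpData n (fun l => Z l ω) k ∈ jumpDomain M j := by
  have hn' : (0 : ℝ) < n := by exact_mod_cast hn
  refine ⟨fun a => ?_, (gridPoint_strictMono hn).comp hk, fun a => gridPoint_mem hn hM _⟩
  exact div_ne_zero (abs_pos.1 ((by positivity : 0 ≤ n * δ).trans_lt (hω.1 a))) hn'.ne'

theorem sum_sub_sum_trunc {z : ℕ → ℝ} {b : ℝ} {k : Fin j → Fin N} (hk : Function.Injective k)
    (hbig : ∀ l : Fin N, b < |z l| → l ∈ range k) (hk_big : ∀ a, b < |z (k a)|) {K : ℕ}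
    (hK : K ≤ N) :
    ∑ l ∈ Finset.range K, z l - ∑ l ∈ Finset.range K, trunc b (z l) =
      ∑ a, if (k a : ℕ) < K then z (k a) else 0 := by
  have hrange : Finset.range K = (Finset.range N).filter (· < K) := by
    ext l
    simp only [Finset.mem_range, Finset.mem_filter]
    lia
  rw [← Finset.sum_sub_distrib, hrange, Finset.sum_filter, Finset.sum_range]
  refine (Fintype.sum_of_injective k hk _ _ (fun l hl => ?_) fun a => ?_).symm
  · have hsmall : |z l| ≤ b := not_lt.1 (mt (hbig l) hl)
    simp [trunc, hsmall]
  · simp [trunc, not_le.2 (hk_big a)]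

theorem stepDrift_jumpData (hn : 1 ≤ n) (z : ℕ → ℝ) (k : Fin j → Fin N) (t : Icc 0 M) :
    (stepDrift M m j (jumpData n z k)).toFun t =
      (∑ a, if (k a : ℕ) < ⌊(n : ℝ) * t⌋₊ then z (k a) else 0) / n + m * t := by
  simp only [stepDrift, jumpData, gridPoint_le_iff hn, Finset.sum_div, ite_div, zero_div]

theorem edist_walkPath_stepDrift_le (hn : 1 ≤ n) (hε : 0 ≤ ε) (hm : |m| ≤ n * ε)
    {k : Fin j → Fin ⌊(n : ℝ) * M⌋₊} (hk : Function.Injective k)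
    {B : Set ((Fin j → ℝ) × (Fin j → ℝ))} (hω : ω ∈ exactJumps Z δ n k B)
    (hdev : ω ∉ truncDeviation Z M m δ ε n) :
    edist (walkPath M n fun l => Z l ω) (stepDrift M m j (jumpData n (fun l => Z l ω) k)) ≤
      ENNReal.ofReal (2 * ε) := by
  have hn' : (0 : ℝ) < n := by exact_mod_cast hn
  refine edist_skorohod_le (by positivity) fun t => ?_
  let K := ⌊(n : ℝ) * t⌋₊
  have hdiff : (walkPath M n fun l => Z l ω).toFun t -
      (stepDrift M m j (jumpData n (fun l => Z l ω) k)).toFun t =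
        ((∑ l ∈ Finset.range K, trunc (n * δ) (Z l ω) - K * m) + m * (K - n * t)) / n := by
    rw [stepDrift_jumpData hn, ← sum_sub_sum_trunc (z := fun l => Z l ω) hk hω.2 hω.1.1
      (floor_mul_le t), walkPath]
    field_simp
    ring
  have hsum : |∑ l ∈ Finset.range K, trunc (n * δ) (Z l ω) - K * m| < n * ε :=
    not_le.1 fun h => hdev ⟨K, floor_mul_le t, h⟩
  have hdrift : |m * (K - n * t)| ≤ |m| := by
    rw [abs_mul]
    refine mul_le_of_le_one_right (abs_nonneg _) (abs_le.2 ⟨?_, ?_⟩)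
    · linarith [Nat.lt_floor_add_one ((n : ℝ) * t)]
    · linarith [Nat.floor_le (mul_nonneg hn'.le t.2.1)]
  rw [hdiff, abs_div, Nat.abs_cast, div_le_iff₀ hn']
  linarith [abs_add_le (∑ l ∈ Finset.range K, trunc (n * δ) (Z l ω) - K * m) (m * (K - n * t))]

theorem exists_exactJumps_or_exists_largeJumps (Z : ℕ → Ω → ℝ) (δ : ℝ) (n N j : ℕ) (ω : Ω) :
    (∃ i ≤ j, ∃ k : Fin i → Fin N, StrictMono k ∧ ω ∈ exactJumps Z δ n k univ) ∨
      ∃ k : Fin (j + 1) → Fin N, StrictMono k ∧ ω ∈ largeJumps Z δ n k univ := by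
  classical
  let S : Finset (Fin N) := Finset.univ.filter fun l => n * δ < |Z l ω|
  have hS : ∀ l, l ∈ S ↔ n * δ < |Z l ω| := fun l => by simp [S]
  rcases le_or_gt S.card j with hle | hlt
  · refine Or.inl ⟨S.card, hle, S.orderEmbOfFin rfl, (S.orderEmbOfFin rfl).strictMono,
      ⟨fun a => (hS _).1 (S.orderEmbOfFin_mem rfl a), mem_univ _⟩, fun l hl => ?_⟩
    rw [S.range_orderEmbOfFin rfl]
    exact (hS l).2 hl
  · exact Or.inr ⟨S.orderEmbOfCardLe hlt, (S.orderEmbOfCardLe hlt).strictMono,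
      fun a => (hS _).1 (S.orderEmbOfCardLe_mem hlt a), mem_univ _⟩

end LargeJumps

section Estimates

variable {Ω : Type*} {Z : ℕ → Ω → ℝ} {M m δ ε : ℝ} {n N j : ℕ}

theorem setOf_walkPath_mem_subset (hn : 1 ≤ n) (hM : 0 ≤ M) (hδ : 0 ≤ δ) (hε : 0 ≤ ε)
    (hm : |m| ≤ n * ε) {r : ℝ} (hεr : 2 * ε < r) {F : Set (SkorohodSpace M)}
    (hF : ∀ x ∈ F, ∀ y ∈ stepLE M m j, ENNReal.ofReal r ≤ edist x y)
    {C : Set ((Fin (j + 1) → ℝ) × (Fin (j + 1) → ℝ))}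
    (hFC : ∀ q ∈ jumpDomain M (j + 1),
      stepDrift M m (j + 1) q ∈ Metric.cthickening (2 * ε) F → q ∈ C) :
    {ω | walkPath M n (fun l => Z l ω) ∈ F} ⊆
      (⋃ (k : Fin (j + 1) → Fin ⌊(n : ℝ) * M⌋₊) (_ : StrictMono k), largeJumps Z δ n k C) ∪
        (truncDeviation Z M m δ ε n ∪
          ⋃ (k : Fin (j + 2) → Fin ⌊(n : ℝ) * M⌋₊) (_ : StrictMono k),
            largeJumps Z δ n k univ) := by
  intro ω hωF
  by_cases hdev : ω ∈ truncDeviation Z M m δ ε n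
  · exact Or.inr (Or.inl hdev)
  obtain ⟨i, hi, k, hk, hω⟩ | ⟨k, hk, hω⟩ :=
    exists_exactJumps_or_exists_largeJumps Z δ n ⌊(n : ℝ) * M⌋₊ (j + 1) ω
  · have hclose := edist_walkPath_stepDrift_le hn hε hm hk.injective hω hdev
    have hdom := jumpData_mem_jumpDomain hn hM hδ hk hω.1
    rcases hi.lt_or_eq with hlt | rfl
    · have hr := (hF _ hωF _ (stepEq_subset_stepLE (Nat.lt_succ_iff.1 hlt)
        (mem_image_of_mem _ hdom))).trans hclose
      exact absurd ((ENNReal.ofReal_le_ofReal_iff (by positivity)).1 hr) (not_le.2 hεr)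
    · rw [edist_comm] at hclose
      exact Or.inl (mem_iUnion₂.2 ⟨k, hk, hω.1.1,
        hFC _ hdom (Metric.mem_cthickening_of_edist_le _ _ _ _ hωF hclose)⟩)
  · exact Or.inr (Or.inr (mem_iUnion₂.2 ⟨k, hk, hω⟩))

theorem iUnion_exactJumps_subset (hn : 1 ≤ n) (hε : 0 ≤ ε) (hm : |m| ≤ n * ε)
    {G : Set (SkorohodSpace M)} {O : Set ((Fin j → ℝ) × (Fin j → ℝ))}
    (hO : ∀ q ∈ O, stepDrift M m j q ∉ Metric.cthickening (2 * ε) Gᶜ) :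
    (⋃ (k : Fin j → Fin ⌊(n : ℝ) * M⌋₊) (_ : StrictMono k), exactJumps Z δ n k O) ⊆
      {ω | walkPath M n (fun l => Z l ω) ∈ G} ∪ truncDeviation Z M m δ ε n := by
  refine iUnion₂_subset fun k hk ω hω => or_iff_not_imp_right.2 fun hdev => ?_
  have hclose := edist_walkPath_stepDrift_le hn hε hm hk.injective hω hdev
  rw [edist_comm] at hclose
  by_contra hG
  exact hO _ hω.1.2 (Metric.mem_cthickening_of_edist_le _ _ _ _ hG hclose)

variable [MeasurableSpace Ω]

theorem measurableSet_largeJumps (hZ : ∀ i, Measurable (Z i)) (k : Fin j → Fin N)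
    {B : Set ((Fin j → ℝ) × (Fin j → ℝ))} (hB : MeasurableSet B) :
    MeasurableSet (largeJumps Z δ n k B) := by
  have hdata : Measurable fun ω => jumpData n (fun l => Z l ω) k :=
    (measurable_pi_lambda _ fun a => (hZ _).div_const _).prodMk measurable_const
  rw [largeJumps, ofPred_and, ofPred_forall]
  exact (MeasurableSet.iInter fun a => measurableSet_lt measurable_const (hZ _).abs).inter
    (hdata hB)

theorem measurableSet_exactJumps (hZ : ∀ i, Measurable (Z i)) (k : Fin j → Fin N)
    {B : Set ((Fin j → ℝ) × (Fin j → ℝ))} (hB : MeasurableSet B) :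
    MeasurableSet (exactJumps Z δ n k B) := by
  rw [exactJumps, ofPred_and, ofPred_forall]
  exact (measurableSet_largeJumps hZ k hB).inter (MeasurableSet.iInter fun _ =>
    (measurableSet_lt measurable_const (hZ _).abs).imp (MeasurableSet.const _))

theorem gridSum_univ (μ : Measure ℝ) [SigmaFinite μ] (δ : ℝ) (n N j : ℕ) :
    gridSum μ δ n N (univ : Set ((Fin j → ℝ) × (Fin j → ℝ))) = (N * μ (away δ)) ^ j := by
  simp [gridSum, ofPred_true, Measure.pi_univ, mul_pow]

variable {P : Measure Ω} [IsProbabilityMeasure P]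

theorem IsIID.measure_largeJumps (hZ : IsIID P Z) (hn : 1 ≤ n) (δ : ℝ) {k : Fin j → Fin N}
    (hk : Function.Injective k) {B : Set ((Fin j → ℝ) × (Fin j → ℝ))} (hB : MeasurableSet B) :
    P (largeJumps Z δ n k B) =
      Measure.pi (fun _ : Fin j => (P.map fun ω => Z 0 ω / n).restrict (away δ))
        {z | (z, fun i => gridPoint n (k i)) ∈ B} :=
  (hZ.pi_restrict_away_apply hn δ (Fin.val_injective.comp hk) (measurable_prodMk_right hB)).symm

theorem IsIID.measure_iUnion_largeJumps_le (hZ : IsIID P Z) (hn : 1 ≤ n) (δ : ℝ) (N : ℕ)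
    {B : Set ((Fin j → ℝ) × (Fin j → ℝ))} (hB : MeasurableSet B) :
    P (⋃ (k : Fin j → Fin N) (_ : StrictMono k), largeJumps Z δ n k B) ≤
      gridSum (P.map fun ω => Z 0 ω / n) δ n N B := by
  refine (measure_iUnion_fintype_le _ _).trans (Finset.sum_le_sum fun k _ => ?_)
  by_cases hk : StrictMono k
  · simp only [hk, iUnion_true, hZ.measure_largeJumps hn δ hk.injective hB, le_refl]
  · simp [hk]

theorem IsIID.measure_walkPath_le (hZ : IsIID P Z) (hn : 1 ≤ n) (hM : 0 ≤ M) (hδ : 0 ≤ δ)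
    (hε : 0 ≤ ε) (hm : |m| ≤ n * ε) {r : ℝ} (hεr : 2 * ε < r) {F : Set (SkorohodSpace M)}
    (hF : ∀ x ∈ F, ∀ y ∈ stepLE M m j, ENNReal.ofReal r ≤ edist x y)
    {C : Set ((Fin (j + 1) → ℝ) × (Fin (j + 1) → ℝ))} (hC : MeasurableSet C)
    (hFC : ∀ q ∈ jumpDomain M (j + 1),
      stepDrift M m (j + 1) q ∈ Metric.cthickening (2 * ε) F → q ∈ C) :
    P {ω | walkPath M n (fun l => Z l ω) ∈ F} ≤
      gridSum (P.map fun ω => Z 0 ω / n) δ n ⌊(n : ℝ) * M⌋₊ C +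
        (P (truncDeviation Z M m δ ε n) +
          (⌊(n : ℝ) * M⌋₊ * P.map (fun ω => Z 0 ω / n) (away δ)) ^ (j + 2)) := by
  refine (measure_mono (setOf_walkPath_mem_subset hn hM hδ hε hm hεr hF hFC)).trans
    ((measure_union_le _ _).trans ?_)
  gcongr
  · exact hZ.measure_iUnion_largeJumps_le hn δ _ hC
  · refine (measure_union_le _ _).trans ?_
    gcongr
    rw [← gridSum_univ _ δ n _ (j + 2)]
    exact hZ.measure_iUnion_largeJumps_le hn δ _ MeasurableSet.univ

theorem IsIID.measure_largeJumps_le (hZ : IsIID P Z) (hn : 1 ≤ n) (δ : ℝ) {k : Fin j → Fin N}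
    (hk : Function.Injective k) (B : Set ((Fin j → ℝ) × (Fin j → ℝ))) :
    P (largeJumps Z δ n k B) ≤ P (exactJumps Z δ n k B) +
      N * P.map (fun ω => Z 0 ω / n) (away δ) ^ (j + 1) := by
  refine (measure_mono (largeJumps_subset k B)).trans ((measure_union_le _ _).trans ?_)
  gcongr
  refine (measure_iUnion_fintype_le _ _).trans ((Finset.sum_le_card_nsmul _ _
    (P.map (fun ω => Z 0 ω / n) (away δ) ^ (j + 1)) fun l _ => ?_).trans_eq (by simp))
  by_cases hl : l ∈ range k
  · simp [hl]
  · simp only [hl, not_false_eq_true, iUnion_true]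
    rw [hZ.measure_largeJumps hn δ (Fin.cons_injective_iff.2 ⟨hl, hk⟩) MeasurableSet.univ]
    simp [ofPred_true, Measure.pi_univ]

theorem IsIID.gridSum_le (hZ : IsIID P Z) (hn : 1 ≤ n) (δ : ℝ) (N : ℕ)
    {O : Set ((Fin j → ℝ) × (Fin j → ℝ))} (hO : MeasurableSet O)
    (hmono : ∀ q ∈ O, StrictMono q.2) :
    gridSum (P.map fun ω => Z 0 ω / n) δ n N O ≤
      P (⋃ (k : Fin j → Fin N) (_ : StrictMono k), exactJumps Z δ n k O) +
        (N * P.map (fun ω => Z 0 ω / n) (away δ)) ^ (j + 1) := by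
  set t := P.map (fun ω => Z 0 ω / n) (away δ)
  have hterm : ∀ k : Fin j → Fin N,
      Measure.pi (fun _ : Fin j => (P.map fun ω => Z 0 ω / n).restrict (away δ))
        {z | (z, fun i => gridPoint n (k i)) ∈ O} ≤
      P (⋃ _ : StrictMono k, exactJumps Z δ n k O) + N * t ^ (j + 1) := fun k => by
    by_cases hk : StrictMono k
    · simp only [hk, iUnion_true]
      rw [← hZ.measure_largeJumps hn δ hk.injective hO]
      exact hZ.measure_largeJumps_le hn δ hk.injective O
    · have hempty : {z : Fin j → ℝ | (z, fun i => gridPoint n (k i)) ∈ O} = ∅ :=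
        eq_empty_of_forall_notMem fun z hz => hk fun a b hab =>
          (gridPoint_strictMono hn).lt_iff_lt.1 (hmono _ hz hab)
      rw [hempty, measure_empty]
      exact zero_le
  rw [measure_iUnion (fun k k' hne => ?_) fun k => MeasurableSet.iUnion fun _ =>
    measurableSet_exactJumps hZ.measurable k hO, tsum_fintype]
  · refine (Finset.sum_le_sum fun k _ => hterm k).trans_eq ?_
    simp only [Finset.sum_add_distrib, Finset.sum_const, Finset.card_univ, Fintype.card_fun,
      Fintype.card_fin, nsmul_eq_mul, Nat.cast_pow]
    ring
  · simp only [Function.onFun, disjoint_iUnion_left, disjoint_iUnion_right]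
    exact fun hk hk' => disjoint_exactJumps hk' hk hne O

theorem IsIID.gridSum_le_measure_walkPath (hZ : IsIID P Z) (hn : 1 ≤ n) (hε : 0 ≤ ε)
    (hm : |m| ≤ n * ε) {G : Set (SkorohodSpace M)} {O : Set ((Fin j → ℝ) × (Fin j → ℝ))}
    (hO : MeasurableSet O) (hmono : ∀ q ∈ O, StrictMono q.2)
    (hOG : ∀ q ∈ O, stepDrift M m j q ∉ Metric.cthickening (2 * ε) Gᶜ) :
    gridSum (P.map fun ω => Z 0 ω / n) δ n ⌊(n : ℝ) * M⌋₊ O ≤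
      P {ω | walkPath M n (fun l => Z l ω) ∈ G} +
        (P (truncDeviation Z M m δ ε n) +
          (⌊(n : ℝ) * M⌋₊ * P.map (fun ω => Z 0 ω / n) (away δ)) ^ (j + 1)) := by
  rw [← add_assoc]
  refine (hZ.gridSum_le hn δ _ hO hmono).trans ?_
  gcongr
  exact (measure_mono (iUnion_exactJumps_subset hn hε hm hOG)).trans (measure_union_le _ _)

end Estimates

/-! ### Convergence -/

section Criterion

variable {S : Type*} [PseudoEMetricSpace S]

theorem ofReal_sub_le_edist_of_mem_cthickening {F C : Set S} {r s : ℝ} (hs : 0 ≤ s)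
    (hF : ∀ x ∈ F, ∀ y ∈ C, ENNReal.ofReal r ≤ edist x y) {x y : S}
    (hx : x ∈ Metric.cthickening s F) (hy : y ∈ C) : ENNReal.ofReal (r - s) ≤ edist x y := by
  rw [ENNReal.ofReal_sub _ hs, tsub_le_iff_left]
  calc ENNReal.ofReal r ≤ Metric.infEDist y F :=
        Metric.le_infEDist.2 fun z hz => edist_comm z y ▸ hF z hz y hy
    _ ≤ Metric.infEDist x F + edist y x := Metric.infEDist_le_infEDist_add_edist
    _ ≤ ENNReal.ofReal s + edist x y := add_le_add hx (edist_comm y x).le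

theorem areSeparated_cthickening {F C : Set S} {r s : ℝ} (hs : 0 ≤ s) (hsr : s < r)
    (hF : ∀ x ∈ F, ∀ y ∈ C, ENNReal.ofReal r ≤ edist x y) :
    Metric.AreSeparated (Metric.cthickening s F) C :=
  areSeparated_iff_ofReal_le_edist.2 ⟨r - s, sub_pos.2 hsr, fun _ hx _ hy =>
    ofReal_sub_le_edist_of_mem_cthickening hs hF hx hy⟩

variable [MeasurableSpace S]

theorem measure_eq_iSup_compl_cthickening (μ : Measure S) {G : Set S} (hG : IsOpen G) :
    μ G = ⨆ s : Ioi (0 : ℝ), μ (Metric.cthickening s Gᶜ)ᶜ := by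
  rw [← Antitone.measure_iUnion]
  · rw [← compl_iInter, iInter_coe_set]
    simp only [mem_Ioi]
    rw [← Metric.closure_eq_iInter_cthickening, hG.isClosed_compl.closure_eq, compl_compl]
  · exact fun s t hst => compl_subset_compl.2 (Metric.cthickening_mono hst _)

theorem tendstoMO_of_cthickening [OpensMeasurableSpace S] {C : Set S} {μ : ℕ → Measure S}
    {μ₀ : Measure S} (hC : IsClosed C) (hfin : ∀ n, FiniteAwayFrom C (μ n))
    (hfin₀ : FiniteAwayFrom C μ₀)
    (hF : ∀ F, IsClosed F → ∀ r s, (∀ x ∈ F, ∀ y ∈ C, ENNReal.ofReal r ≤ edist x y) → 0 < s →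
      s < r → limsup (fun n => μ n F) atTop ≤ μ₀ (Metric.cthickening s F))
    (hG : ∀ G, IsOpen G → Metric.AreSeparated G C → ∀ s > 0,
      μ₀ (Metric.cthickening s Gᶜ)ᶜ ≤ liminf (fun n => μ n G) atTop) :
    TendstoMO C μ μ₀ where
  isClosed := hC
  finite_seq := hfin
  finite_lim := hfin₀
  limsup_le F hFc hsep := by
    obtain ⟨r, hr, hFr⟩ := areSeparated_iff_ofReal_le_edist.1 hsep
    have hlim : Tendsto (fun s => μ₀ (Metric.cthickening s F)) (𝓝[>] 0) (𝓝 (μ₀ F)) :=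
      (tendsto_measure_cthickening_of_isClosed ⟨r / 2, half_pos hr,
        (hfin₀ _ Metric.isClosed_cthickening.measurableSet
          (areSeparated_cthickening (half_pos hr).le (half_lt_self hr) hFr)).ne⟩ hFc).mono_left
        nhdsWithin_le_nhds
    refine ge_of_tendsto hlim ?_
    filter_upwards [Ioo_mem_nhdsGT hr] with s hs
    exact hF F hFc r s hFr hs.1 hs.2
  le_liminf G hGo hsep := by
    rw [measure_eq_iSup_compl_cthickening μ₀ hGo]
    exact iSup_le fun s => hG G hGo hsep s s.2

end Criterion

theorem eventually_abs_le_natCast_mul (m : ℝ) {ε : ℝ} (hε : 0 < ε) :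
    ∀ᶠ n : ℕ in atTop, |m| ≤ n * ε :=
  (tendsto_natCast_atTop_atTop.atTop_mul_const hε).eventually_ge_atTop |m|

section Walk

variable {Ω : Type*} [MeasurableSpace Ω] {P : Measure Ω} [IsProbabilityMeasure P]
  {Z : ℕ → Ω → ℝ} {α p M m : ℝ} {j : ℕ}

theorem IsIID.exists_tendsto_negligible (hZ : IsIID P Z) (hRV : IsRegVar P (Z 0) α p)
    (hα : 1 < α) (hm : m = ∫ ω, Z 0 ω ∂P) (hM : 0 < M) {ε r : ℝ} (hε : 0 < ε) (hr : 0 < r) :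
    ∃ δ, 0 < δ ∧ δ < r ∧ Tendsto (fun n : ℕ => ENNReal.ofReal (rate P (Z 0) j n) *
      (P (truncDeviation Z M m δ ε n) +
        (⌊(n : ℝ) * M⌋₊ * P.map (fun ω => Z 0 ω / n) (away δ)) ^ (j + 1))) atTop (𝓝 0) := by
  obtain ⟨δ₀, hδ₀, h⟩ := hZ.exists_tendsto_rate_mul_truncDeviation hRV hα hm hM hε j
  obtain ⟨δ, hδ, hδ'⟩ := exists_between (lt_min hδ₀ hr)
  refine ⟨δ, hδ, hδ'.trans_le (min_le_right _ _), ?_⟩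
  simpa only [mul_add, add_zero] using (h δ hδ (hδ'.trans_le (min_le_left _ _))).add
    (hRV.tendsto_rate_mul_pow_succ (hZ.measurable 0) hα hδ hM.le)

theorem isClosed_setOf_monotone : IsClosed {q : (Fin j → ℝ) × (Fin j → ℝ) | Monotone q.2} :=
  isClosed_monotone.preimage continuous_snd

theorem IsIID.limsup_le_cthickening (hZ : IsIID P Z) (hRV : IsRegVar P (Z 0) α p) (hα : 1 < α)
    (hm : m = ∫ ω, Z 0 ω ∂P) (hM : 0 < M) {F : Set (SkorohodSpace M)} {r s : ℝ}
    (hF : ∀ x ∈ F, ∀ y ∈ stepLE M m j, ENNReal.ofReal r ≤ edist x y) (hs : 0 < s) (hsr : s < r) :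
    limsup (fun n : ℕ => ENNReal.ofReal (rate P (Z 0) (j + 1) n) *
      P {ω | walkPath M n (fun k => Z k ω) ∈ F}) atTop ≤
      limitMeasure M m α p (j + 1) (Metric.cthickening s F) := by
  have hε := half_pos hs
  obtain ⟨δ, hδ, -, hneg⟩ :=
    hZ.exists_tendsto_negligible (j := j + 1) hRV hα hm hM hε one_pos
  set F' := Metric.cthickening s F
  have hF' : IsClosed F' := Metric.isClosed_cthickening
  -- `stepDrift` is discontinuous at jump times that coincide or lie at an endpoint; a closed set
  -- of data has to contain all of these.
  let C : Set ((Fin (j + 1) → ℝ) × (Fin (j + 1) → ℝ)) := {q | Monotone q.2} ∩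
    {q | q.2 ∈ interiorTimes M (j + 1) ∧ stepDrift M m (j + 1) q ∈ F'ᶜ}ᶜ
  have hC : IsClosed C := isClosed_setOf_monotone.inter
    (isOpen_setOf_stepDrift_mem hM.le hF'.isOpen_compl).isClosed_compl
  have hbound : ∀ᶠ n : ℕ in atTop, ENNReal.ofReal (rate P (Z 0) (j + 1) n) *
      P {ω | walkPath M n (fun k => Z k ω) ∈ F} ≤
      ((fun n : ℕ => ENNReal.ofReal (rate P (Z 0) (j + 1) n) *
        gridSum (P.map fun ω => Z 0 ω / n) δ n ⌊(n : ℝ) * M⌋₊ C) + fun n : ℕ =>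
      ENNReal.ofReal (rate P (Z 0) (j + 1) n) * (P (truncDeviation Z M m δ (s / 2) n) +
        (⌊(n : ℝ) * M⌋₊ * P.map (fun ω => Z 0 ω / n) (away δ)) ^ (j + 2))) n := by
    filter_upwards [eventually_ge_atTop 1, eventually_abs_le_natCast_mul m hε] with n hn hmn
    rw [Pi.add_apply, ← mul_add]
    gcongr
    refine hZ.measure_walkPath_le hn hM.le hδ.le hε.le hmn (r := r) (by linarith) hF
      hC.measurableSet fun q hq hqF => ⟨hq.2.1.monotone, fun h => h.2 ?_⟩
    rwa [mul_div_cancel₀ s two_ne_zero] at hqF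
  refine (limsup_le_limsup hbound).trans ?_
  rw [ENNReal.limsup_add_of_right_tendsto_zero hneg]
  refine (hRV.limsup_rate_mul_gridSum_le (hZ.measurable 0) (by linarith) hδ hM.le hC).trans ?_
  rw [limitMeasure_apply hM.le hF'.measurableSet]
  refine measure_mono_ae ?_
  filter_upwards [ae_prod_mem_interiorTimes (Measure.pi fun _ => nuAlpha α p) M] with q hq
  rintro ⟨⟨hmono, hqF⟩, hlarge, hmem⟩
  have hint := hq hmono fun i => hmem i (mem_univ i)
  exact ⟨by_contra fun h => hqF ⟨hint, h⟩,
    fun i => abs_pos.1 (hδ.trans (hlarge i (mem_univ i))), interiorTimes_subset_jumpTimes hint⟩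

theorem IsIID.le_liminf_compl_cthickening (hZ : IsIID P Z) (hRV : IsRegVar P (Z 0) α p)
    (hα : 1 < α) (hm : m = ∫ ω, Z 0 ω ∂P) (hM : 0 < M) {G : Set (SkorohodSpace M)} {s : ℝ}
    (hG : Metric.AreSeparated G (stepLE M m j)) (hs : 0 < s) :
    limitMeasure M m α p (j + 1) (Metric.cthickening s Gᶜ)ᶜ ≤
      liminf (fun n : ℕ => ENNReal.ofReal (rate P (Z 0) (j + 1) n) *
        P {ω | walkPath M n (fun k => Z k ω) ∈ G}) atTop := by
  have hε := half_pos hs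
  obtain ⟨r, hr, hGr⟩ := areSeparated_iff_ofReal_le_edist.1 hG
  obtain ⟨δ, hδ, hδr, hneg⟩ :=
    hZ.exists_tendsto_negligible (j := j + 1) hRV hα hm hM hε hr
  set G' := (Metric.cthickening s Gᶜ)ᶜ
  have hG' : IsOpen G' := Metric.isClosed_cthickening.isOpen_compl
  have hG'G : G' ⊆ G := compl_subset_comm.1 (Metric.self_subset_cthickening _)
  let O : Set ((Fin (j + 1) → ℝ) × (Fin (j + 1) → ℝ)) :=
    {q | q.2 ∈ interiorTimes M (j + 1) ∧ stepDrift M m (j + 1) q ∈ G'}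
  have hO : IsOpen O := isOpen_setOf_stepDrift_mem hM.le hG'
  have hbound : ∀ᶠ n : ℕ in atTop, ENNReal.ofReal (rate P (Z 0) (j + 1) n) *
      gridSum (P.map fun ω => Z 0 ω / n) δ n ⌊(n : ℝ) * M⌋₊ O ≤
      ((fun n : ℕ => ENNReal.ofReal (rate P (Z 0) (j + 1) n) *
        P {ω | walkPath M n (fun k => Z k ω) ∈ G}) + fun n : ℕ =>
      ENNReal.ofReal (rate P (Z 0) (j + 1) n) * (P (truncDeviation Z M m δ (s / 2) n) +
        (⌊(n : ℝ) * M⌋₊ * P.map (fun ω => Z 0 ω / n) (away δ)) ^ (j + 2))) n := by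
    filter_upwards [eventually_ge_atTop 1, eventually_abs_le_natCast_mul m hε] with n hn hmn
    rw [Pi.add_apply, ← mul_add]
    gcongr
    refine hZ.gridSum_le_measure_walkPath hn hε.le hmn hO.measurableSet
      (fun q hq => hq.1.1) fun q hq => ?_
    rw [mul_div_cancel₀ s two_ne_zero]
    exact hq.2
  rw [← ENNReal.liminf_add_of_right_tendsto_zero hneg]
  refine le_trans ?_ (liminf_le_liminf hbound)
  refine le_trans ?_ (hRV.le_liminf_rate_mul_gridSum (hZ.measurable 0) (by linarith) hδ hM.le hO)
  rw [limitMeasure_apply hM.le hG'.measurableSet]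
  refine measure_mono_ae ?_
  filter_upwards [ae_prod_mem_interiorTimes (Measure.pi fun _ => nuAlpha α p) M] with q hq
  rintro ⟨hqG, hqd⟩
  exact ⟨⟨hq hqd.2.1.monotone hqd.2.2, hqG⟩, fun i _ =>
    hδr.trans_le (le_abs_jump_of_forall_le_edist hqd (hGr _ (hG'G hqG)) i), fun i _ => hqd.2.2 i⟩

theorem IsIID.tendstoMO (hZ : IsIID P Z) (hRV : IsRegVar P (Z 0) α p) (hα : 1 < α)
    (hm : m = ∫ ω, Z 0 ω ∂P) (hM : 0 < M) :
    TendstoMO (stepLE M m j)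
      (fun n => ENNReal.ofReal (rate P (Z 0) (j + 1) n) •
        P.map (fun ω => walkPath M n (fun k => Z k ω)))
      (limitMeasure M m α p (j + 1)) := by
  have hwalk : ∀ n, Measurable fun ω => walkPath M n fun k => Z k ω := fun n =>
    continuous_walkPath.measurable.comp (measurable_pi_lambda _ hZ.measurable)
  have happly : ∀ (n : ℕ) {A : Set (SkorohodSpace M)}, MeasurableSet A →
      (ENNReal.ofReal (rate P (Z 0) (j + 1) n) •
        P.map (fun ω => walkPath M n (fun k => Z k ω))) A =
      ENNReal.ofReal (rate P (Z 0) (j + 1) n) *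
        P {ω | walkPath M n (fun k => Z k ω) ∈ A} := fun n A hA => by
    rw [Measure.smul_apply, smul_eq_mul, Measure.map_apply (hwalk n) hA]
    rfl
  refine tendstoMO_of_cthickening (isClosed_stepLE hM.le) (fun n A hA _ => ?_)
    (finiteAwayFrom_limitMeasure hM.le (by linarith) hRV.p_nonneg hRV.p_le_one)
    (fun F hFc r s hF hs hsr => ?_) fun G hGo hsep s hs => ?_
  · rw [happly n hA]
    exact ENNReal.mul_lt_top ENNReal.ofReal_lt_top (measure_lt_top _ _)
  · simp only [happly _ hFc.measurableSet]
    exact hZ.limsup_le_cthickening hRV hα hm hM hF hs hsr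
  · simp only [happly _ hGo.measurableSet]
    exact hZ.le_liminf_compl_cthickening hRV hα hm hM hsep hs

end Walk

end HiddenLD

theorem corollary3p9 {Ω : Type*} [MeasurableSpace Ω] (P : Measure Ω) [IsProbabilityMeasure P]
    (Z : ℕ → Ω → ℝ) (hmeas : ∀ i, Measurable (Z i)) (hindep : iIndepFun Z P)
    (hident : ∀ i, IdentDistrib (Z i) (Z 0) P P)
    (α p : ℝ) (hα : 1 < α) (hRV : HiddenLD.IsRegVar P (Z 0) α p)
    (m : ℝ) (hm : m = ∫ ω, Z 0 ω ∂P)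
    (M : ℝ) (hM : 0 < M) (j : ℕ) (hj : 1 ≤ j) :
    Integrable (Z 0) P ∧
    HiddenLD.TendstoMO (HiddenLD.stepLE M m (j - 1))
      (fun n => ENNReal.ofReal (HiddenLD.rate P (Z 0) j n) •
        P.map (fun ω => HiddenLD.walkPath M n (fun k => Z k ω)))
      (HiddenLD.limitMeasure M m α p j) := by
  have hZ : HiddenLD.IsIID P Z := ⟨hmeas, hindep, hident⟩
  obtain ⟨j, rfl⟩ := Nat.exists_eq_add_of_le' hj
  exact ⟨hRV.integrable (hmeas 0) hα, hZ.tendstoMO hRV hα hm hM⟩
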